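/- Let $(M,g)$ be a smooth Riemannian $n$-manifold and let $G(k,M)$ be the Grassmannian of oriented $k$-planes $\pi\subset T_xM$, $x\in M$. Let $\mathcal U\subseteq G(k,M)$ be a subset and $f:\mathcal U\to\mathbb R$ a function. Let $\alpha$ be an $f$-anisotropic calibration, i.e. a smooth $k$-form on $M$ with $d\alpha=0$ such that for every $\pi\in\mathcal U$ one has $\alpha|_\pi\le f(\pi)\,\mathrm{vol}_\pi$ (that is, $\alpha|_\pi=\lambda\,\mathrm{vol}_\pi$ with $\lambda\le f(\pi)$), where $\mathrm{vol}_\pi$ is the volume form induced on $\pi$ by $g$ and by the orientation. Let $\Sigma$ be a compact oriented smooth $k$-manifold without boundary. Let $\mathrm{Imm}_{\mathcal U}(\Sigma,M)$ be the set of smooth immersions $\iota:\Sigma\to M$ with $\iota_*(T_x\Sigma)\in\mathcal U$ for all $x\in\Sigma$, endowed with the $C^1$ topology, and set $$\mathrm{Vol}_f(\iota)=\int_\Sigma f(\iota_*(T\Sigma))\,\mathrm{vol}_{\iota^*g}$$ whenever the integral converges absolutely (which is automatic if $f$ is continuous). An immersion $\iota\in\mathrm{Imm}_{\mathcal U}(\Sigma,M)$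 is $f$-calibrated if $\alpha|_\pi=f(\pi)\,\mathrm{vol}_\pi$ for each of its oriented tangent planes $\pi=\iota_*(T_x\Sigma)$. Let $R$ be a commutative ring with a ring homomorphism $R\to\mathbb R$ (for instance $\mathbb Z$, $\mathbb Q$ or $\mathbb R$); homology is smooth singular homology with coefficients in $R$, and $\iota,\iota'$ are called homologous if $\iota_*[\Sigma]=\iota'_*[\Sigma]$ in $H_k(M;R)$, where $[\Sigma]$ is the fundamental class. Let $\iota\in\mathrm{Imm}_{\mathcal U}(\Sigma,M)$ be $f$-calibrated. Then $\mathrm{Vol}_f(\iota)$ is defined and: 1. $\iota$ minimizes $\mathrm{Vol}_f$ in its restricted homology class: $\mathrm{Vol}_f(\iota)\le\mathrm{Vol}_f(\iota')$ for every $\iota'\in\mathrm{Imm}_{\mathcal U}(\Sigma,M)$ homologous to $\iota$ for which $\mathrm{Vol}_f(\iota')$ is defined. 2. $\iota$ is a $C^1$-local minimum: there is a $C^1$-neighbourhood of $\iota$ in $\mathrm{Imm}_{\mathcal U}(\Sigma,M)$ such that $\mathrm{Vol}_f(\iota)\le\mathrm{Vol}_f(\iota')$ for every $\iota'$ in it for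 which $\mathrm{Vol}_f(\iota')$ is defined. 3. The minimum value is topologically determined: it is the pairing of the de Rham class $[\alpha]$ with the homology class $\iota_*[\Sigma]$. That is, for every smooth closed $k$-form $\beta$ such that $\beta-\alpha$ is exact, $\mathrm{Vol}_f(\iota)=\int_\Sigma\iota^*\beta$, and $\mathrm{Vol}_f(\iota)=\int_z\beta$ for every smooth singular cycle $z$ in $M$ representing $\iota_*[\Sigma]$. -/

import Mathlib

open Set Filter Topology MeasureTheory
open scoped Manifold ContDiff

noncomputable section

namespace AnisotropicCalibration

/-! ## Orientations and frames -/

/-- The sign (`1`, `-1`, or `0` if `v` is linearly dependent) of a frame `v` with respect to an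
orientation. `o.someVector` is any alternating form representing the orientation; the sign does
not depend on which one. For `k = 0` this is the sign of an oriented point. -/
def frameSign {k : ℕ} {V : Type*} [AddCommGroup V] [Module ℝ V]
    (o : Orientation ℝ V (Fin k)) (v : Fin k → V) : ℝ :=
  ((SignType.sign (o.someVector v) : SignType) : ℝ)

section Manifold

variable {k : ℕ} {S : Type*} [TopologicalSpace S] [ChartedSpace (EuclideanSpace ℝ (Fin k)) S]

/-- The coordinate frame `∂₁, …, ∂ₖ` of the chart `φ` at the point with coordinates `y`. -/
def coordFrame (φ : OpenPartialHomeomorph S (EuclideanSpace ℝ (Fin k)))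
    (y : EuclideanSpace ℝ (Fin k)) : Fin k → TangentSpace (𝓡 k) (φ.symm y) :=
  fun i => mfderiv (𝓡 k) (𝓡 k) φ.symm y (EuclideanSpace.single i (1 : ℝ))

variable (k S) in
/-- An orientation of a smooth `k`-manifold: an orientation of every tangent space, such that the
sign of the coordinate frame of every smooth chart is continuous (hence locally constant). -/
structure ManifoldOrientation where
  /-- The orientation of the tangent space at `x`. -/
  at_ (x : S) : Orientation ℝ (TangentSpace (𝓡 k) x) (Fin k)
  continuousOn_sign : ∀ φ ∈ IsManifold.maximalAtlas (𝓡 k) ∞ S,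
    ContinuousOn (fun y => frameSign (at_ (φ.symm y)) (coordFrame φ y)) φ.target

/-! ## Integration of `k`-forms over a compact oriented `k`-manifold

A `k`-form on `S` (with no regularity required) is given by its values
`θ x (v₁, …, vₖ)` on `k`-tuples of tangent vectors. -/

variable (k S) in
/-- A smooth partition of unity subordinate to the atlas of preferred charts. -/
def chartPartition [IsManifold (𝓡 k) ∞ S] [T2Space S] [CompactSpace S] :
    SmoothPartitionOfUnity S (𝓡 k) S univ :=
  (SmoothPartitionOfUnity.exists_isSubordinate_chartAt_source (𝓡 k) S).choose

lemma chartPartition_isSubordinate [IsManifold (𝓡 k) ∞ S] [T2Space S] [CompactSpace S] :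
    (chartPartition k S).IsSubordinate
      (fun x => (chartAt (EuclideanSpace ℝ (Fin k)) x).source) :=
  (SmoothPartitionOfUnity.exists_isSubordinate_chartAt_source (𝓡 k) S).choose_spec

/-- The expression of `ρᵢ θ` in the `i`-th chart `φᵢ`: this is
`± ρᵢ θ(∂₁, …, ∂ₖ)`, with sign `+` where the chart is positively oriented, `-` where it is
negatively oriented. -/
def localIntegrand [IsManifold (𝓡 k) ∞ S] [T2Space S] [CompactSpace S]
    (o : ManifoldOrientation k S) (θ : ∀ x : S, (Fin k → TangentSpace (𝓡 k) x) → ℝ) (i : S)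
    (y : EuclideanSpace ℝ (Fin k)) : ℝ :=
  let φ := chartAt (EuclideanSpace ℝ (Fin k)) i
  chartPartition k S i (φ.symm y) *
    (frameSign (o.at_ (φ.symm y)) (coordFrame φ y) * θ (φ.symm y) (coordFrame φ y))

/-- The `k`-form `θ` is (absolutely) integrable on `S`. -/
def FormIntegrable [IsManifold (𝓡 k) ∞ S] [T2Space S] [CompactSpace S]
    (o : ManifoldOrientation k S) (θ : ∀ x : S, (Fin k → TangentSpace (𝓡 k) x) → ℝ) : Prop :=
  ∀ i : S, IntegrableOn (localIntegrand o θ i) (chartAt (EuclideanSpace ℝ (Fin k)) i).target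

/-- The integral `∫_S θ` of a `k`-form over a compact oriented `k`-manifold. The sum has only
finitely many non-zero terms, since `S` is compact. -/
def formIntegral [IsManifold (𝓡 k) ∞ S] [T2Space S] [CompactSpace S]
    (o : ManifoldOrientation k S) (θ : ∀ x : S, (Fin k → TangentSpace (𝓡 k) x) → ℝ) : ℝ :=
  ∑ᶠ i : S, ∫ y in (chartAt (EuclideanSpace ℝ (Fin k)) i).target, localIntegrand o θ i y

end Manifold

/-! ## Differential forms -/

section Forms

variable {k n : ℕ} {M : Type*} [TopologicalSpace M] [ChartedSpace (EuclideanSpace ℝ (Fin n)) M]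

variable (k n M) in
/-- Differential `k`-forms on the `n`-manifold `M` (with no regularity required). -/
abbrev DiffForm : Type _ := ∀ x : M, (TangentSpace (𝓡 n) x) [⋀^Fin k]→L[ℝ] ℝ

/-- The expression `(φ⁻¹)^* α` of a form in a chart `φ`. -/
def DiffForm.inChart (α : DiffForm k n M)
    (φ : OpenPartialHomeomorph M (EuclideanSpace ℝ (Fin n))) (y : EuclideanSpace ℝ (Fin n)) :
    (EuclideanSpace ℝ (Fin n)) [⋀^Fin k]→L[ℝ] ℝ :=
  (α (φ.symm y)).compContinuousLinearMap (mfderiv (𝓡 n) (𝓡 n) φ.symm y)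

/-- Smoothness of a form, tested in all smooth charts. -/
def DiffForm.IsSmooth (α : DiffForm k n M) : Prop :=
  ∀ φ ∈ IsManifold.maximalAtlas (𝓡 n) ∞ M, ContDiffOn ℝ ∞ (α.inChart φ) φ.target

/-- `dη = θ`, tested in all smooth charts. -/
def DiffForm.HasExtDeriv (η : DiffForm k n M) (θ : DiffForm (k + 1) n M) : Prop :=
  ∀ φ ∈ IsManifold.maximalAtlas (𝓡 n) ∞ M, ∀ y ∈ φ.target,
    extDeriv (η.inChart φ) y = θ.inChart φ y

/-- `dα = 0`. -/
def DiffForm.IsClosed (α : DiffForm k n M) : Prop := α.HasExtDeriv 0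

/-- `θ = dη` for a smooth `(k-1)`-form `η`; the only exact `0`-form is zero. -/
def DiffForm.IsExact : {k : ℕ} → DiffForm k n M → Prop
  | 0, θ => θ = 0
  | _ + 1, θ => ∃ η : DiffForm _ n M, η.IsSmooth ∧ η.HasExtDeriv θ

/-- The pullback `ι^* α`, as a form on `S` given by its values on tuples of vectors. -/
def DiffForm.pullback {m : ℕ} {S : Type*} [TopologicalSpace S]
    [ChartedSpace (EuclideanSpace ℝ (Fin m)) S] (α : DiffForm k n M) (ι : S → M) (x : S)
    (v : Fin k → TangentSpace (𝓡 m) x) : ℝ :=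
  α (ι x) (fun i => mfderiv (𝓡 m) (𝓡 n) ι x (v i))

end Forms

/-! ## Smooth singular homology -/

/-- The standard simplex `{y ∈ ℝᵖ | yᵢ ≥ 0, ∑ yᵢ ≤ 1}`. -/
def solidSimplex (p : ℕ) : Set (Fin p → ℝ) := {y | (∀ i, 0 ≤ y i) ∧ ∑ i, y i ≤ 1}

/-- The affine embedding of the standard `p`-simplex as the `j`-th face of the standard
`(p+1)`-simplex, i.e. the face opposite to the `j`-th vertex (the vertices being
`0, e₁, …, eₚ₊₁`). -/
def faceMap (p : ℕ) (j : Fin (p + 2)) (y : Fin p → ℝ) : Fin (p + 1) → ℝ :=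
  Fin.cases (motive := fun _ => Fin (p + 1) → ℝ)
    (Fin.cons (α := fun _ => ℝ) (1 - ∑ i, y i) y)
    (fun i => Fin.insertNth (α := fun _ => ℝ) i 0 y) j

lemma faceMap_mem (p : ℕ) (j : Fin (p + 2)) {y : Fin p → ℝ} (hy : y ∈ solidSimplex p) :
    faceMap p j y ∈ solidSimplex (p + 1) := by
  obtain ⟨h0, h1⟩ := hy
  refine Fin.cases ?_ (fun i => ?_) j
  · refine ⟨fun l => ?_, ?_⟩
    · refine Fin.cases ?_ (fun l => ?_) l
      · simp [faceMap, h1]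
      · simp [faceMap, h0]
    · simp [faceMap, Fin.sum_univ_succ]
  · refine ⟨fun l => ?_, ?_⟩
    · refine Fin.succAboveCases i ?_ (fun l => ?_) l
      · simp [faceMap]
      · simp [faceMap, h0]
    · rw [Fin.sum_univ_succAbove _ i]
      simpa [faceMap] using h1

lemma contDiff_faceMap (p : ℕ) (j : Fin (p + 2)) : ContDiff ℝ ∞ (faceMap p j) := by
  rw [contDiff_pi]
  intro l
  refine Fin.cases ?_ (fun i => ?_) j
  · refine Fin.cases ?_ (fun l => ?_) l
    · simp only [faceMap, Fin.cases_zero, Fin.cons_zero]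
      fun_prop
    · simp only [faceMap, Fin.cases_zero, Fin.cons_succ]
      fun_prop
  · refine Fin.succAboveCases i ?_ (fun l => ?_) l
    · simp only [faceMap, Fin.cases_succ, Fin.insertNth_apply_same]
      fun_prop
    · simp only [faceMap, Fin.cases_succ, Fin.insertNth_apply_succAbove]
      fun_prop

section Homology

variable {m n : ℕ} {S M : Type*}
  [TopologicalSpace S] [ChartedSpace (EuclideanSpace ℝ (Fin m)) S]
  [TopologicalSpace M] [ChartedSpace (EuclideanSpace ℝ (Fin n)) M]

variable (n M) in
/-- A smooth singular `p`-simplex in `M`: a map from the standard simplex that extends to a smooth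
map on a neighbourhood of the simplex in `ℝᵖ`. -/
@[ext]
structure SmoothSimplex (p : ℕ) where
  /-- The underlying map. -/
  toFun : solidSimplex p → M
  exists_extension : ∃ (V : Set (Fin p → ℝ)) (F : (Fin p → ℝ) → M), IsOpen V ∧
    solidSimplex p ⊆ V ∧ ContMDiffOn 𝓘(ℝ, Fin p → ℝ) (𝓡 n) ∞ F V ∧
    ∀ y : solidSimplex p, F y = toFun y

namespace SmoothSimplex

variable {p : ℕ}

/-- A smooth extension of `σ` to a neighbourhood of the standard simplex. Its values and its
derivatives at points of the standard simplex do not depend on the choice. -/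
def extend (σ : SmoothSimplex n M p) : (Fin p → ℝ) → M := σ.exists_extension.choose_spec.choose

/-- The `j`-th face of a smooth singular simplex. -/
def face (σ : SmoothSimplex n M (p + 1)) (j : Fin (p + 2)) : SmoothSimplex n M p where
  toFun y := σ.toFun ⟨faceMap p j y, faceMap_mem p j y.2⟩
  exists_extension := by
    obtain ⟨V, F, hV, hsub, hF, hFσ⟩ := σ.exists_extension
    refine ⟨faceMap p j ⁻¹' V, F ∘ faceMap p j, hV.preimage (contDiff_faceMap p j).continuous,
      fun y hy => hsub (faceMap_mem p j hy), ?_, fun y => hFσ ⟨_, faceMap_mem p j y.2⟩⟩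
    exact hF.comp (contDiff_faceMap p j).contMDiff.contMDiffOn (fun y hy => hy)

/-- The composition of a smooth singular simplex with a smooth map. -/
def push (h : C^∞⟮𝓡 m, S; 𝓡 n, M⟯) (σ : SmoothSimplex m S p) : SmoothSimplex n M p where
  toFun y := h (σ.toFun y)
  exists_extension := by
    obtain ⟨V, F, hV, hsub, hF, hFσ⟩ := σ.exists_extension
    exact ⟨V, h ∘ F, hV, hsub, h.contMDiff.comp_contMDiffOn hF, fun y => by simp [hFσ y]⟩

/-- The integral `∫_σ β` of a `p`-form over a smooth singular `p`-simplex. -/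
def integral (σ : SmoothSimplex n M p) (β : DiffForm p n M) : ℝ :=
  ∫ y in solidSimplex p, β (σ.extend y)
    (fun i => mfderiv 𝓘(ℝ, Fin p → ℝ) (𝓡 n) σ.extend y (Pi.single i (1 : ℝ) : Fin p → ℝ))

end SmoothSimplex

variable (R : Type*) [CommRing R]

variable (n M) in
/-- Smooth singular `p`-chains in `M` with coefficients in `R`. -/
abbrev Chain (p : ℕ) : Type _ := SmoothSimplex n M p →₀ R

variable {R}

/-- The boundary operator `∂σ = ∑ⱼ (-1)ʲ σ ∘ faceⱼ`. -/
def boundary {p : ℕ} : Chain n M R (p + 1) →ₗ[R] Chain n M R p :=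
  Finsupp.linearCombination R
    (fun σ => ∑ j : Fin (p + 2), Finsupp.single (σ.face j) ((-1 : R) ^ (j : ℕ)))

/-- `∂c = 0`; every `0`-chain is a cycle. -/
def IsCycle : {p : ℕ} → Chain n M R p → Prop
  | 0, _ => True
  | _ + 1, c => boundary c = 0

/-- `c` is a boundary; cycles are homologous when their difference is a boundary. -/
def IsBoundary {p : ℕ} (c : Chain n M R p) : Prop := ∃ b : Chain n M R (p + 1), boundary b = c

/-- The map `h_#` induced on chains by a smooth map `h`. -/
def pushChain {p : ℕ} (h : C^∞⟮𝓡 m, S; 𝓡 n, M⟯) (c : Chain m S R p) : Chain n M R p :=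
  Finsupp.mapDomain (SmoothSimplex.push h) c

/-- The integral `∫_z β` of a form over a smooth singular chain. -/
def chainIntegral [Algebra R ℝ] {p : ℕ} (z : Chain n M R p) (β : DiffForm p n M) : ℝ :=
  z.sum (fun σ r => algebraMap R ℝ r * σ.integral β)

/-- `c` is a cycle representing the fundamental class of the oriented `m`-manifold `S`: it is an
`m`-cycle whose image in `H_m(S, S ∖ {x}; R)` is, for every point `x`, the generator determined by
the orientation. That generator is represented by `ε σ` for any injective smooth simplex `σ` which
maps an interior point `y` of the standard simplex to `x`, with invertible differential at `y` whose
orientation sign is `ε`. Equality of the classes in `H_m(S, S ∖ {x}; R)` means that `c - ε σ` is the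
sum of a boundary and of a chain in `S ∖ {x}`. (One can take `ε = 1`, except when `m = 0` and
`x` is a negatively oriented point.) -/
def IsFundamentalCycle (o : ManifoldOrientation m S) (c : Chain m S R m) : Prop :=
  IsCycle c ∧ ∀ x : S, ∃ (σ : SmoothSimplex m S m) (y : Fin m → ℝ) (ε : ℤˣ),
    Function.Injective σ.toFun ∧ y ∈ interior (solidSimplex m) ∧ σ.extend y = x ∧
    frameSign (o.at_ (σ.extend y))
      (fun i => mfderiv 𝓘(ℝ, Fin m → ℝ) (𝓡 m) σ.extend y (Pi.single i (1 : ℝ) : Fin m → ℝ)) =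
        ((ε : ℤ) : ℝ) ∧
    ∃ (b : Chain m S R (m + 1)) (c' : Chain m S R m),
      (∀ τ ∈ c'.support, ∀ t, τ.toFun t ≠ x) ∧
      c = Finsupp.single σ ((ε : ℤ) : R) + boundary b + c'

variable (R)

/-- The smooth maps `ι`, `ι'` of the compact oriented manifold `S` into `M` are homologous:
`ι_*[S] = ι'_*[S]` in the homology of `M` with coefficients in `R`. -/
def HomologousMaps (o : ManifoldOrientation m S) (ι ι' : C^∞⟮𝓡 m, S; 𝓡 n, M⟯) : Prop :=
  ∃ c : Chain m S R m, IsFundamentalCycle o c ∧ IsBoundary (pushChain ι c - pushChain ι' c)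

variable {R}

/-- The chain `z` in `M` is a cycle representing the homology class `ι_*[S]`. -/
def RepresentsClass (o : ManifoldOrientation m S) (ι : C^∞⟮𝓡 m, S; 𝓡 n, M⟯)
    (z : Chain n M R m) : Prop :=
  ∃ c : Chain m S R m, IsFundamentalCycle o c ∧ IsBoundary (z - pushChain ι c)

end Homology

/-! ## The oriented Grassmannian and anisotropic calibrations -/

section Calibration

variable {k n : ℕ} {S M : Type*}
  [TopologicalSpace S] [ChartedSpace (EuclideanSpace ℝ (Fin k)) S]
  [TopologicalSpace M] [ChartedSpace (EuclideanSpace ℝ (Fin n)) M]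

variable (k n M) in
/-- The oriented Grassmannian `G(k, M)`: oriented `k`-planes in the tangent spaces of `M`. -/
structure OrientedPlane where
  /-- The base point. -/
  base : M
  /-- The underlying plane. -/
  plane : Submodule ℝ (TangentSpace (𝓡 n) base)
  finrank_eq : Module.finrank ℝ plane = k
  /-- The orientation of the plane. -/
  orientation : Orientation ℝ plane (Fin k)

/-- A smooth Riemannian metric on `M`. -/
abbrev Metric (n : ℕ) (M : Type*) [TopologicalSpace M]
    [ChartedSpace (EuclideanSpace ℝ (Fin n)) M] [IsManifold (𝓡 n) ∞ M] : Type _ :=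
  Bundle.ContMDiffRiemannianMetric (𝓡 n) ∞ (EuclideanSpace ℝ (Fin n))
    (fun x : M => TangentSpace (𝓡 n) x)

/-- The Gram matrix `g(vᵢ, vⱼ)`. -/
def gram [IsManifold (𝓡 n) ∞ M] (g : Metric n M) {x : M} (v : Fin k → TangentSpace (𝓡 n) x) :
    Matrix (Fin k) (Fin k) ℝ :=
  Matrix.of fun i j => g.inner x (v i) (v j)

/-- The volume form `vol_π` of an oriented plane `π`, evaluated on vectors of `π`. -/
def planeVolume [IsManifold (𝓡 n) ∞ M] (g : Metric n M) (π : OrientedPlane k n M)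
    (v : Fin k → π.plane) : ℝ :=
  frameSign π.orientation v *
    √(gram g (fun i => (v i : TangentSpace (𝓡 n) π.base))).det

/-- `α` is an `f`-anisotropic calibration: a smooth `k`-form with `dα = 0` such that, for all
`π ∈ U`, `α|_π ≤ f(π) vol_π`, i.e. `α|_π = c vol_π` with `c ≤ f(π)`. -/
structure IsAnisotropicCalibration [IsManifold (𝓡 n) ∞ M] (g : Metric n M)
    (U : Set (OrientedPlane k n M)) (f : U → ℝ) (α : DiffForm k n M) : Prop where
  isSmooth : α.IsSmooth
  le_vol : ∀ π : U, ∃ c : ℝ, c ≤ f π ∧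
    ∀ v : Fin k → π.1.plane, α π.1.base (fun i => v i) = c * planeVolume g π.1 v
  isClosed : α.IsClosed

/-- The `f`-calibrated planes: those `π ∈ U` with `α|_π = f(π) vol_π`. -/
def calibratedPlanes [IsManifold (𝓡 n) ∞ M] (g : Metric n M)
    (U : Set (OrientedPlane k n M)) (f : U → ℝ) (α : DiffForm k n M) :
    Set (OrientedPlane k n M) :=
  {π | ∃ h : π ∈ U,
    ∀ v : Fin k → π.plane, α π.base (fun i => v i) = f ⟨π, h⟩ * planeVolume g π v}

/-- The oriented tangent plane `ι_*(T_x S)` of a map that is immersive at `x`. -/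
def tangentPlane (o : ManifoldOrientation k S) (ι : S → M) (x : S)
    (h : Function.Injective (mfderiv (𝓡 k) (𝓡 n) ι x)) : OrientedPlane k n M where
  base := ι x
  plane := LinearMap.range
    (mfderiv (𝓡 k) (𝓡 n) ι x : TangentSpace (𝓡 k) x →ₗ[ℝ] TangentSpace (𝓡 n) (ι x))
  finrank_eq :=
    (LinearMap.finrank_range_of_inj
      (f := (mfderiv (𝓡 k) (𝓡 n) ι x : TangentSpace (𝓡 k) x →ₗ[ℝ] TangentSpace (𝓡 n) (ι x)))
      h).trans (finrank_euclideanSpace_fin (𝕜 := ℝ) (n := k))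
  orientation := Orientation.map (Fin k)
    (LinearEquiv.ofInjective
      (mfderiv (𝓡 k) (𝓡 n) ι x : TangentSpace (𝓡 k) x →ₗ[ℝ] TangentSpace (𝓡 n) (ι x)) h)
    (o.at_ x)

/-- `Imm_U(S, M)`: the smooth immersions of `S` into `M` whose oriented tangent planes belong
to `U`. -/
structure Imm (o : ManifoldOrientation k S) (U : Set (OrientedPlane k n M)) where
  /-- The underlying smooth map. -/
  map : C^∞⟮𝓡 k, S; 𝓡 n, M⟯
  injective_mfderiv : ∀ x, Function.Injective (mfderiv (𝓡 k) (𝓡 n) map x)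
  tangentPlane_mem : ∀ x, tangentPlane o map x (injective_mfderiv x) ∈ U

variable {o : ManifoldOrientation k S} {U : Set (OrientedPlane k n M)}

/-- The oriented tangent plane of an immersion in `Imm_U(S, M)`, as an element of `U`. -/
def Imm.plane (ι : Imm o U) (x : S) : U :=
  ⟨tangentPlane o ι.map x (ι.injective_mfderiv x), ι.tangentPlane_mem x⟩

/-- The `C¹` topology on `Imm_U(S, M)`: the compact-open topology on the differentials
`Tι : TS → TM`. -/
instance [IsManifold (𝓡 k) ∞ S] [IsManifold (𝓡 n) ∞ M] : TopologicalSpace (Imm o U) :=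
  TopologicalSpace.induced
    (fun ι => (⟨tangentMap (𝓡 k) (𝓡 n) ι.map,
      ι.map.contMDiff.continuous_tangentMap (by simp)⟩ :
        C(TangentBundle (𝓡 k) S, TangentBundle (𝓡 n) M)))
    inferInstance

/-- The volume form `vol_{ι^*g}` of the metric `ι^* g` on the oriented manifold `S`. -/
def inducedVolume [IsManifold (𝓡 n) ∞ M] (g : Metric n M) (o : ManifoldOrientation k S)
    (ι : S → M) (x : S) (v : Fin k → TangentSpace (𝓡 k) x) : ℝ :=
  frameSign (o.at_ x) v * √(gram g (fun i => mfderiv (𝓡 k) (𝓡 n) ι x (v i))).det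

/-- The integrand `f(ι_*(TS)) vol_{ι^*g}` of the functional `Vol_f`. -/
def Imm.anisotropicVolume [IsManifold (𝓡 n) ∞ M] (g : Metric n M) (f : U → ℝ) (ι : Imm o U)
    (x : S) (v : Fin k → TangentSpace (𝓡 k) x) : ℝ :=
  f (ι.plane x) * inducedVolume g o ι.map x v

variable [IsManifold (𝓡 k) ∞ S] [T2Space S] [CompactSpace S] [IsManifold (𝓡 n) ∞ M]

/-- The integral defining `Vol_f(ι)` converges. This is automatic for continuous `f`. -/
def VolDefined (g : Metric n M) (f : U → ℝ) (ι : Imm o U) : Prop :=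
  FormIntegrable o (ι.anisotropicVolume g f)

/-- The functional `Vol_f(ι) = ∫_S f(ι_*(TS)) vol_{ι^*g}`. -/
def volF (g : Metric n M) (f : U → ℝ) (ι : Imm o U) : ℝ :=
  formIntegral o (ι.anisotropicVolume g f)

end Calibration

end AnisotropicCalibration

end

open AnisotropicCalibration

/-!
For every immersion `ι'` in `Imm_U(S, M)`, the pointwise inequality `α|_π ≤ f(π) vol_π` integrates
to `∫_S ι'^* α ≤ Vol_f(ι')` (`formIntegral_pullback_le_volF`), with equality when `ι'` is calibrated
(`Imm.anisotropicVolume_eq_pullback`). A calibrated `ι` therefore minimizes `Vol_f` among all `ι'`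
with `∫_S ι'^* α = ∫_S ι^* α`, and all assertions reduce to facts about integrals of closed forms:
they depend only on the homology class (`HomologousMaps.formIntegral_eq`,
`RepresentsClass.formIntegral_eq`), only on the cohomology class of the form
(`formIntegral_eq_of_isExact_sub`), and are locally constant in `ι`
(`Imm.eventually_formIntegral_eq`).

All of these rest on Stokes' theorem on a box of `ℝᵖ`, which is the divergence theorem
(`integral_extDeriv_Icc`).

* Chains: a cube collapses onto a simplex by `cubeMap`. Its faces are mapped to the faces of the
  simplex or are collapsed, so that Stokes' theorem on the cube gives Stokes' theorem for closed
  forms on smooth singular simplices (`sum_integral_face_eq_zero`, `chainIntegral_boundary`).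
* Fundamental cycles: near any given point, a fundamental cycle is an embedded simplex plus a
  boundary plus simplices away from the point. Forms of top degree are closed
  (`PullDifferentiable.pullClosed_of_top`), so the boundary does not contribute, and a partition of
  unity gives `∫_c θ = ∫_S θ` (`chainIntegral_eq_formIntegral`).
* Exact forms: a partition of unity subordinate to boxes gives Stokes' theorem on the closed
  manifold `S` (`formIntegral_eq_zero_of_hasExtDeriv`).
* Nearby immersions: the `C¹` topology is finer than uniform convergence, so it suffices to
  consider uniformly close maps. One of them is moved to the other box by box, along
  segments in a chart of `M` cut off by a bump function (`blend`). Such a move sweeps out the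
  image of a prism; Stokes' theorem on it, together with `dα = 0`, shows that the integral does
  not change (`setIntegral_pull_blend`, `exists_dist_formIntegral_eq`). This argument needs neither
  a tubular neighbourhood nor a fundamental cycle.

Forms are handled through their pullbacks `pull F η` under maps `F` from normed spaces, where
Mathlib's exterior derivative is available.
-/

open AnisotropicCalibration

namespace AnisotropicCalibration

noncomputable section

/-! ### Pulling back forms to normed spaces -/

section Pull

variable {p n m : ℕ} {M : Type*} [TopologicalSpace M] [ChartedSpace (EuclideanSpace ℝ (Fin n)) M]
  {S : Type*} [TopologicalSpace S] [ChartedSpace (EuclideanSpace ℝ (Fin m)) S]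
  {E E' : Type*} [NormedAddCommGroup E] [NormedSpace ℝ E] [NormedAddCommGroup E'] [NormedSpace ℝ E']

/-- The pullback `F^* η` of a form on `M` under a map `F` from a normed space to `M`. -/
def pull (F : E → M) (η : DiffForm p n M) (y : E) : E [⋀^Fin p]→L[ℝ] ℝ :=
  (η (F y)).compContinuousLinearMap (mfderiv 𝓘(ℝ, E) (𝓡 n) F y)

lemma pull_apply (F : E → M) (η : DiffForm p n M) (y : E) (v : Fin p → E) :
    pull F η y v = η (F y) (fun i => mfderiv 𝓘(ℝ, E) (𝓡 n) F y (v i)) := rfl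

lemma inChart_eq_pull (η : DiffForm p n M)
    (φ : OpenPartialHomeomorph M (EuclideanSpace ℝ (Fin n))) : η.inChart φ = pull φ.symm η := rfl

lemma pull_congr {F F' : E → M} {y : E} (h : F =ᶠ[𝓝 y] F') (η : DiffForm p n M) :
    pull F η y = pull F' η y := by
  have h0 : F y = F' y := h.eq_of_nhds
  have h1 : (mfderiv 𝓘(ℝ, E) (𝓡 n) F y : E →L[ℝ] EuclideanSpace ℝ (Fin n)) =
    (mfderiv 𝓘(ℝ, E) (𝓡 n) F' y : E →L[ℝ] EuclideanSpace ℝ (Fin n)) := h.mfderiv_eq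
  ext v
  have key : ∀ (q q' : M) (_ : q = q') (A A' : E →L[ℝ] EuclideanSpace ℝ (Fin n)), A = A' →
      (η q) (fun i => A (v i)) = (η q') (fun i => A' (v i)) := by
    rintro q _ rfl A _ rfl; rfl
  exact key _ _ h0 _ _ h1

lemma pull_comp {F : E → M} {g : E' → E} {y : E'}
    (hF : MDifferentiableAt 𝓘(ℝ, E) (𝓡 n) F (g y)) (hg : DifferentiableAt ℝ g y)
    (η : DiffForm p n M) :
    pull (F ∘ g) η y = (pull F η (g y)).compContinuousLinearMap (fderiv ℝ g y) := by
  ext v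
  rw [pull_apply, ContinuousAlternatingMap.compContinuousLinearMap_apply, pull_apply,
    mfderiv_comp y hF hg.mdifferentiableAt, mfderiv_eq_fderiv]
  rfl

/-- The pullback `ι^* η` under a map of manifolds, as a differential form: its values are those of
`DiffForm.pullback`. -/
def pullForm (ι : S → M) (η : DiffForm p n M) : DiffForm p m S :=
  fun x => (η (ι x)).compContinuousLinearMap (mfderiv (𝓡 m) (𝓡 n) ι x)

lemma pull_pullForm {F : E → S} {ι : S → M} {y : E}
    (hι : MDifferentiableAt (𝓡 m) (𝓡 n) ι (F y)) (hF : MDifferentiableAt 𝓘(ℝ, E) (𝓡 m) F y)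
    (η : DiffForm p n M) : pull F (pullForm ι η : DiffForm p m S) y = pull (ι ∘ F) η y := by
  ext v
  rw [pull_apply, pull_apply, mfderiv_comp y hι hF]
  rfl

variable [IsManifold (𝓡 n) ∞ M]

/-- Near a point, the pullback under `F` is the pullback, under the coordinate expression of `F`,
of the coordinate expression of the form. -/
lemma pull_eventuallyEq_inChart {F : E → M} {y : E} (hF : ContMDiffAt 𝓘(ℝ, E) (𝓡 n) ∞ F y)
    (η : DiffForm p n M) :
    ContDiffAt ℝ ∞ (fun z => chartAt (EuclideanSpace ℝ (Fin n)) (F y) (F z)) y ∧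
    ∀ᶠ z in 𝓝 y, pull F η z =
      (η.inChart (chartAt (EuclideanSpace ℝ (Fin n)) (F y))
        (chartAt (EuclideanSpace ℝ (Fin n)) (F y) (F z))).compContinuousLinearMap
        (fderiv ℝ (fun z => chartAt (EuclideanSpace ℝ (Fin n)) (F y) (F z)) z) := by
  set ψ := chartAt (EuclideanSpace ℝ (Fin n)) (F y) with hψ
  have hmem : ψ ∈ IsManifold.maximalAtlas (𝓡 n) ∞ M := IsManifold.chart_mem_maximalAtlas _
  have hsrc : F y ∈ ψ.source := mem_chart_source _ _
  have h1 : ContMDiffAt (𝓡 n) (𝓡 n) ∞ ψ (F y) := contMDiffAt_of_mem_maximalAtlas hmem hsrc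
  have h2 : ContDiffAt ℝ ∞ (fun z => ψ (F z)) y := (h1.comp y hF).contDiffAt
  refine ⟨h2, ?_⟩
  have h3 : ∀ᶠ z in 𝓝 y, ContDiffAt ℝ 1 (fun z => ψ (F z)) z :=
    (h2.of_le (by norm_cast)).eventually (by simp)
  have h4 : ∀ᶠ z in 𝓝 y, F z ∈ ψ.source :=
    hF.continuousAt.eventually (ψ.open_source.mem_nhds hsrc)
  filter_upwards [h3, h4.eventually_nhds] with z hz hz'
  have hz0 : F z ∈ ψ.source := hz'.self_of_nhds
  have hsymm : MDifferentiableAt (𝓡 n) (𝓡 n) ψ.symm (ψ (F z)) :=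
    (contMDiffAt_symm_of_mem_maximalAtlas hmem (ψ.map_source hz0)).mdifferentiableAt (by simp)
  rw [inChart_eq_pull, ← pull_comp (F := ψ.symm) (g := fun z => ψ (F z)) hsymm
    (hz.differentiableAt (by simp))]
  apply pull_congr
  filter_upwards [hz'] with w hw
  simp [ψ.left_inv hw]

lemma IsSmooth.differentiableAt_pull {F : E → M} {y : E} {η : DiffForm p n M} (hη : η.IsSmooth)
    (hF : ContMDiffAt 𝓘(ℝ, E) (𝓡 n) ∞ F y) : DifferentiableAt ℝ (pull F η) y := by
  obtain ⟨h1, h2⟩ := pull_eventuallyEq_inChart hF η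
  have hsrc : F y ∈ (chartAt (EuclideanSpace ℝ (Fin n)) (F y)).source := mem_chart_source _ _
  have h3 := (hη _ (IsManifold.chart_mem_maximalAtlas (I := 𝓡 n) (n := ∞) (F y))).contDiffAt
    ((chartAt (EuclideanSpace ℝ (Fin n)) (F y)).open_target.mem_nhds
      ((chartAt (EuclideanSpace ℝ (Fin n)) (F y)).map_source hsrc))
  refine DifferentiableAt.congr_of_eventuallyEq ?_ h2
  refine DifferentiableAt.continuousAlternatingMapCompContinuousLinearMap ?_ ?_
  · exact (h3.differentiableAt (by simp)).comp y (h1.differentiableAt (by simp))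
  · exact (h1.fderiv_right (m := 1) (by norm_cast)).differentiableAt (by simp)

/-- The exterior derivative commutes with pullbacks. -/
lemma HasExtDeriv.extDeriv_pull {F : E → M} {y : E} {η : DiffForm p n M}
    {θ : DiffForm (p + 1) n M} (hη : η.IsSmooth) (hθ : η.HasExtDeriv θ)
    (hF : ContMDiffAt 𝓘(ℝ, E) (𝓡 n) ∞ F y) : extDeriv (pull F η) y = pull F θ y := by
  obtain ⟨h1, h2⟩ := pull_eventuallyEq_inChart hF η
  obtain ⟨-, h2'⟩ := pull_eventuallyEq_inChart hF θ
  have hsrc : F y ∈ (chartAt (EuclideanSpace ℝ (Fin n)) (F y)).source := mem_chart_source _ _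
  have ht := (chartAt (EuclideanSpace ℝ (Fin n)) (F y)).map_source hsrc
  have hm := IsManifold.chart_mem_maximalAtlas (I := 𝓡 n) (n := ∞) (F y)
  have h3 := (hη _ hm).contDiffAt
    ((chartAt (EuclideanSpace ℝ (Fin n)) (F y)).open_target.mem_nhds ht)
  rw [Filter.EventuallyEq.extDeriv_eq h2, h2'.self_of_nhds, ← hθ _ hm _ ht]
  exact extDeriv_pullback (h3.differentiableAt (by simp)) h1
    (by simpa using WithTop.coe_le_coe.2 (le_top : (2 : ℕ∞) ≤ ⊤))

lemma IsClosed.extDeriv_pull {F : E → M} {y : E} {η : DiffForm p n M}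
    (hη : η.IsSmooth) (hc : η.IsClosed)
    (hF : ContMDiffAt 𝓘(ℝ, E) (𝓡 n) ∞ F y) : extDeriv (pull F η) y = 0 :=
  (HasExtDeriv.extDeriv_pull hη hc hF).trans (by ext; rfl)

end Pull

/-! ### Stokes' theorem on a box -/

/-- The standard frame of `ℝᵖ`. -/
def stdFrame (p : ℕ) (i : Fin p) : Fin p → ℝ := Pi.single i 1

/-- Stokes' theorem on a box: the divergence theorem rewritten in terms of `extDeriv`. -/
lemma integral_extDeriv_Icc {p : ℕ} {a b : Fin (p + 1) → ℝ} (hab : a ≤ b)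
    {ζ : (Fin (p + 1) → ℝ) → (Fin (p + 1) → ℝ) [⋀^Fin p]→L[ℝ] ℝ}
    (hd : ∀ x ∈ Icc a b, DifferentiableAt ℝ ζ x)
    (hi : IntegrableOn (fun x => extDeriv ζ x (stdFrame (p + 1))) (Icc a b)) :
    ∫ x in Icc a b, extDeriv ζ x (stdFrame (p + 1)) =
      ∑ i : Fin (p + 1),
        ((∫ x in Icc (a ∘ i.succAbove) (b ∘ i.succAbove),
          (-1 : ℝ) ^ (i : ℕ) * ζ (i.insertNth (b i) x) (stdFrame (p + 1) ∘ i.succAbove)) -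
        ∫ x in Icc (a ∘ i.succAbove) (b ∘ i.succAbove),
          (-1 : ℝ) ^ (i : ℕ) * ζ (i.insertNth (a i) x) (stdFrame (p + 1) ∘ i.succAbove)) := by
  have hderiv : ∀ (i : Fin (p + 1)), ∀ x ∈ Icc a b, HasFDerivAt
      (fun y => (-1 : ℝ) ^ (i : ℕ) * ζ y (stdFrame (p + 1) ∘ i.succAbove))
      ((-1 : ℝ) ^ (i : ℕ) • fderiv ℝ (fun y => ζ y (stdFrame (p + 1) ∘ i.succAbove)) x) x := by
    intro i x hx
    have : DifferentiableAt ℝ (fun y => ζ y (stdFrame (p + 1) ∘ i.succAbove)) x :=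
      (hd x hx).continuousAlternatingMap_apply_const _
    exact this.hasFDerivAt.const_mul _
  have hdiv : ∀ x ∈ Icc a b, extDeriv ζ x (stdFrame (p + 1)) = ∑ i : Fin (p + 1),
      ((-1 : ℝ) ^ (i : ℕ) • fderiv ℝ (fun y => ζ y (stdFrame (p + 1) ∘ i.succAbove)) x)
        (Pi.single i 1) := by
    intro x hx
    rw [extDeriv_apply (hd x hx)]
    refine Finset.sum_congr rfl fun i _ => ?_
    rw [smul_apply, zsmul_eq_mul, smul_eq_mul]
    push_cast
    rfl
  rw [← integral_divergence_of_hasFDerivAt_off_countable' a b hab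
    (fun i y => (-1 : ℝ) ^ (i : ℕ) * ζ y (stdFrame (p + 1) ∘ i.succAbove))
    (fun i x => (-1 : ℝ) ^ (i : ℕ) • fderiv ℝ (fun y => ζ y (stdFrame (p + 1) ∘ i.succAbove)) x)
    ∅ countable_empty]
  · exact setIntegral_congr_fun measurableSet_Icc hdiv
  · exact fun i x hx => (hderiv i x hx).continuousAt.continuousWithinAt
  · intro x hx i
    refine hderiv i x ?_
    rw [← pi_univ_Icc]
    exact fun j hj => Ioo_subset_Icc_self (hx.1 j hj)
  · exact hi.congr_fun hdiv measurableSet_Icc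

/-- The signed face integrals of a closed form over the boundary of a box cancel. -/
lemma sum_face_integrals_eq_zero {p : ℕ} {a b : Fin (p + 1) → ℝ} (hab : a ≤ b)
    {ζ : (Fin (p + 1) → ℝ) → (Fin (p + 1) → ℝ) [⋀^Fin p]→L[ℝ] ℝ}
    (hd : ∀ x ∈ Icc a b, DifferentiableAt ℝ ζ x) (hc : ∀ x ∈ Icc a b, extDeriv ζ x = 0) :
      ∑ i : Fin (p + 1),
        ((∫ x in Icc (a ∘ i.succAbove) (b ∘ i.succAbove),
          (-1 : ℝ) ^ (i : ℕ) * ζ (i.insertNth (b i) x) (stdFrame (p + 1) ∘ i.succAbove)) -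
        ∫ x in Icc (a ∘ i.succAbove) (b ∘ i.succAbove),
          (-1 : ℝ) ^ (i : ℕ) * ζ (i.insertNth (a i) x) (stdFrame (p + 1) ∘ i.succAbove)) = 0 := by
  have h0 : ∀ x ∈ Icc a b, extDeriv ζ x (stdFrame (p + 1)) = 0 := by
    intro x hx; rw [hc x hx]; rfl
  rw [← integral_extDeriv_Icc hab hd, setIntegral_congr_fun measurableSet_Icc h0]
  · simp
  · exact (integrableOn_zero).congr_fun (fun x hx => (h0 x hx).symm) measurableSet_Icc

/-! ### The collapse of a cube onto a simplex -/

/-- The map collapsing the unit cube onto the standard simplex, whose `j`-th coordinate is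
`tⱼ ∏_{l > j} (1 - tₗ)`. -/
def cubeMap : (p : ℕ) → (Fin p → ℝ) → (Fin p → ℝ)
  | 0, t => t
  | p + 1, t => Fin.cons (t 0 * (1 - ∑ i, cubeMap p (Fin.tail t) i)) (cubeMap p (Fin.tail t))

lemma cubeMap_succ {p : ℕ} (t : Fin (p + 1) → ℝ) : cubeMap (p + 1) t =
    Fin.cons (t 0 * (1 - ∑ i, cubeMap p (Fin.tail t) i)) (cubeMap p (Fin.tail t)) := rfl

lemma contDiff_tail {p : ℕ} : ContDiff ℝ ∞ (fun t : Fin (p + 1) → ℝ => Fin.tail t) := by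
  rw [contDiff_pi]; intro i; exact contDiff_apply ℝ ℝ i.succ

lemma contDiff_cubeMap (p : ℕ) : ContDiff ℝ ∞ (cubeMap p) := by
  induction p with
  | zero => exact contDiff_id
  | succ p ih =>
    have h : ContDiff ℝ ∞ (fun t : Fin (p + 1) → ℝ => cubeMap p (Fin.tail t)) :=
      ih.comp contDiff_tail
    rw [contDiff_pi] at h ⊢
    intro i
    refine Fin.cases ?_ (fun i => ?_) i
    · simp only [cubeMap_succ, Fin.cons_zero]
      exact (contDiff_apply ℝ ℝ 0).mul (contDiff_const.sub (ContDiff.sum fun i _ => h i))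
    · simpa only [cubeMap_succ, Fin.cons_succ] using h i

lemma one_sub_sum_cubeMap {p : ℕ} (t : Fin p → ℝ) :
    1 - ∑ i, cubeMap p t i = ∏ i, (1 - t i) := by
  induction p with
  | zero => simp
  | succ p ih =>
    rw [cubeMap_succ, Fin.sum_cons, Fin.prod_univ_succ]
    have := ih (Fin.tail t)
    simp only [Fin.tail] at this ⊢
    rw [← this]; ring

lemma cubeMap_mem {p : ℕ} {t : Fin p → ℝ} (ht : t ∈ Icc (0 : Fin p → ℝ) 1) :
    cubeMap p t ∈ solidSimplex p := by
  refine ⟨?_, ?_⟩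
  · induction p with
    | zero => exact fun i => i.elim0
    | succ p ih =>
      have ht' : Fin.tail t ∈ Icc (0 : Fin p → ℝ) 1 := ⟨fun i => ht.1 i.succ, fun i => ht.2 i.succ⟩
      refine Fin.cases ?_ (fun i => ?_)
      · rw [cubeMap_succ, Fin.cons_zero, one_sub_sum_cubeMap]
        exact mul_nonneg (ht.1 0) (Finset.prod_nonneg fun i _ => sub_nonneg.2 (ht'.2 i))
      · rw [cubeMap_succ, Fin.cons_succ]
        exact ih ht' i
  · have := one_sub_sum_cubeMap t
    have h2 : 0 ≤ ∏ i, (1 - t i) := Finset.prod_nonneg fun i _ => sub_nonneg.2 (ht.2 i)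
    linarith

lemma cubeMap_insertNth_zero {p : ℕ} (i : Fin (p + 1)) (t : Fin p → ℝ) :
    cubeMap (p + 1) (Fin.insertNth (α := fun _ => ℝ) i 0 t) =
      Fin.insertNth (α := fun _ => ℝ) i 0 (cubeMap p t) := by
  induction p with
  | zero =>
    obtain rfl : i = 0 := Subsingleton.elim (α := Fin 1) _ _
    ext j
    obtain rfl : j = 0 := Subsingleton.elim (α := Fin 1) _ _
    simp [cubeMap_succ]
  | succ p ih =>
    refine Fin.cases ?_ (fun i => ?_) i
    · rw [cubeMap_succ]
      simp
    · have h : Fin.tail (Fin.insertNth (α := fun _ => ℝ) i.succ 0 t) =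
          Fin.insertNth (α := fun _ => ℝ) i 0 (Fin.tail t) := by
        ext j
        refine Fin.succAboveCases i ?_ (fun l => ?_) j
        · simp [Fin.tail]
        · rw [Fin.insertNth_apply_succAbove, Fin.tail, Fin.tail, ← Fin.succ_succAbove_succ,
            Fin.insertNth_apply_succAbove]
      have h0 : Fin.insertNth (α := fun _ => ℝ) i.succ 0 t 0 = t 0 := by
        conv_lhs => rw [← Fin.succ_succAbove_zero i]
        rw [Fin.insertNth_apply_succAbove]
      rw [cubeMap_succ, h, ih, h0, cubeMap_succ t]
      ext j
      refine Fin.cases ?_ (fun j => ?_) j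
      · conv_rhs => rw [← Fin.succ_succAbove_zero i]
        rw [Fin.insertNth_apply_succAbove, Fin.sum_univ_succAbove _ i]
        simp
      · refine Fin.succAboveCases i ?_ (fun l => ?_) j
        · simp
        · rw [Fin.cons_succ, Fin.insertNth_apply_succAbove, ← Fin.succ_succAbove_succ,
            Fin.insertNth_apply_succAbove, Fin.cons_succ]

/-- The cube map sends the face `t₀ = 1` of the cube to the face of the simplex opposite to `0`. -/
lemma cubeMap_front_zero {p : ℕ} (t : Fin p → ℝ) :
    cubeMap (p + 1) (Fin.insertNth (α := fun _ => ℝ) 0 1 t) = faceMap p 0 (cubeMap p t) := by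
  simp [cubeMap_succ, faceMap]

/-- The cube map sends the faces `tᵢ = 0` of the cube to the coordinate faces of the simplex. -/
lemma cubeMap_back {p : ℕ} (i : Fin (p + 1)) (t : Fin p → ℝ) :
    cubeMap (p + 1) (Fin.insertNth (α := fun _ => ℝ) i 0 t) = faceMap p i.succ (cubeMap p t) := by
  rw [cubeMap_insertNth_zero]; simp [faceMap]

lemma cubeMap_eq_of_tail_eq_one {p : ℕ} {t : Fin (p + 1) → ℝ} {i : Fin p} (hi : t i.succ = 1) :
    cubeMap (p + 1) t = Fin.cons 0 (cubeMap p (Fin.tail t)) := by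
  rw [cubeMap_succ, one_sub_sum_cubeMap, Finset.prod_eq_zero (Finset.mem_univ i), mul_zero]
  simp [Fin.tail, hi]

/-- The cube map collapses the direction `e₀` on the faces `tᵢ = 1`, `i > 0`. -/
lemma fderiv_cubeMap_stdFrame_zero {p : ℕ} {t : Fin (p + 1) → ℝ} {i : Fin p} (hi : t i.succ = 1) :
    fderiv ℝ (cubeMap (p + 1)) t (stdFrame (p + 1) 0) = 0 := by
  have hd : DifferentiableAt ℝ (cubeMap (p + 1)) t :=
    (contDiff_cubeMap _).differentiable (by simp) t
  rw [← hd.lineDeriv_eq_fderiv, lineDeriv]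
  have : ∀ s : ℝ, cubeMap (p + 1) (t + s • stdFrame (p + 1) 0) =
      Fin.cons 0 (cubeMap p (Fin.tail t)) := by
    intro s
    rw [cubeMap_eq_of_tail_eq_one (i := i) (by simp [stdFrame, hi])]
    congr 2
    ext j
    simp [Fin.tail, stdFrame]
  simp [this]

/-- The derivative of the cube map is triangular: its lower block is the derivative of the cube map
in one dimension less, and its first column is supported in the first entry. -/
lemma fderiv_cubeMap_apply {p : ℕ} (t v : Fin (p + 1) → ℝ) :
    (∀ i : Fin p, fderiv ℝ (cubeMap (p + 1)) t v i.succ =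
      fderiv ℝ (cubeMap p) (Fin.tail t) (Fin.tail v) i) ∧
    (Fin.tail v = 0 → fderiv ℝ (cubeMap (p + 1)) t v 0 = v 0 * ∏ i, (1 - Fin.tail t i)) := by
  have hd : DifferentiableAt ℝ (cubeMap (p + 1)) t :=
    (contDiff_cubeMap _).differentiable (by simp) t
  have hd' : DifferentiableAt ℝ (cubeMap p) (Fin.tail t) :=
    (contDiff_cubeMap _).differentiable (by simp) _
  have htail : ∀ s : ℝ, Fin.tail (t + s • v) = Fin.tail t + s • Fin.tail v := fun s => rfl
  have hl := hd.hasFDerivAt.hasLineDerivAt v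
  have hl' := hd'.hasFDerivAt.hasLineDerivAt (Fin.tail v)
  rw [HasLineDerivAt, hasDerivAt_pi] at hl hl'
  refine ⟨fun i => ?_, fun hv => ?_⟩
  · refine (hl i.succ).unique ?_
    simpa only [cubeMap_succ, Fin.cons_succ, htail] using hl' i
  · refine (hl 0).unique ?_
    simp only [cubeMap_succ, Fin.cons_zero, htail, hv, smul_zero, add_zero, one_sub_sum_cubeMap]
    simpa using (((hasDerivAt_id (0 : ℝ)).mul_const (v 0)).const_add (t 0)).mul_const
      (∏ i, (1 - Fin.tail t i))

lemma det_fderiv_cubeMap_nonneg {p : ℕ} {t : Fin p → ℝ} (ht : t ∈ Icc (0 : Fin p → ℝ) 1) :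
    0 ≤ (fderiv ℝ (cubeMap p) t).det := by
  have tail_succ : ∀ {q : ℕ} (j : Fin q), Fin.tail (stdFrame (q + 1) j.succ) = stdFrame q j := by
    intro q j; ext l; simp [Fin.tail, stdFrame, Pi.single_apply]
  have tail_zero : ∀ {q : ℕ}, Fin.tail (stdFrame (q + 1) 0) = 0 := by
    intro q; ext l; simp [Fin.tail, stdFrame]
  have key : (∀ i j : Fin p, j < i → fderiv ℝ (cubeMap p) t (stdFrame p j) i = 0) ∧
      ∀ i, 0 ≤ fderiv ℝ (cubeMap p) t (stdFrame p i) i := by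
    induction p with
    | zero => exact ⟨fun i => i.elim0, fun i => i.elim0⟩
    | succ p ih =>
      have ht' : Fin.tail t ∈ Icc (0 : Fin p → ℝ) 1 := ⟨fun i => ht.1 i.succ, fun i => ht.2 i.succ⟩
      refine ⟨fun i j hij => ?_, fun i => ?_⟩
      · induction i using Fin.cases with
        | zero => exact absurd hij (Fin.not_lt_zero j)
        | succ i =>
          rw [(fderiv_cubeMap_apply t _).1]
          induction j using Fin.cases with
          | zero => rw [tail_zero]; simp
          | succ j => rw [tail_succ]; exact (ih ht').1 i j (Fin.succ_lt_succ_iff.1 hij)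
      · induction i using Fin.cases with
        | zero =>
          rw [(fderiv_cubeMap_apply t _).2 tail_zero]
          refine mul_nonneg (by simp [stdFrame]) (Finset.prod_nonneg fun i _ => ?_)
          exact sub_nonneg.2 (ht'.2 i)
        | succ i =>
          rw [(fderiv_cubeMap_apply t _).1, tail_succ]
          exact (ih ht').2 i
  have h1 : (fderiv ℝ (cubeMap p) t).det =
      (LinearMap.toMatrix' (fderiv ℝ (cubeMap p) t : (Fin p → ℝ) →ₗ[ℝ] (Fin p → ℝ))).det := by
    rw [LinearMap.det_toMatrix']
  rw [h1, Matrix.det_of_isUpperTriangular]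
  · refine Finset.prod_nonneg fun i _ => ?_
    simpa [LinearMap.toMatrix'_apply, stdFrame, ← Pi.single_apply] using key.2 i
  · intro i j hij
    simpa [LinearMap.toMatrix'_apply, stdFrame, ← Pi.single_apply] using key.1 i j hij

lemma injOn_cubeMap (p : ℕ) : InjOn (cubeMap p) (pi univ fun _ => Ico (0 : ℝ) 1) := by
  induction p with
  | zero => exact fun x _ y _ _ => Subsingleton.elim _ _
  | succ p ih =>
    intro x hx y hy h
    rw [cubeMap_succ, cubeMap_succ, Fin.cons_inj] at h
    have ht : Fin.tail x = Fin.tail y :=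
      ih (fun i _ => hx i.succ (mem_univ _)) (fun i _ => hy i.succ (mem_univ _)) h.2
    have h0 := h.1
    rw [ht, one_sub_sum_cubeMap] at h0
    have hpos : 0 < ∏ i, (1 - Fin.tail y i) :=
      Finset.prod_pos fun i _ => sub_pos.2 (hy i.succ (mem_univ _)).2
    have h0' : x 0 = y 0 := mul_right_cancel₀ hpos.ne' h0
    rw [← Fin.cons_self_tail x, ← Fin.cons_self_tail y, ht, h0']

lemma image_cubeMap (p : ℕ) : cubeMap p '' (pi univ fun _ => Ico (0 : ℝ) 1) =
    {y | (∀ i, 0 ≤ y i) ∧ ∑ i, y i < 1} := by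
  refine Subset.antisymm ?_ ?_
  · rintro _ ⟨t, ht, rfl⟩
    have h1 : t ∈ Icc (0 : Fin p → ℝ) 1 :=
      ⟨fun i => (ht i (mem_univ _)).1, fun i => (ht i (mem_univ _)).2.le⟩
    refine ⟨(cubeMap_mem h1).1, ?_⟩
    have := one_sub_sum_cubeMap t
    have h2 : 0 < ∏ i, (1 - t i) :=
      Finset.prod_pos fun i _ => sub_pos.2 (ht i (mem_univ _)).2
    linarith
  · induction p with
    | zero => exact fun y _ => ⟨y, fun i => i.elim0, rfl⟩
    | succ p ih =>
      rintro y ⟨hy0, hy1⟩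
      rw [Fin.sum_univ_succ] at hy1
      have hlt : ∑ i, Fin.tail y i < 1 := by
        have := hy0 0
        simp only [Fin.tail]
        linarith
      obtain ⟨t, ht, hty⟩ := @ih (Fin.tail y) ⟨fun i => hy0 i.succ, hlt⟩
      have hpos : 0 < 1 - ∑ i, Fin.tail y i := sub_pos.2 hlt
      refine ⟨Fin.cons (y 0 / (1 - ∑ i, Fin.tail y i)) t, ?_, ?_⟩
      · intro i _
        refine Fin.cases ?_ (fun i => ?_) i
        · rw [Fin.cons_zero]
          refine ⟨div_nonneg (hy0 0) hpos.le, ?_⟩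
          rw [div_lt_one hpos]
          simp only [Fin.tail]
          linarith
        · rw [Fin.cons_succ]; exact ht i (mem_univ _)
      · rw [cubeMap_succ, Fin.tail_cons, hty, Fin.cons_zero, div_mul_cancel₀ _ hpos.ne',
          Fin.cons_self_tail]

lemma convex_solidSimplex (p : ℕ) : Convex ℝ (solidSimplex p) := by
  intro x hx y hy a b ha hb hab
  refine ⟨fun i => ?_, ?_⟩
  · have := mul_nonneg ha (hx.1 i)
    have := mul_nonneg hb (hy.1 i)
    simp; linarith
  · simp only [Pi.add_apply, Pi.smul_apply, smul_eq_mul, Finset.sum_add_distrib, ← Finset.mul_sum]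
    nlinarith [hx.2, hy.2]

lemma isCompact_solidSimplex (p : ℕ) : IsCompact (solidSimplex p) := by
  refine (isCompact_Icc (a := (0 : Fin p → ℝ)) (b := 1)).of_isClosed_subset ?_ ?_
  · have : solidSimplex p = (⋂ i, {y | 0 ≤ y i}) ∩ {y | ∑ i, y i ≤ 1} := by
      ext; simp [solidSimplex]
    rw [this]
    refine IsClosed.inter (isClosed_iInter fun i => ?_) ?_
    · exact isClosed_le continuous_const (continuous_apply i)
    · exact isClosed_le (by fun_prop) continuous_const
  · intro y hy
    refine ⟨hy.1, fun i => ?_⟩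
    exact (Finset.single_le_sum (fun j _ => hy.1 j) (Finset.mem_univ i)).trans hy.2

/-- The standard simplex differs from the image of the half-open cube by a part of its boundary,
which is a null set by convexity. -/
lemma image_cubeMap_ae_eq (p : ℕ) :
    cubeMap p '' (pi univ fun _ => Ico (0 : ℝ) 1) =ᵐ[volume] solidSimplex p := by
  rw [image_cubeMap]
  set D : Set (Fin p → ℝ) := {y | (∀ i, 0 ≤ y i) ∧ ∑ i, y i < 1}
  have hD : Convex ℝ D := by
    intro x hx y hy a b ha hb hab
    refine ⟨fun i => ?_, ?_⟩
    · have := mul_nonneg ha (hx.1 i)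
      have := mul_nonneg hb (hy.1 i)
      simp; linarith
    · simp only [Pi.add_apply, Pi.smul_apply, smul_eq_mul, Finset.sum_add_distrib,
        ← Finset.mul_sum]
      rcases ha.eq_or_lt with rfl | ha
      · have : b = 1 := by linarith
        subst this; simpa using hy.2
      · nlinarith [hx.2, hy.2, mul_lt_mul_of_pos_left hx.2 ha,
          mul_le_mul_of_nonneg_left hy.2.le hb]
  have h1 : solidSimplex p ⊆ closure D := by
    intro x hx
    have htend : Tendsto (fun s : ℝ => s • x) (𝓝[<] 1) (𝓝 x) := by
      have : Tendsto (fun s : ℝ => s • x) (𝓝 1) (𝓝 ((1 : ℝ) • x)) :=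
        (continuous_id.smul continuous_const).tendsto _
      rw [one_smul] at this
      exact this.mono_left nhdsWithin_le_nhds
    refine mem_closure_of_tendsto htend ?_
    filter_upwards [self_mem_nhdsWithin, mem_nhdsWithin_of_mem_nhds (Ioi_mem_nhds zero_lt_one)]
      with s hs hs0
    refine ⟨fun i => mul_nonneg (le_of_lt hs0) (hx.1 i), ?_⟩
    simp only [Pi.smul_apply, smul_eq_mul, ← Finset.mul_sum]
    have h2 := hx.2
    have h3 : 0 ≤ ∑ i, x i := Finset.sum_nonneg fun i _ => hx.1 i
    have hs1 : s < 1 := hs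
    have hs2 : 0 < s := hs0
    nlinarith
  have h2 : (D : Set (Fin p → ℝ)) ⊆ solidSimplex p := fun x hx => ⟨hx.1, hx.2.le⟩
  refine (h2.eventuallyLE).antisymm ?_
  rw [ae_le_set]
  refine measure_mono_null ?_ (hD.addHaar_frontier volume)
  intro x hx
  exact ⟨h1 hx.1, fun h => hx.2 (interior_subset h)⟩

lemma alternating_comp_stdFrame {k : ℕ} (μ : (Fin k → ℝ) [⋀^Fin k]→ₗ[ℝ] ℝ)
    (A : (Fin k → ℝ) →ₗ[ℝ] (Fin k → ℝ)) :
    μ (fun i => A (stdFrame k i)) = LinearMap.det A * μ (stdFrame k) := by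
  have h3 : (stdFrame k) = Pi.basisFun ℝ (Fin k) := by
    ext i j; simp [stdFrame]
  have h1 : ∀ v, μ v = μ (stdFrame k) * (Pi.basisFun ℝ (Fin k)).det v := by
    intro v
    have h2 := congrArg (fun f => f v) (μ.eq_smul_basis_det (Pi.basisFun ℝ (Fin k)))
    simpa [h3] using h2
  have h4 := (Pi.basisFun ℝ (Fin k)).det_comp A (stdFrame k)
  have h5 : (Pi.basisFun ℝ (Fin k)).det (stdFrame k) = 1 := by rw [h3, Module.Basis.det_self]
  rw [h5, mul_one] at h4
  rw [h1, mul_comm, ← h4]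
  rfl

lemma map_comp_stdFrame {p : ℕ} (ζ : (Fin p → ℝ) [⋀^Fin p]→L[ℝ] ℝ)
    (A : (Fin p → ℝ) →L[ℝ] (Fin p → ℝ)) :
    ζ.compContinuousLinearMap A (stdFrame p) = A.det * ζ (stdFrame p) :=
  alternating_comp_stdFrame ζ.toAlternatingMap (A : (Fin p → ℝ) →ₗ[ℝ] (Fin p → ℝ))

section

variable {n : ℕ} {M : Type*} [TopologicalSpace M] [ChartedSpace (EuclideanSpace ℝ (Fin n)) M]

/-- An integral over the simplex as an integral over the cube, by the change of variables given by
the cube map. -/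
lemma setIntegral_solidSimplex_pull {p : ℕ} {G : (Fin p → ℝ) → M} (η : DiffForm p n M)
    (hG : ∀ x ∈ solidSimplex p, MDifferentiableAt 𝓘(ℝ, Fin p → ℝ) (𝓡 n) G x) :
    ∫ x in solidSimplex p, pull G η x (stdFrame p) =
      ∫ t in Icc (0 : Fin p → ℝ) 1, pull (G ∘ cubeMap p) η t (stdFrame p) := by
  have hd : ∀ t, DifferentiableAt ℝ (cubeMap p) t := fun t =>
    (contDiff_cubeMap _).differentiable (by simp) t
  rw [← setIntegral_congr_set (image_cubeMap_ae_eq p),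
    integral_image_eq_integral_abs_det_fderiv_smul volume
      (MeasurableSet.univ_pi fun _ => measurableSet_Ico)
      (fun t _ => (hd t).hasFDerivAt.hasFDerivWithinAt) (injOn_cubeMap p)]
  have h : (pi univ fun _ : Fin p => Ico (0 : ℝ) 1) =ᵐ[volume] Icc (0 : Fin p → ℝ) 1 :=
    Measure.univ_pi_Ico_ae_eq_Icc
  rw [setIntegral_congr_set h]
  refine setIntegral_congr_fun measurableSet_Icc fun t ht => ?_
  rw [pull_comp (hG _ (cubeMap_mem ht)) (hd t), map_comp_stdFrame,
    abs_of_nonneg (det_fderiv_cubeMap_nonneg ht), smul_eq_mul]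

end

/-! ### Stokes' theorem for smooth singular chains -/

section Chains

variable {p n m : ℕ} {M : Type*} [TopologicalSpace M] [ChartedSpace (EuclideanSpace ℝ (Fin n)) M]
  {S : Type*} [TopologicalSpace S] [ChartedSpace (EuclideanSpace ℝ (Fin m)) S]
  {R : Type*} [CommRing R]

/-- A form all of whose pullbacks under smooth maps from Euclidean spaces are differentiable. This
is the regularity needed for Stokes' theorem, and it is stable under pullbacks and under products
with functions and their differentials. -/
def PullDifferentiable (η : DiffForm p n M) : Prop :=
  ∀ ⦃q : ℕ⦄ ⦃F : (Fin q → ℝ) → M⦄ ⦃y : Fin q → ℝ⦄,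
    ContMDiffAt 𝓘(ℝ, Fin q → ℝ) (𝓡 n) ∞ F y → DifferentiableAt ℝ (pull F η) y

/-- A `p`-form all of whose pullbacks under smooth maps from `ℝᵖ⁺¹` are closed. -/
def PullClosed (η : DiffForm p n M) : Prop :=
  ∀ ⦃F : (Fin (p + 1) → ℝ) → M⦄ ⦃y : Fin (p + 1) → ℝ⦄,
    ContMDiffAt 𝓘(ℝ, Fin (p + 1) → ℝ) (𝓡 n) ∞ F y → extDeriv (pull F η) y = 0

lemma IsSmooth.pullDifferentiable [IsManifold (𝓡 n) ∞ M] {η : DiffForm p n M} (hη : η.IsSmooth) :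
    PullDifferentiable η := fun _ _ _ hF => IsSmooth.differentiableAt_pull hη hF

lemma IsClosed.pullClosed [IsManifold (𝓡 n) ∞ M] {η : DiffForm p n M} (hη : η.IsSmooth)
    (hc : η.IsClosed) : PullClosed η := fun _ _ hF => IsClosed.extDeriv_pull hη hc hF

lemma SmoothSimplex.exists_extend (σ : SmoothSimplex n M p) : ∃ V, IsOpen V ∧ solidSimplex p ⊆ V ∧
    ContMDiffOn 𝓘(ℝ, Fin p → ℝ) (𝓡 n) ∞ σ.extend V ∧
    ∀ y : solidSimplex p, σ.extend y = σ.toFun y :=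
  ⟨_, σ.exists_extension.choose_spec.choose_spec⟩

lemma SmoothSimplex.extend_apply (σ : SmoothSimplex n M p) (y : solidSimplex p) :
    σ.extend y = σ.toFun y := σ.exists_extend.choose_spec.2.2.2 y

lemma SmoothSimplex.contMDiffAt_extend (σ : SmoothSimplex n M p) {y : Fin p → ℝ}
    (hy : y ∈ solidSimplex p) : ContMDiffAt 𝓘(ℝ, Fin p → ℝ) (𝓡 n) ∞ σ.extend y := by
  obtain ⟨V, hV, hsub, hF, -⟩ := σ.exists_extend
  exact hF.contMDiffAt (hV.mem_nhds (hsub hy))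

/-- The integral over a simplex can be computed with any extension. -/
lemma SmoothSimplex.integral_eq (σ : SmoothSimplex n M p) (β : DiffForm p n M)
    {G : (Fin p → ℝ) → M} (hG : ∀ y : solidSimplex p, G y = σ.toFun y) :
    σ.integral β = ∫ y in solidSimplex p, pull G β y (stdFrame p) := by
  have hae : (interior (solidSimplex p) : Set (Fin p → ℝ)) =ᵐ[volume] solidSimplex p :=
    interior_ae_eq_of_null_frontier ((convex_solidSimplex p).addHaar_frontier volume)
  change ∫ y in solidSimplex p, pull σ.extend β y (stdFrame p) = _
  rw [← setIntegral_congr_set hae, ← setIntegral_congr_set hae]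
  refine setIntegral_congr_fun isOpen_interior.measurableSet fun y hy => ?_
  have : σ.extend =ᶠ[𝓝 y] G := by
    filter_upwards [mem_interior_iff_mem_nhds.1 hy] with z hz
    rw [σ.extend_apply ⟨z, hz⟩, hG ⟨z, hz⟩]
  simp only [pull_congr this]

lemma SmoothSimplex.integrableOn_pull (σ : SmoothSimplex n M p) {β : DiffForm p n M}
    (hβ : PullDifferentiable β) :
    IntegrableOn (fun y => pull σ.extend β y (stdFrame p)) (solidSimplex p) := by
  refine ContinuousOn.integrableOn_compact (isCompact_solidSimplex p) fun y hy => ?_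
  have := (hβ (σ.contMDiffAt_extend hy)).continuousAlternatingMap_apply_const (stdFrame p)
  exact this.continuousAt.continuousWithinAt

lemma hasFDerivAt_insertNth (i : Fin (p + 1)) (c : ℝ) (x : Fin p → ℝ) :
    ∃ L : (Fin p → ℝ) →L[ℝ] (Fin (p + 1) → ℝ),
      HasFDerivAt (fun x : Fin p → ℝ => Fin.insertNth (α := fun _ => ℝ) i c x) L x ∧
      ∀ j, L (stdFrame p j) = stdFrame (p + 1) (i.succAbove j) := by
  have hd : DifferentiableAt ℝ (fun x : Fin p → ℝ => Fin.insertNth (α := fun _ => ℝ) i c x) x := by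
    rw [differentiableAt_pi]
    intro l
    refine Fin.succAboveCases i ?_ (fun l => ?_) l
    · simp
    · simp only [Fin.insertNth_apply_succAbove]
      fun_prop
  refine ⟨_, hd.hasFDerivAt, fun j => ?_⟩
  rw [← hd.lineDeriv_eq_fderiv]
  have key : ∀ s : ℝ, Fin.insertNth (α := fun _ => ℝ) i c (x + s • stdFrame p j) =
      Fin.insertNth (α := fun _ => ℝ) i c x + s • stdFrame (p + 1) (i.succAbove j) := by
    intro s
    ext l
    refine Fin.succAboveCases i ?_ (fun l => ?_) l
    · simp [stdFrame]
    · simp [stdFrame, Pi.single_apply]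
  rw [lineDeriv]
  simp only [key]
  simpa using (((hasDerivAt_id (0 : ℝ)).smul_const
    (stdFrame (p + 1) (i.succAbove j))).const_add (Fin.insertNth (α := fun _ => ℝ) i c x)).deriv

lemma pull_insertNth {G : (Fin (p + 1) → ℝ) → M} (i : Fin (p + 1)) (c : ℝ) (x : Fin p → ℝ)
    (hG : MDifferentiableAt 𝓘(ℝ, Fin (p + 1) → ℝ) (𝓡 n) G
      (Fin.insertNth (α := fun _ => ℝ) i c x)) (η : DiffForm p n M) :
    pull (G ∘ fun x => Fin.insertNth (α := fun _ => ℝ) i c x) η x (stdFrame p) =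
      pull G η (Fin.insertNth (α := fun _ => ℝ) i c x) (stdFrame (p + 1) ∘ i.succAbove) := by
  obtain ⟨L, hL, hLs⟩ := hasFDerivAt_insertNth i c x
  rw [pull_comp hG hL.differentiableAt, hL.fderiv,
    ContinuousAlternatingMap.compContinuousLinearMap_apply]
  congr 1
  ext1 j
  exact hLs j

/-- Stokes' theorem for a closed form on a smooth singular simplex. Composing with the cube map
reduces it to Stokes' theorem on a cube, of which some faces are sent to the faces of the simplex
while the others are collapsed and contribute nothing. -/
lemma sum_integral_face_eq_zero (σ : SmoothSimplex n M (p + 1)) {η : DiffForm p n M}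
    (hη : PullDifferentiable η) (hc : PullClosed η) :
    ∑ j : Fin (p + 2), (-1 : ℝ) ^ (j : ℕ) * (σ.face j).integral η = 0 := by
  set G := σ.extend ∘ cubeMap (p + 1) with hGdef
  have hsm : ∀ t, ContMDiffAt 𝓘(ℝ, Fin (p + 1) → ℝ) 𝓘(ℝ, Fin (p + 1) → ℝ) ∞ (cubeMap (p + 1)) t :=
    fun t => (contDiff_cubeMap (p + 1)).contMDiff t
  have hG : ∀ t ∈ Icc (0 : Fin (p + 1) → ℝ) 1,
      ContMDiffAt 𝓘(ℝ, Fin (p + 1) → ℝ) (𝓡 n) ∞ G t := fun t ht =>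
    (σ.contMDiffAt_extend (cubeMap_mem ht)).comp t (hsm t)
  have hmem : ∀ (i : Fin (p + 1)) (c : ℝ), c ∈ Icc (0 : ℝ) 1 → ∀ x ∈ Icc (0 : Fin p → ℝ) 1,
      Fin.insertNth (α := fun _ => ℝ) i c x ∈ Icc (0 : Fin (p + 1) → ℝ) 1 := by
    intro i c hc x hx
    refine ⟨fun l => ?_, fun l => ?_⟩
    · refine Fin.succAboveCases i ?_ (fun l => ?_) l
      · simpa using hc.1
      · simpa using hx.1 l
    · refine Fin.succAboveCases i ?_ (fun l => ?_) l
      · simpa using hc.2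
      · simpa using hx.2 l
  have h0 := sum_face_integrals_eq_zero (a := (0 : Fin (p + 1) → ℝ)) (b := 1)
    (fun i => zero_le_one) (ζ := pull G η) (fun t ht => hη (hG t ht)) (fun t ht => hc (hG t ht))
  -- a face of the cube which the cube map sends onto a face of the simplex
  have hface : ∀ (i : Fin (p + 1)) (c : ℝ), c ∈ Icc (0 : ℝ) 1 → ∀ j : Fin (p + 2),
      (∀ x : Fin p → ℝ, cubeMap (p + 1) (Fin.insertNth (α := fun _ => ℝ) i c x) =
        faceMap p j (cubeMap p x)) →
      ∫ x in Icc (0 : Fin p → ℝ) 1, (-1 : ℝ) ^ (i : ℕ) *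
        pull G η (Fin.insertNth (α := fun _ => ℝ) i c x) (stdFrame (p + 1) ∘ i.succAbove) =
      (-1 : ℝ) ^ (i : ℕ) * (σ.face j).integral η := by
    intro i c hc j hj
    rw [integral_const_mul]
    congr 1
    have hsmj : ∀ y ∈ solidSimplex p, MDifferentiableAt 𝓘(ℝ, Fin p → ℝ) (𝓡 n)
        (σ.extend ∘ faceMap p j) y := fun y hy =>
      ((σ.contMDiffAt_extend (faceMap_mem p j hy)).comp y
        ((contDiff_faceMap p j).contMDiff y)).mdifferentiableAt (by simp)
    rw [(σ.face j).integral_eq η (G := σ.extend ∘ faceMap p j)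
      (fun y => σ.extend_apply ⟨_, faceMap_mem p j y.2⟩), setIntegral_solidSimplex_pull η hsmj]
    refine setIntegral_congr_fun measurableSet_Icc fun x hx => ?_
    have := pull_insertNth i c x ((hG _ (hmem i c hc x hx)).mdifferentiableAt (by simp)) η
    simp only [← this]
    congr 2
    ext y
    simp [hGdef, hj]
  have hback : ∀ i : Fin (p + 1), ∫ x in Icc ((0 : Fin (p + 1) → ℝ) ∘ i.succAbove)
        ((1 : Fin (p + 1) → ℝ) ∘ i.succAbove), (-1 : ℝ) ^ (i : ℕ) *
        pull G η (Fin.insertNth (α := fun _ => ℝ) i ((0 : Fin (p + 1) → ℝ) i) x)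
          (stdFrame (p + 1) ∘ i.succAbove) =
      (-1 : ℝ) ^ (i : ℕ) * (σ.face i.succ).integral η := fun i =>
    hface i 0 ⟨le_rfl, zero_le_one⟩ i.succ (cubeMap_back i)
  have hfront0 : ∫ x in Icc ((0 : Fin (p + 1) → ℝ) ∘ (0 : Fin (p + 1)).succAbove)
        ((1 : Fin (p + 1) → ℝ) ∘ (0 : Fin (p + 1)).succAbove), (-1 : ℝ) ^ ((0 : Fin (p + 1)) : ℕ) *
        pull G η (Fin.insertNth (α := fun _ => ℝ) 0 ((1 : Fin (p + 1) → ℝ) 0) x)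
          (stdFrame (p + 1) ∘ (0 : Fin (p + 1)).succAbove) =
      (-1 : ℝ) ^ ((0 : Fin (p + 1)) : ℕ) * (σ.face 0).integral η :=
    hface 0 1 ⟨zero_le_one, le_rfl⟩ 0 cubeMap_front_zero
  -- the other front faces are collapsed
  have hfront : ∀ i : Fin p, ∫ x in Icc ((0 : Fin (p + 1) → ℝ) ∘ i.succ.succAbove)
        ((1 : Fin (p + 1) → ℝ) ∘ i.succ.succAbove), (-1 : ℝ) ^ (i.succ : ℕ) *
        pull G η (Fin.insertNth (α := fun _ => ℝ) i.succ ((1 : Fin (p + 1) → ℝ) i.succ) x)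
          (stdFrame (p + 1) ∘ i.succ.succAbove) = 0 := by
    intro i
    rw [← integral_zero (Fin p → ℝ) ℝ (μ := volume.restrict (Icc ((0 : Fin (p + 1) → ℝ) ∘
      i.succ.succAbove) ((1 : Fin (p + 1) → ℝ) ∘ i.succ.succAbove)))]
    refine setIntegral_congr_fun measurableSet_Icc fun x hx => ?_
    have hx' := hmem i.succ 1 ⟨zero_le_one, le_rfl⟩ x hx
    have hzero := fderiv_cubeMap_stdFrame_zero (p := p)
      (t := Fin.insertNth (α := fun _ => ℝ) i.succ 1 x) (i := i) (by simp)
    have hpos : 0 < p := i.pos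
    obtain ⟨q, rfl⟩ := Nat.exists_eq_succ_of_ne_zero hpos.ne'
    simp only [Pi.one_apply]
    rw [hGdef, pull_comp ((σ.contMDiffAt_extend (cubeMap_mem hx')).mdifferentiableAt (by simp))
      ((contDiff_cubeMap _).differentiable (by simp) _),
      ContinuousAlternatingMap.compContinuousLinearMap_apply,
      ContinuousAlternatingMap.map_coord_zero _ (0 : Fin (q + 1)), mul_zero]
    simpa using hzero
  rw [Finset.sum_sub_distrib] at h0
  simp only [hback] at h0
  rw [Fin.sum_univ_succ, hfront0, Finset.sum_eq_zero (fun i _ => hfront i)] at h0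
  rw [Fin.sum_univ_succ]
  simp only [Fin.val_succ, pow_succ, mul_neg, mul_one, neg_mul, Finset.sum_neg_distrib]
  simpa [sub_eq_add_neg] using h0

variable [Algebra R ℝ]

/-- Integration of a fixed form over chains, as an additive map. -/
def chainIntegralHom (β : DiffForm p n M) : Chain n M R p →+ ℝ :=
  Finsupp.liftAddHom fun σ =>
    (AddMonoidHom.mulRight (σ.integral β)).comp (algebraMap R ℝ).toAddMonoidHom

lemma chainIntegralHom_apply (β : DiffForm p n M) (z : Chain n M R p) :
    chainIntegralHom β z = chainIntegral z β := rfl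

lemma chainIntegralHom_single (β : DiffForm p n M) (σ : SmoothSimplex n M p) (r : R) :
    chainIntegralHom β (Finsupp.single σ r) = algebraMap R ℝ r * σ.integral β := by
  simp [chainIntegralHom]

lemma chainIntegral_boundary {η : DiffForm p n M} (hη : PullDifferentiable η) (hc : PullClosed η)
    (b : Chain n M R (p + 1)) : chainIntegral (boundary b) η = 0 := by
  rw [← chainIntegralHom_apply]
  induction b using Finsupp.induction_linear with
  | zero => simp
  | add a b ha hb => rw [map_add, map_add, ha, hb, add_zero]
  | single σ r =>
    rw [boundary, Finsupp.linearCombination_single, Finset.smul_sum, map_sum]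
    have h := sum_integral_face_eq_zero σ hη hc
    have : ∀ j : Fin (p + 2), chainIntegralHom η
        (r • Finsupp.single (σ.face j) ((-1 : R) ^ (j : ℕ))) =
        algebraMap R ℝ r * ((-1 : ℝ) ^ (j : ℕ) * (σ.face j).integral η) := by
      intro j
      rw [Finsupp.smul_single, chainIntegralHom_single]
      simp [mul_assoc]
    rw [Finset.sum_congr rfl fun j _ => this j, ← Finset.mul_sum, h, mul_zero]

lemma chainIntegral_eq_of_isBoundary_sub {η : DiffForm p n M} (hη : PullDifferentiable η)
    (hc : PullClosed η) {z z' : Chain n M R p} (h : IsBoundary (z - z')) :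
    chainIntegral z η = chainIntegral z' η := by
  obtain ⟨b, hb⟩ := h
  have := chainIntegral_boundary hη hc b
  rw [hb, ← chainIntegralHom_apply, map_sub, sub_eq_zero] at this
  exact this

lemma chainIntegral_pushChain (h : C^∞⟮𝓡 m, S; 𝓡 n, M⟯) (c : Chain m S R p)
    (β : DiffForm p n M) :
    chainIntegral (pushChain h c) β = chainIntegral c (pullForm h β) := by
  rw [← chainIntegralHom_apply, ← chainIntegralHom_apply]
  induction c using Finsupp.induction_linear with
  | zero => simp [pushChain]
  | add a b ha hb =>
    rw [map_add, ← ha, ← hb, ← map_add]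
    congr 1
    exact Finsupp.mapDomain_add
  | single σ r =>
    rw [pushChain, Finsupp.mapDomain_single, chainIntegralHom_single, chainIntegralHom_single,
      (σ.push h).integral_eq β (G := h ∘ σ.extend) (fun y => congrArg h (σ.extend_apply y)),
      σ.integral_eq _ (G := σ.extend) σ.extend_apply]
    congr 1
    refine setIntegral_congr_fun (isCompact_solidSimplex p).measurableSet fun y hy => ?_
    have hs := (σ.contMDiffAt_extend hy).mdifferentiableAt (n := ∞) (by simp)
    rw [pull_pullForm ((h.contMDiff _).mdifferentiableAt (by simp)) hs]

lemma chainIntegral_sum {κ : Type*} (s : Finset κ) {θ : κ → DiffForm p n M}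
    (hθ : ∀ j ∈ s, PullDifferentiable (θ j)) (c : Chain n M R p) :
    chainIntegral c (∑ j ∈ s, θ j) = ∑ j ∈ s, chainIntegral c (θ j) := by
  simp only [chainIntegral, Finsupp.sum]
  rw [Finset.sum_comm]
  refine Finset.sum_congr rfl fun σ _ => ?_
  rw [← Finset.mul_sum]
  congr 1
  simp only [σ.integral_eq _ (G := σ.extend) σ.extend_apply]
  rw [← integral_finsetSum _ fun j hj => σ.integrableOn_pull (hθ j hj)]
  refine integral_congr_ae (Eventually.of_forall fun y => ?_)
  simp [pull_apply, Finset.sum_apply]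

end Chains

/-! ### Computing an integral in an oriented parametrization -/

section Param

variable {k : ℕ} {S : Type*} [TopologicalSpace S] [ChartedSpace (EuclideanSpace ℝ (Fin k)) S]

/-- The sign of a frame given by vectors of the model space. -/
def signAt (o : ManifoldOrientation k S) (x : S) (v : Fin k → EuclideanSpace ℝ (Fin k)) : ℝ :=
  frameSign (V := TangentSpace (𝓡 k) x) (o.at_ x) v

/-- The value of a top-degree form on a frame, times the sign of that frame. -/
def signedValue (o : ManifoldOrientation k S) (θ : DiffForm k k S) (x : S)
    (v : Fin k → EuclideanSpace ℝ (Fin k)) : ℝ :=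
  signAt o x v * θ x v

lemma signAt_comp (o : ManifoldOrientation k S) (x : S)
    (L : (Fin k → ℝ) →L[ℝ] EuclideanSpace ℝ (Fin k)) (A : (Fin k → ℝ) →L[ℝ] (Fin k → ℝ)) :
    signAt o x (fun i => L (A (stdFrame k i))) =
      ((SignType.sign A.det : SignType) : ℝ) * signAt o x (fun i => L (stdFrame k i)) := by
  have h := alternating_comp_stdFrame ((o.at_ x).someVector.compLinearMap
    (L : (Fin k → ℝ) →ₗ[ℝ] EuclideanSpace ℝ (Fin k))) (A : (Fin k → ℝ) →ₗ[ℝ] (Fin k → ℝ))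
  have h' : (o.at_ x).someVector (fun i => L (A (stdFrame k i))) =
    A.det * (o.at_ x).someVector (fun i => L (stdFrame k i)) := h
  change ((SignType.sign ((o.at_ x).someVector (fun i => L (A (stdFrame k i)))) : SignType) : ℝ) = _
  rw [h', sign_mul, SignType.coe_mul]
  rfl

lemma signedValue_comp (o : ManifoldOrientation k S) (θ : DiffForm k k S) (x : S)
    (L : (Fin k → ℝ) →L[ℝ] EuclideanSpace ℝ (Fin k)) (A : (Fin k → ℝ) →L[ℝ] (Fin k → ℝ)) :
    signedValue o θ x (fun i => L (A (stdFrame k i))) =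
      |A.det| * signedValue o θ x (fun i => L (stdFrame k i)) := by
  have h := alternating_comp_stdFrame ((θ x).toAlternatingMap.compLinearMap
    (L : (Fin k → ℝ) →ₗ[ℝ] EuclideanSpace ℝ (Fin k))) (A : (Fin k → ℝ) →ₗ[ℝ] (Fin k → ℝ))
  have h' : θ x (fun i => L (A (stdFrame k i))) = A.det * θ x (fun i => L (stdFrame k i)) := h
  rw [signedValue, h', signAt_comp, signedValue]
  have := sign_mul_self (α := ℝ) A.det
  rw [← this]; ring

/-- The canonical identification of `ℝᵏ` with Euclidean space. -/
def euc (k : ℕ) : (Fin k → ℝ) ≃L[ℝ] EuclideanSpace ℝ (Fin k) :=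
  (EuclideanSpace.equiv (Fin k) ℝ).symm

lemma measurePreserving_euc : MeasurePreserving (euc k) volume volume :=
  PiLp.volume_preserving_toLp (Fin k)

lemma contMDiffAt_symm_euc {φ : OpenPartialHomeomorph S (EuclideanSpace ℝ (Fin k))}
    (hφ : φ ∈ IsManifold.maximalAtlas (𝓡 k) ∞ S) {z : Fin k → ℝ} (hz : euc k z ∈ φ.target) :
    ContMDiffAt 𝓘(ℝ, Fin k → ℝ) (𝓡 k) ∞ (φ.symm ∘ euc k) z :=
  (contMDiffAt_symm_of_mem_maximalAtlas hφ hz).comp z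
    ((euc k).contDiff.contMDiff z)

/-- The frame `∂₁F, …, ∂ₖF` of a parametrization, as vectors of the model space. -/
def paramFrame (F : (Fin k → ℝ) → S) (u : Fin k → ℝ) : Fin k → EuclideanSpace ℝ (Fin k) :=
  fun i => mfderiv 𝓘(ℝ, Fin k → ℝ) (𝓡 k) F u (stdFrame k i)

/-- The coordinate frame of a chart, as vectors of the model space. -/
def chartFrame (φ : OpenPartialHomeomorph S (EuclideanSpace ℝ (Fin k)))
    (y : EuclideanSpace ℝ (Fin k)) : Fin k → EuclideanSpace ℝ (Fin k) := coordFrame φ y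

lemma paramFrame_symm_euc {φ : OpenPartialHomeomorph S (EuclideanSpace ℝ (Fin k))}
    (hφ : φ ∈ IsManifold.maximalAtlas (𝓡 k) ∞ S) {z : Fin k → ℝ} (hz : euc k z ∈ φ.target) :
    paramFrame (φ.symm ∘ euc k) z = chartFrame φ (euc k z) := by
  ext1 i
  rw [paramFrame,
    mfderiv_comp z ((contMDiffAt_symm_of_mem_maximalAtlas hφ hz).mdifferentiableAt (by simp))
    (euc k).differentiableAt.mdifferentiableAt, mfderiv_eq_fderiv, (euc k).fderiv]
  rfl

/-- The derivative of a smooth map factors through the derivative of a chart, so that frames of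
different parametrizations are compared by the Jacobian of the coordinate change. -/
lemma mfderiv_factor {φ : OpenPartialHomeomorph S (EuclideanSpace ℝ (Fin k))}
    (hφ : φ ∈ IsManifold.maximalAtlas (𝓡 k) ∞ S) {F : (Fin k → ℝ) → S} {u : Fin k → ℝ}
    (hF : ContMDiffAt 𝓘(ℝ, Fin k → ℝ) (𝓡 k) ∞ F u) (hu : F u ∈ φ.source) :
    ContDiffAt ℝ ∞ (fun z => (euc k).symm (φ (F z))) u ∧
    ∃ L : (Fin k → ℝ) →L[ℝ] EuclideanSpace ℝ (Fin k),
      paramFrame F u = (fun i =>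
        L (fderiv ℝ (fun z => (euc k).symm (φ (F z))) u (stdFrame k i))) ∧
      chartFrame φ (φ (F u)) = fun i => L (stdFrame k i) := by
  have h1 : ContDiffAt ℝ ∞ (fun z => (euc k).symm (φ (F z))) u := by
    have : ContDiffAt ℝ ∞ (fun z => φ (F z)) u :=
      ((contMDiffAt_of_mem_maximalAtlas hφ hu).comp u hF).contDiffAt
    exact (euc k).symm.contDiff.contDiffAt.comp u this
  have hz : euc k ((euc k).symm (φ (F u))) ∈ φ.target := by simpa using φ.map_source hu
  refine ⟨h1, mfderiv 𝓘(ℝ, Fin k → ℝ) (𝓡 k) (φ.symm ∘ euc k) ((euc k).symm (φ (F u))), ?_, ?_⟩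
  swap
  · have h := paramFrame_symm_euc hφ hz
    rw [ContinuousLinearEquiv.apply_symm_apply] at h
    exact h.symm
  have h2 : F =ᶠ[𝓝 u] (φ.symm ∘ euc k) ∘ (fun z => (euc k).symm (φ (F z))) := by
    filter_upwards [hF.continuousAt.eventually (φ.open_source.mem_nhds hu)] with z hz
    simp [φ.left_inv hz]
  have h3 : (mfderiv 𝓘(ℝ, Fin k → ℝ) (𝓡 k) F u : (Fin k → ℝ) →L[ℝ] EuclideanSpace ℝ (Fin k)) =
      mfderiv 𝓘(ℝ, Fin k → ℝ) (𝓡 k)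
        ((φ.symm ∘ euc k) ∘ (fun z => (euc k).symm (φ (F z)))) u := h2.mfderiv_eq
  ext1 i
  change (mfderiv 𝓘(ℝ, Fin k → ℝ) (𝓡 k) F u : (Fin k → ℝ) →L[ℝ] EuclideanSpace ℝ (Fin k))
    (stdFrame k i) = _
  rw [h3, mfderiv_comp u ((contMDiffAt_symm_euc hφ hz).mdifferentiableAt (by simp))
    (h1.differentiableAt (by simp)).mdifferentiableAt, mfderiv_eq_fderiv]
  rfl

lemma signAt_paramFrame {φ : OpenPartialHomeomorph S (EuclideanSpace ℝ (Fin k))}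
    (hφ : φ ∈ IsManifold.maximalAtlas (𝓡 k) ∞ S) (o : ManifoldOrientation k S)
    {F : (Fin k → ℝ) → S} {u : Fin k → ℝ}
    (hF : ContMDiffAt 𝓘(ℝ, Fin k → ℝ) (𝓡 k) ∞ F u) (hu : F u ∈ φ.source) :
    signAt o (F u) (paramFrame F u) =
      ((SignType.sign (fderiv ℝ (fun z => (euc k).symm (φ (F z))) u).det : SignType) : ℝ) *
        signAt o (F u) (chartFrame φ (φ (F u))) := by
  obtain ⟨-, L, h1, h2⟩ := mfderiv_factor hφ hF hu
  rw [h1, h2, signAt_comp]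

lemma signedValue_paramFrame {φ : OpenPartialHomeomorph S (EuclideanSpace ℝ (Fin k))}
    (hφ : φ ∈ IsManifold.maximalAtlas (𝓡 k) ∞ S) (o : ManifoldOrientation k S)
    (θ : DiffForm k k S) {F : (Fin k → ℝ) → S} {u : Fin k → ℝ}
    (hF : ContMDiffAt 𝓘(ℝ, Fin k → ℝ) (𝓡 k) ∞ F u) (hu : F u ∈ φ.source) :
    signedValue o θ (F u) (paramFrame F u) =
      |(fderiv ℝ (fun z => (euc k).symm (φ (F z))) u).det| *
        signedValue o θ (F u) (chartFrame φ (φ (F u))) := by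
  obtain ⟨-, L, h1, h2⟩ := mfderiv_factor hφ hF hu
  rw [h1, h2, signedValue_comp]

lemma signedValue_eq_zero (o : ManifoldOrientation k S) {θ : DiffForm k k S} {x : S} (h : θ x = 0)
    (v : Fin k → EuclideanSpace ℝ (Fin k)) : signedValue o θ x v = 0 := by
  rw [signedValue, h]; exact mul_zero _

variable [IsManifold (𝓡 k) ∞ S]
variable [T2Space S] [CompactSpace S]

lemma localIntegrand_eq (o : ManifoldOrientation k S) (θ : DiffForm k k S) (i : S)
    (y : EuclideanSpace ℝ (Fin k)) :
    localIntegrand o (fun x v => θ x v) i y =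
      chartPartition k S i ((chartAt (EuclideanSpace ℝ (Fin k)) i).symm y) *
      signedValue o θ ((chartAt (EuclideanSpace ℝ (Fin k)) i).symm y)
        (chartFrame (chartAt (EuclideanSpace ℝ (Fin k)) i) y) := rfl

variable (k S) in
lemma finite_chartPartition : {i : S | ∃ x, chartPartition k S i x ≠ 0}.Finite := by
  have := (chartPartition k S).locallyFinite.finite_nonempty_of_compact
  exact this

/-- The contribution of one chart to the integral of a form supported in the image of a
parametrization. -/
lemma setIntegral_localIntegrand_eq (o : ManifoldOrientation k S) {θ : DiffForm k k S}
    {N : Set (Fin k → ℝ)} (hN : IsOpen N) {F : (Fin k → ℝ) → S}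
    (hF : ContMDiffOn 𝓘(ℝ, Fin k → ℝ) (𝓡 k) ∞ F N) (hinj : InjOn F N)
    (hsupp : ∀ x, θ x ≠ 0 → x ∈ F '' N) (i : S) :
    ∫ y in (chartAt (EuclideanSpace ℝ (Fin k)) i).target,
      localIntegrand o (fun x v => θ x v) i y =
    ∫ u in N, chartPartition k S i (F u) * signedValue o θ (F u) (paramFrame F u) := by
  set φ := chartAt (EuclideanSpace ℝ (Fin k)) i with hφdef
  have hφ : φ ∈ IsManifold.maximalAtlas (𝓡 k) ∞ S := IsManifold.chart_mem_maximalAtlas _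
  have hFat : ∀ u ∈ N, ContMDiffAt 𝓘(ℝ, Fin k → ℝ) (𝓡 k) ∞ F u := fun u hu =>
    hF.contMDiffAt (hN.mem_nhds hu)
  set g : (Fin k → ℝ) → (Fin k → ℝ) := fun z => (euc k).symm (φ (F z)) with hg
  set T : Set (Fin k → ℝ) := euc k ⁻¹' φ.target with hT
  have hTo : IsOpen T := φ.open_target.preimage (euc k).continuous
  set N' : Set (Fin k → ℝ) := N ∩ F ⁻¹' φ.source with hN'
  have hN'o : IsOpen N' := hF.continuousOn.isOpen_inter_preimage hN φ.open_source
  set h : (Fin k → ℝ) → ℝ := fun z => localIntegrand o (fun x v => θ x v) i (euc k z) with hh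
  have hemb : MeasurableEmbedding (euc k) := (euc k).toHomeomorph.measurableEmbedding
  have hgN' : g '' N' ⊆ T := by
    rintro _ ⟨u, hu, rfl⟩
    simpa [hT, hg] using φ.map_source hu.2
  have hginj : InjOn g N' := by
    intro u hu v hv huv
    exact hinj hu.1 hv.1 (φ.injOn hu.2 hv.2 ((euc k).symm.injective huv))
  calc ∫ y in φ.target, localIntegrand o (fun x v => θ x v) i y
      = ∫ z in T, h z := (measurePreserving_euc.setIntegral_preimage_emb hemb _ _).symm
    _ = ∫ z in g '' N', h z := by
        refine setIntegral_eq_of_subset_of_forall_sdiff_eq_zero hTo.measurableSet hgN' ?_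
        rintro z ⟨hzT, hz⟩
        by_contra hne
        have hθ : θ (φ.symm (euc k z)) ≠ 0 := by
          intro h0
          apply hne
          rw [hh]
          simp only
          rw [localIntegrand_eq, signedValue_eq_zero o h0, mul_zero]
        obtain ⟨u, huN, hu⟩ := hsupp _ hθ
        refine hz ⟨u, ⟨huN, ?_⟩, ?_⟩
        · rw [mem_preimage, hu]; exact φ.map_target hzT
        · simp only [hg]
          rw [hu, φ.right_inv hzT, ContinuousLinearEquiv.symm_apply_apply]
    _ = ∫ u in N', |(fderiv ℝ g u).det| • h (g u) :=
        integral_image_eq_integral_abs_det_fderiv_smul volume hN'o.measurableSet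
          (fun u hu => ((mfderiv_factor hφ (hFat u hu.1) hu.2).1.differentiableAt
            (by simp)).hasFDerivAt.hasFDerivWithinAt) hginj _
    _ = ∫ u in N', chartPartition k S i (F u) * signedValue o θ (F u) (paramFrame F u) := by
        refine setIntegral_congr_fun hN'o.measurableSet fun u hu => ?_
        simp only [hh]
        rw [localIntegrand_eq, signedValue_paramFrame hφ o θ (hFat u hu.1) hu.2, smul_eq_mul]
        have h1 : euc k (g u) = φ (F u) := by simp [hg]
        rw [← hφdef, h1, φ.left_inv hu.2]
        ring
    _ = ∫ u in N, chartPartition k S i (F u) * signedValue o θ (F u) (paramFrame F u) := by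
        symm
        refine setIntegral_eq_of_subset_of_forall_sdiff_eq_zero hN.measurableSet
          inter_subset_left ?_
        rintro u ⟨huN, hu⟩
        have : chartPartition k S i (F u) = 0 := by
          by_contra hne
          exact hu ⟨huN, chartPartition_isSubordinate i (subset_closure hne)⟩
        rw [this, zero_mul]

/-- The integral of a form supported in the image of an oriented parametrization. -/
lemma formIntegral_eq_of_param (o : ManifoldOrientation k S) {θ : DiffForm k k S}
    (hθ : PullDifferentiable θ) {N K : Set (Fin k → ℝ)} (hN : IsOpen N) (hK : IsCompact K)
    (hKN : K ⊆ N) {F : (Fin k → ℝ) → S} (hF : ContMDiffOn 𝓘(ℝ, Fin k → ℝ) (𝓡 k) ∞ F N)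
    (hinj : InjOn F N) {ε : ℝ} (hsign : ∀ u ∈ N, signAt o (F u) (paramFrame F u) = ε)
    (hsupp : ∀ x, θ x ≠ 0 → x ∈ F '' K) :
    formIntegral o (fun x v => θ x v) = ε * ∫ u in K, pull F θ u (stdFrame k) := by
  have hFat : ∀ u ∈ N, ContMDiffAt 𝓘(ℝ, Fin k → ℝ) (𝓡 k) ∞ F u := fun u hu =>
    hF.contMDiffAt (hN.mem_nhds hu)
  have hzero : ∀ u ∈ N \ K, θ (F u) = 0 := by
    rintro u ⟨huN, huK⟩
    by_contra hne
    obtain ⟨v, hv, hvu⟩ := hsupp _ hne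
    exact huK (hinj (hKN hv) huN hvu ▸ hv)
  have hpull : ∀ u, pull F θ u (stdFrame k) = θ (F u) (paramFrame F u) := fun u => rfl
  have hval : ∀ u ∈ N, signedValue o θ (F u) (paramFrame F u) =
      ε * pull F θ u (stdFrame k) := by
    intro u hu; rw [signedValue, hsign u hu, hpull]
  have hi : ∀ i : S, ∫ y in (chartAt (EuclideanSpace ℝ (Fin k)) i).target,
      localIntegrand o (fun x v => θ x v) i y =
      ∫ u in K, chartPartition k S i (F u) * (ε * pull F θ u (stdFrame k)) := by
    intro i
    rw [setIntegral_localIntegrand_eq o hN hF hinj (fun x hx => image_mono hKN (hsupp x hx)) i,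
      setIntegral_eq_of_subset_of_forall_sdiff_eq_zero hN.measurableSet hKN
        (fun u hu => by rw [signedValue_eq_zero o (hzero u hu), mul_zero])]
    exact setIntegral_congr_fun hK.measurableSet fun u hu => by simp only [hval u (hKN hu)]
  have hint : ∀ i : S, IntegrableOn
      (fun u => chartPartition k S i (F u) * (ε * pull F θ u (stdFrame k))) K := by
    intro i
    refine ContinuousOn.integrableOn_compact hK fun u hu => ContinuousAt.continuousWithinAt ?_
    have h1 := ((hθ (hFat u (hKN hu))).continuousAlternatingMap_apply_const
      (stdFrame k)).continuousAt
    have h2 : ContinuousAt (fun u => chartPartition k S i (F u)) u :=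
      ((chartPartition k S i).contMDiff.continuous.continuousAt).comp (hFat u (hKN hu)).continuousAt
    exact h2.mul (h1.const_mul ε)
  rw [formIntegral, finsum_congr hi]
  rw [finsum_eq_sum_of_support_subset (s := (finite_chartPartition k S).toFinset)]
  · rw [← integral_finsetSum _ fun i _ => hint i, ← integral_const_mul]
    refine setIntegral_congr_fun hK.measurableSet fun u hu => ?_
    rw [← Finset.sum_mul]
    have h1 : ∑ᶠ i, chartPartition k S i (F u) = 1 :=
      (chartPartition k S).sum_eq_one (mem_univ _)
    rw [finsum_eq_sum_of_support_subset (s := (finite_chartPartition k S).toFinset)] at h1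
    · rw [h1, one_mul]
    · intro i hi
      rw [Finite.coe_toFinset]
      exact ⟨F u, hi⟩
  · intro i hi
    rw [Finite.coe_toFinset]
    by_contra hne
    apply hi
    have : ∀ x, chartPartition k S i x = 0 := by
      intro x; by_contra h; exact hne ⟨x, h⟩
    simp [this]

end Param

/-! ### Linearity of the integral and oriented boxes -/

section Boxes

variable {k : ℕ} {S : Type*} [TopologicalSpace S] [ChartedSpace (EuclideanSpace ℝ (Fin k)) S]

/-- A function with values in `{-1, 0, 1}` is constant near its points of continuity. -/
lemma eventually_eq_of_continuousAt_sign {X : Type*} [TopologicalSpace X] {s : X → SignType} {x : X}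
    (h : ContinuousAt (fun y => ((s y : SignType) : ℝ)) x) : ∀ᶠ y in 𝓝 x, s y = s x := by
  have h1 := Metric.tendsto_nhds.1 h 1 one_pos
  filter_upwards [h1] with y hy
  revert hy
  rw [Real.dist_eq]
  cases s y <;> cases s x <;> norm_num

lemma eventually_signAt_chartFrame [IsManifold (𝓡 k) ∞ S] (o : ManifoldOrientation k S)
    {φ : OpenPartialHomeomorph S (EuclideanSpace ℝ (Fin k))}
    (hφ : φ ∈ IsManifold.maximalAtlas (𝓡 k) ∞ S) {y : EuclideanSpace ℝ (Fin k)}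
    (hy : y ∈ φ.target) : ∀ᶠ z in 𝓝 y,
      signAt o (φ.symm z) (chartFrame φ z) = signAt o (φ.symm y) (chartFrame φ y) := by
  have h := (o.continuousOn_sign φ hφ).continuousAt (φ.open_target.mem_nhds hy)
  filter_upwards [eventually_eq_of_continuousAt_sign h] with z hz
  change ((SignType.sign _ : SignType) : ℝ) = ((SignType.sign _ : SignType) : ℝ)
  exact congrArg _ hz

/-- The sign of the frame of a parametrization is locally constant where it does not vanish; there
the coordinate expression of the parametrization has invertible derivative. -/
lemma eventually_signAt_paramFrame [IsManifold (𝓡 k) ∞ S] (o : ManifoldOrientation k S)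
    {φ : OpenPartialHomeomorph S (EuclideanSpace ℝ (Fin k))}
    (hφ : φ ∈ IsManifold.maximalAtlas (𝓡 k) ∞ S)
    {F : (Fin k → ℝ) → S} {u : Fin k → ℝ}
    (hFev : ∀ᶠ z in 𝓝 u, ContMDiffAt 𝓘(ℝ, Fin k → ℝ) (𝓡 k) ∞ F z)
    (hu : F u ∈ φ.source) (hne : signAt o (F u) (paramFrame F u) ≠ 0) :
    (fderiv ℝ (fun z => (euc k).symm (φ (F z))) u).det ≠ 0 ∧
    ∀ᶠ z in 𝓝 u, signAt o (F z) (paramFrame F z) = signAt o (F u) (paramFrame F u) := by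
  have hF := hFev.self_of_nhds
  have hdet : (fderiv ℝ (fun z => (euc k).symm (φ (F z))) u).det ≠ 0 := by
    intro h0
    apply hne
    rw [signAt_paramFrame hφ o hF hu, h0]
    simp
  refine ⟨hdet, ?_⟩
  have hg := (mfderiv_factor hφ hF hu).1
  have h1 : ContinuousAt (fun z => (fderiv ℝ (fun z => (euc k).symm (φ (F z))) z).det) u :=
    ContinuousLinearMap.continuous_det.continuousAt.comp
      (hg.fderiv_right (m := 0) (by simp)).continuousAt
  have h2 : ∀ᶠ z in 𝓝 u, SignType.sign (fderiv ℝ (fun z => (euc k).symm (φ (F z))) z).det =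
      SignType.sign (fderiv ℝ (fun z => (euc k).symm (φ (F z))) u).det := by
    rcases hdet.lt_or_gt with h | h
    · filter_upwards [h1.eventually_lt_const h] with z hz
      rw [sign_neg h, sign_neg hz]
    · filter_upwards [h1.eventually_const_lt h] with z hz
      rw [sign_pos h, sign_pos hz]
  have h3 : ContinuousAt (fun z => φ (F z)) u := by
    have := (euc k).continuous.continuousAt.comp hg.continuousAt
    simpa [Function.comp_def] using this
  have h4 := h3.eventually (eventually_signAt_chartFrame o hφ (φ.map_source hu))
  filter_upwards [h2, h4, hFev,
    hF.continuousAt.eventually (φ.open_source.mem_nhds hu)] with z hz2 hz4 hz5 hz6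
  rw [signAt_paramFrame hφ o hz5 hz6, signAt_paramFrame hφ o hF hu, hz2]
  rw [φ.left_inv hz6, φ.left_inv hu] at hz4
  rw [hz4]

/-- A smooth parametrization of an open subset of an oriented manifold by a neighbourhood of a
box, the sign of whose frame is a constant `ε`. The coordinates are not required to be positively
oriented, as an oriented point may be negative. -/
structure OrientedBox (o : ManifoldOrientation k S) where
  /-- The parametrization. -/
  F : (Fin k → ℝ) → S
  /-- A neighbourhood of the box on which the parametrization is a smooth embedding. -/
  N : Set (Fin k → ℝ)
  /-- The lower corner of the box. -/
  a : Fin k → ℝ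
  /-- The upper corner of the box. -/
  b : Fin k → ℝ
  /-- The sign of the frame. -/
  ε : ℝ
  isOpen : IsOpen N
  le : a ≤ b
  subset : Icc a b ⊆ N
  contMDiffOn : ContMDiffOn 𝓘(ℝ, Fin k → ℝ) (𝓡 k) ∞ F N
  injOn : InjOn F N
  sign_eq : ∀ u ∈ N, signAt o (F u) (paramFrame F u) = ε

/-- The image of the open box. -/
def OrientedBox.inner {o : ManifoldOrientation k S} (B : OrientedBox o) : Set S :=
  B.F '' (pi univ fun i => Ioo (B.a i) (B.b i))

lemma OrientedBox.contMDiffAt {o : ManifoldOrientation k S} (B : OrientedBox o) {u : Fin k → ℝ}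
    (hu : u ∈ B.N) : ContMDiffAt 𝓘(ℝ, Fin k → ℝ) (𝓡 k) ∞ B.F u :=
  B.contMDiffOn.contMDiffAt (B.isOpen.mem_nhds hu)

lemma OrientedBox.notMem_inner {o : ManifoldOrientation k S} (B : OrientedBox o) {u : Fin k → ℝ}
    (hu : u ∈ Icc B.a B.b) {i : Fin k} (hi : u i = B.a i ∨ u i = B.b i) : B.F u ∉ B.inner := by
  rintro ⟨v, hv, hvu⟩
  have hvI : v ∈ Icc B.a B.b :=
    ⟨fun i => (hv i (mem_univ _)).1.le, fun i => (hv i (mem_univ _)).2.le⟩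
  have := B.injOn (B.subset hvI) (B.subset hu) hvu
  subst this
  have h1 := hv i (mem_univ _)
  rcases hi with hi | hi
  · exact h1.1.ne' hi
  · exact h1.2.ne hi

lemma OrientedBox.inner_subset {o : ManifoldOrientation k S} (B : OrientedBox o) :
    B.inner ⊆ B.F '' Icc B.a B.b :=
  image_mono fun _ hv => ⟨fun i => (hv i (mem_univ _)).1.le, fun i => (hv i (mem_univ _)).2.le⟩

lemma exists_orientedBox [IsManifold (𝓡 k) ∞ S] (o : ManifoldOrientation k S) (x : S) {O : Set S}
    (hO : O ∈ 𝓝 x) : ∃ B : OrientedBox o, B.F '' B.N ⊆ O ∧ B.inner ∈ 𝓝 x := by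
  set φ := chartAt (EuclideanSpace ℝ (Fin k)) x
  have hφ : φ ∈ IsManifold.maximalAtlas (𝓡 k) ∞ S := IsManifold.chart_mem_maximalAtlas _
  have hx : x ∈ φ.source := mem_chart_source _ _
  set z₀ : Fin k → ℝ := (euc k).symm (φ x) with hz₀
  have hz : euc k z₀ = φ x := by simp [hz₀]
  have hzt : euc k z₀ ∈ φ.target := hz ▸ φ.map_source hx
  have e1 : ∀ᶠ z in 𝓝 z₀, euc k z ∈ φ.target :=
    (euc k).continuous.continuousAt.eventually (φ.open_target.mem_nhds hzt)
  have e2 : ∀ᶠ z in 𝓝 z₀, signAt o (φ.symm (euc k z)) (chartFrame φ (euc k z)) =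
      signAt o (φ.symm (euc k z₀)) (chartFrame φ (euc k z₀)) :=
    (euc k).continuous.continuousAt.eventually (eventually_signAt_chartFrame o hφ hzt)
  have hc : ContinuousAt (φ.symm ∘ euc k) z₀ := (contMDiffAt_symm_euc hφ hzt).continuousAt
  have e3 : ∀ᶠ z in 𝓝 z₀, φ.symm (euc k z) ∈ O := by
    refine hc.eventually ?_
    simpa [hz, φ.left_inv hx] using hO
  obtain ⟨r, hr, hball⟩ := Metric.eventually_nhds_iff_ball.1 (e1.and (e2.and e3))
  refine ⟨⟨φ.symm ∘ euc k, Metric.ball z₀ r, fun i => z₀ i - r / 2, fun i => z₀ i + r / 2,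
    signAt o (φ.symm (euc k z₀)) (chartFrame φ (euc k z₀)), Metric.isOpen_ball,
    fun i => by linarith, ?_, ?_, ?_, ?_⟩, ?_, ?_⟩
  · intro u hu
    rw [Metric.mem_ball, dist_pi_lt_iff hr]
    intro i
    have h1 := hu.1 i
    have h2 := hu.2 i
    simp only at h1 h2
    rw [Real.dist_eq, abs_lt]
    constructor <;> linarith
  · exact fun u hu => (contMDiffAt_symm_euc hφ (hball u hu).1).contMDiffWithinAt
  · intro u hu v hv huv
    exact (euc k).injective (φ.symm.injOn (hball u hu).1 (hball v hv).1 huv)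
  · intro u hu
    rw [paramFrame_symm_euc hφ (hball u hu).1]
    exact (hball u hu).2.1
  · rintro _ ⟨u, hu, rfl⟩
    exact (hball u hu).2.2
  · have h1 : ∀ᶠ s in 𝓝 x, (euc k).symm (φ s) ∈
        (pi univ fun i => Ioo (z₀ i - r / 2) (z₀ i + r / 2) : Set (Fin k → ℝ)) := by
      have hcont : ContinuousAt (fun s => (euc k).symm (φ s)) x :=
        (euc k).symm.continuous.continuousAt.comp (φ.continuousAt hx)
      refine hcont.eventually ((isOpen_set_pi finite_univ fun i _ => isOpen_Ioo).mem_nhds ?_)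
      intro i _
      change z₀ i ∈ Ioo _ _
      constructor <;> linarith
    filter_upwards [h1, φ.open_source.mem_nhds hx] with s hs hs'
    exact ⟨_, hs, by simp [φ.left_inv hs']⟩

variable [IsManifold (𝓡 k) ∞ S] [T2Space S] [CompactSpace S]

variable (k) in
/-- A finite smooth partition of unity subordinate to a family of neighbourhoods. -/
lemma exists_finite_partition (W : S → Set S) (hW : ∀ x, W x ∈ 𝓝 x) :
    ∃ (s : Finset S) (χ : S → S → ℝ), (∀ i, ContMDiff (𝓡 k) 𝓘(ℝ, ℝ) ∞ (χ i)) ∧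
      (∀ i, tsupport (χ i) ⊆ W i) ∧ ∀ x, ∑ i ∈ s, χ i x = 1 := by
  obtain ⟨ρ, hρ⟩ := SmoothPartitionOfUnity.exists_isSubordinate (𝓡 k) (isClosed_univ (X := S))
    (fun x => interior (W x)) (fun x => isOpen_interior)
    (fun x _ => mem_iUnion.2 ⟨x, mem_interior_iff_mem_nhds.2 (hW x)⟩)
  have hfin : {i : S | (Function.support (ρ i)).Nonempty}.Finite :=
    ρ.locallyFinite.finite_nonempty_of_compact
  refine ⟨hfin.toFinset, fun i => ρ i, fun i => (ρ i).contMDiff,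
    fun i => (hρ i).trans interior_subset, fun x => ?_⟩
  rw [← ρ.sum_eq_one (mem_univ x)]
  symm
  refine finsum_eq_sum_of_support_subset _ fun i hi => ?_
  rw [Finite.coe_toFinset]
  exact ⟨x, hi⟩

/-- The sum defining the integral, over a fixed finite set of charts. -/
lemma formIntegral_eq_sum (o : ManifoldOrientation k S)
    (θ : ∀ x : S, (Fin k → TangentSpace (𝓡 k) x) → ℝ) :
    formIntegral o θ = ∑ i ∈ (finite_chartPartition k S).toFinset,
      ∫ y in (chartAt (EuclideanSpace ℝ (Fin k)) i).target, localIntegrand o θ i y := by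
  refine finsum_eq_sum_of_support_subset _ fun i hi => ?_
  rw [Finite.coe_toFinset]
  by_contra hne
  apply hi
  have : ∀ x, chartPartition k S i x = 0 := by
    intro x; by_contra h; exact hne ⟨x, h⟩
  simp [localIntegrand, this]

/-- In each chart the integrand is continuous, and it vanishes off the compact image of the support
of the corresponding function of the partition of unity. -/
lemma PullDifferentiable.formIntegrable (o : ManifoldOrientation k S) {θ : DiffForm k k S}
    (hθ : PullDifferentiable θ) : FormIntegrable o (fun x v => θ x v) := by
  intro i
  set φ := chartAt (EuclideanSpace ℝ (Fin k)) i with hφdef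
  have hφ : φ ∈ IsManifold.maximalAtlas (𝓡 k) ∞ S := IsManifold.chart_mem_maximalAtlas _
  set C : Set S := tsupport (chartPartition k S i)
  have hC : IsCompact C := (isClosed_tsupport _).isCompact
  have hCs : C ⊆ φ.source := chartPartition_isSubordinate i
  have hK : IsCompact (φ '' C) := hC.image_of_continuousOn (φ.continuousOn.mono hCs)
  have hKt : φ '' C ⊆ φ.target := by rintro _ ⟨x, hx, rfl⟩; exact φ.map_source (hCs hx)
  have hcont : ContinuousOn (localIntegrand o (fun x v => θ x v) i) φ.target := by
    refine ContinuousOn.mul ?_ (ContinuousOn.mul (o.continuousOn_sign φ hφ) ?_)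
    · exact (chartPartition k S i).contMDiff.continuous.comp_continuousOn φ.continuousOn_symm
    · have h1 : ContinuousOn (fun y => pull (φ.symm ∘ euc k) θ ((euc k).symm y) (stdFrame k))
          φ.target := by
        intro y hy
        have hy' : euc k ((euc k).symm y) ∈ φ.target := by simpa using hy
        have := ((hθ (contMDiffAt_symm_euc hφ hy')).continuousAlternatingMap_apply_const
          (stdFrame k)).continuousAt
        exact (this.comp (euc k).symm.continuous.continuousAt).continuousWithinAt
      refine h1.congr fun y hy => ?_
      have hy' : euc k ((euc k).symm y) ∈ φ.target := by simpa using hy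
      change θ (φ.symm y) (chartFrame φ y) =
        θ (φ.symm (euc k ((euc k).symm y))) (paramFrame (φ.symm ∘ euc k) ((euc k).symm y))
      rw [paramFrame_symm_euc hφ hy', ContinuousLinearEquiv.apply_symm_apply]
  refine IntegrableOn.of_forall_sdiff_eq_zero ((hcont.mono hKt).integrableOn_compact hK)
    φ.open_target.measurableSet fun y hy => ?_
  have h0 : chartPartition k S i (φ.symm y) = 0 := by
    by_contra hne
    exact hy.2 ⟨φ.symm y, subset_closure hne, φ.right_inv hy.1⟩
  rw [localIntegrand_eq, ← hφdef, h0, zero_mul]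

lemma formIntegral_sum (o : ManifoldOrientation k S) {κ : Type*} (s : Finset κ)
    {θ : κ → DiffForm k k S} (hθ : ∀ j ∈ s, PullDifferentiable (θ j)) :
    formIntegral o (fun x v => (∑ j ∈ s, θ j) x v) =
      ∑ j ∈ s, formIntegral o (fun x v => θ j x v) := by
  simp only [formIntegral_eq_sum]
  rw [Finset.sum_comm]
  refine Finset.sum_congr rfl fun i _ => ?_
  rw [← integral_finsetSum _ fun j hj => (hθ j hj).formIntegrable o i]
  refine integral_congr_ae (Eventually.of_forall fun y => ?_)
  simp [localIntegrand, Finset.sum_apply, Finset.mul_sum]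

end Boxes

/-! ### Stokes' theorem on a closed manifold -/

section Closed

variable {p k n : ℕ} {S : Type*} [TopologicalSpace S] [ChartedSpace (EuclideanSpace ℝ (Fin k)) S]
  {M : Type*} [TopologicalSpace M] [ChartedSpace (EuclideanSpace ℝ (Fin n)) M]

/-- `dη = θ`, tested on pullbacks to Euclidean spaces. -/
def PullHasExtDeriv (η : DiffForm p k S) (θ : DiffForm (p + 1) k S) : Prop :=
  ∀ ⦃q : ℕ⦄ ⦃F : (Fin q → ℝ) → S⦄ ⦃y : Fin q → ℝ⦄,
    (∀ᶠ z in 𝓝 y, ContMDiffAt 𝓘(ℝ, Fin q → ℝ) (𝓡 k) ∞ F z) → extDeriv (pull F η) y = pull F θ y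

lemma ContMDiffAt.eventually_mdifferentiableAt [IsManifold (𝓡 k) ∞ S] {E : Type*} [NormedAddCommGroup E]
    [NormedSpace ℝ E] {F : E → S} {y : E} (hF : ContMDiffAt 𝓘(ℝ, E) (𝓡 k) ∞ F y) :
    ∀ᶠ z in 𝓝 y, MDifferentiableAt 𝓘(ℝ, E) (𝓡 k) F z := by
  have h1 : ContMDiffAt 𝓘(ℝ, E) (𝓡 k) 1 F y := hF.of_le (by norm_cast)
  have : IsManifold (𝓡 k) 1 S := IsManifold.of_le (n := ∞) (by norm_cast)
  obtain ⟨V, hV, hFV⟩ := (contMDiffAt_iff_contMDiffOn_nhds (by simp)).1 h1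
  filter_upwards [eventually_mem_nhds_iff.2 hV] with z hz
  exact (hFV.contMDiffAt hz).mdifferentiableAt (by simp)

lemma eventually_pull_pullForm [IsManifold (𝓡 k) ∞ S] {ι : S → M}
    (hι : ContMDiff (𝓡 k) (𝓡 n) ∞ ι) {E : Type*} [NormedAddCommGroup E]
    [NormedSpace ℝ E] {F : E → S} {y : E} (hF : ContMDiffAt 𝓘(ℝ, E) (𝓡 k) ∞ F y)
    (η : DiffForm p n M) : pull F (pullForm ι η : DiffForm p k S) =ᶠ[𝓝 y] pull (ι ∘ F) η := by
  filter_upwards [ContMDiffAt.eventually_mdifferentiableAt hF] with z hz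
  exact pull_pullForm ((hι _).mdifferentiableAt (by simp)) hz η

lemma pullDifferentiable_pullForm [IsManifold (𝓡 k) ∞ S] [IsManifold (𝓡 n) ∞ M] {ι : S → M}
    (hι : ContMDiff (𝓡 k) (𝓡 n) ∞ ι) {η : DiffForm p n M} (hη : η.IsSmooth) :
    PullDifferentiable (pullForm ι η : DiffForm p k S) := fun _ _ y hF =>
  (IsSmooth.differentiableAt_pull hη ((hι _).comp y hF)).congr_of_eventuallyEq
    (eventually_pull_pullForm hι hF η)

lemma pullHasExtDeriv_pullForm [IsManifold (𝓡 k) ∞ S] [IsManifold (𝓡 n) ∞ M] {ι : S → M}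
    (hι : ContMDiff (𝓡 k) (𝓡 n) ∞ ι) {η : DiffForm p n M} {θ : DiffForm (p + 1) n M}
    (hη : η.IsSmooth) (hθ : η.HasExtDeriv θ) :
    PullHasExtDeriv (pullForm ι η : DiffForm p k S) (pullForm ι θ) := by
  intro q F y hF
  rw [(eventually_pull_pullForm hι hF.self_of_nhds η).extDeriv_eq,
    HasExtDeriv.extDeriv_pull hη hθ ((hι _).comp y hF.self_of_nhds),
    (eventually_pull_pullForm hι hF.self_of_nhds θ).self_of_nhds]

/-- The product of a function and a form. -/
def mulForm (χ : S → ℝ) (η : DiffForm p k S) : DiffForm p k S := fun x => χ x • η x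

lemma pull_mulForm {E : Type*} [NormedAddCommGroup E] [NormedSpace ℝ E] (F : E → S) (χ : S → ℝ)
    (η : DiffForm p k S) : pull F (mulForm χ η) = fun y => χ (F y) • pull F η y := rfl

lemma PullDifferentiable.mulForm {χ : S → ℝ} (hχ : ContMDiff (𝓡 k) 𝓘(ℝ, ℝ) ∞ χ)
    {η : DiffForm p k S} (hη : PullDifferentiable η) : PullDifferentiable (mulForm χ η) := by
  intro q F y hF
  rw [pull_mulForm]
  have h1 : ContDiffAt ℝ ∞ (fun y => χ (F y)) y := ((hχ _).comp y hF).contDiffAt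
  exact (h1.differentiableAt (by simp)).smul (hη hF)

/-- The differential of a function, as a functional on the model space. -/
def differential (χ : S → ℝ) (x : S) : EuclideanSpace ℝ (Fin k) →L[ℝ] ℝ :=
  mfderiv (𝓡 k) 𝓘(ℝ, ℝ) χ x

/-- The product `dχ ∧ η` of the differential of a function and a form. -/
def dWedge (χ : S → ℝ) (η : DiffForm p k S) : DiffForm (p + 1) k S := fun x =>
  ContinuousAlternatingMap.alternatizeUncurryFin (E := EuclideanSpace ℝ (Fin k))
    ((differential χ x).smulRight (η x : EuclideanSpace ℝ (Fin k) [⋀^Fin p]→L[ℝ] ℝ))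

lemma dWedge_apply (χ : S → ℝ) (η : DiffForm p k S) (x : S)
    (v : Fin (p + 1) → EuclideanSpace ℝ (Fin k)) :
    dWedge χ η x v = ∑ j : Fin (p + 1), (-1 : ℤ) ^ (j : ℕ) •
      (differential χ x (v j) * η x (j.removeNth v)) :=
  ContinuousAlternatingMap.alternatizeUncurryFin_apply _ _

lemma pull_dWedge {E : Type*} [NormedAddCommGroup E] [NormedSpace ℝ E] {F : E → S} {y : E}
    (hF : MDifferentiableAt 𝓘(ℝ, E) (𝓡 k) F y) {χ : S → ℝ}
    (hχ : MDifferentiableAt (𝓡 k) 𝓘(ℝ, ℝ) χ (F y)) (η : DiffForm p k S) :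
    pull F (dWedge χ η) y = ContinuousAlternatingMap.alternatizeUncurryFin
      ((fderiv ℝ (fun z => χ (F z)) y).smulRight (pull F η y)) := by
  have h : fderiv ℝ (fun z => χ (F z)) y = (differential χ (F y)).comp
      (mfderiv 𝓘(ℝ, E) (𝓡 k) F y : E →L[ℝ] EuclideanSpace ℝ (Fin k)) := by
    rw [← mfderiv_eq_fderiv]
    exact mfderiv_comp y hχ hF
  ext v
  rw [h, ContinuousAlternatingMap.alternatizeUncurryFin_apply]
  exact dWedge_apply χ η (F y) _

lemma pullHasExtDeriv_mulForm {χ : S → ℝ} (hχ : ContMDiff (𝓡 k) 𝓘(ℝ, ℝ) ∞ χ)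
    {η : DiffForm p k S} {θ : DiffForm (p + 1) k S} (hη : PullDifferentiable η)
    (hθ : PullHasExtDeriv η θ) :
    PullHasExtDeriv (mulForm χ η) (mulForm χ θ + dWedge χ η) := by
  intro q F y hF
  have hF0 := hF.self_of_nhds
  have h1 : ContDiffAt ℝ ∞ (fun y => χ (F y)) y := ((hχ _).comp y hF0).contDiffAt
  have h2 := (h1.differentiableAt (by simp)).hasFDerivAt.smul (hη hF0).hasFDerivAt
  have h3 : pull F (mulForm χ θ + dWedge χ η) y = pull F (mulForm χ θ) y + pull F (dWedge χ η) y :=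
    rfl
  rw [h3, pull_dWedge (hF0.mdifferentiableAt (by simp)) ((hχ _).mdifferentiableAt (by simp)),
    pull_mulForm, pull_mulForm, extDeriv]
  have h4 : fderiv ℝ (fun y => χ (F y) • pull F η y) y = _ := h2.fderiv
  rw [h4, ContinuousAlternatingMap.alternatizeUncurryFin_add,
    ContinuousAlternatingMap.alternatizeUncurryFin_smul, ← extDeriv, hθ hF]

lemma pullDifferentiable_dWedge {χ : S → ℝ} (hχ : ContMDiff (𝓡 k) 𝓘(ℝ, ℝ) ∞ χ)
    [IsManifold (𝓡 k) ∞ S]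
    {η : DiffForm p k S} (hη : PullDifferentiable η) : PullDifferentiable (dWedge χ η) := by
  intro q F y hF
  have h1 : ContDiffAt ℝ ∞ (fun y => χ (F y)) y := ((hχ _).comp y hF).contDiffAt
  have h2 : DifferentiableAt ℝ (fderiv ℝ (fun y => χ (F y))) y :=
    (h1.fderiv_right (m := 1) (by norm_cast)).differentiableAt (by simp)
  have h3 : DifferentiableAt ℝ (fun z => ContinuousAlternatingMap.alternatizeUncurryFinCLM ℝ
      (Fin q → ℝ) ℝ (ContinuousLinearMap.smulRightL ℝ (Fin q → ℝ)
        ((Fin q → ℝ) [⋀^Fin p]→L[ℝ] ℝ) (fderiv ℝ (fun y => χ (F y)) z) (pull F η z))) y := by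
    refine (ContinuousAlternatingMap.alternatizeUncurryFinCLM ℝ
      (Fin q → ℝ) ℝ).differentiableAt.comp y ?_
    exact ((ContinuousLinearMap.smulRightL ℝ (Fin q → ℝ)
        ((Fin q → ℝ) [⋀^Fin p]→L[ℝ] ℝ)).differentiableAt.comp y h2).clm_apply (hη hF)
  refine h3.congr_of_eventuallyEq ?_
  filter_upwards [ContMDiffAt.eventually_mdifferentiableAt hF] with z hz
  rw [pull_dWedge hz ((hχ _).mdifferentiableAt (by simp))]
  rfl

lemma PullDifferentiable.add {η θ : DiffForm p k S} (hη : PullDifferentiable η)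
    (hθ : PullDifferentiable θ) : PullDifferentiable (η + θ) :=
  fun _ _ _ hF => (hη hF).add (hθ hF)

lemma PullDifferentiable.sub {η θ : DiffForm p k S} (hη : PullDifferentiable η)
    (hθ : PullDifferentiable θ) : PullDifferentiable (η - θ) :=
  fun _ _ _ hF => (hη hF).sub (hθ hF)

lemma dWedge_eq_zero {χ : S → ℝ} {η : DiffForm p k S} {x : S} (hx : x ∉ tsupport χ) :
    dWedge χ η x = 0 := by
  have h : χ =ᶠ[𝓝 x] fun _ => 0 := notMem_tsupport_iff_eventuallyEq.1 hx
  have h1 : differential (k := k) χ x = 0 := h.mfderiv_eq.trans mfderiv_const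
  ext v
  refine (dWedge_apply χ η x v).trans ?_
  rw [h1]
  refine Finset.sum_eq_zero fun j _ => ?_
  change _ • ((0 : ℝ) * _) = 0
  rw [zero_mul, smul_zero]

lemma differential_sum {κ : Type*} (s : Finset κ) {χ : κ → S → ℝ}
    (hχ : ∀ i, ContMDiff (𝓡 k) 𝓘(ℝ, ℝ) ∞ (χ i)) (x : S) :
    differential (k := k) (∑ i ∈ s, χ i) x = ∑ i ∈ s, differential (χ i) x := by
  classical
  suffices h : HasMFDerivAt (𝓡 k) 𝓘(ℝ, ℝ) (∑ i ∈ s, χ i) x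
      (∑ i ∈ s, differential (k := k) (χ i) x : EuclideanSpace ℝ (Fin k) →L[ℝ] ℝ) from h.mfderiv
  induction s using Finset.induction_on with
  | empty => exact hasMFDerivAt_const (0 : ℝ) x
  | insert i s hi ih =>
    rw [Finset.sum_insert hi, Finset.sum_insert hi]
    exact ((hχ i x).mdifferentiableAt (by simp)).hasMFDerivAt.add ih

/-- `∑ dχᵢ ∧ η = d(∑ χᵢ) ∧ η = 0` for a partition of unity. -/
lemma sum_dWedge_eq_zero {κ : Type*} (s : Finset κ) {χ : κ → S → ℝ}
    (hχ : ∀ i, ContMDiff (𝓡 k) 𝓘(ℝ, ℝ) ∞ (χ i)) (hsum : ∀ x, ∑ i ∈ s, χ i x = 1)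
    (η : DiffForm p k S) : ∑ i ∈ s, dWedge (χ i) η = 0 := by
  funext x
  have h1 : ∑ i ∈ s, differential (k := k) (χ i) x = 0 := by
    have h3 : (∑ i ∈ s, χ i) = fun _ => (1 : ℝ) := by ext y; simpa using hsum y
    rw [← differential_sum s hχ, h3]
    exact mfderiv_const
  ext v
  rw [Finset.sum_apply]
  have h4 : ∀ w : EuclideanSpace ℝ (Fin k), ∑ i ∈ s, differential (χ i) x w = 0 := by
    intro w
    have := congrArg (fun L => L w) h1
    simpa using this
  have h6 : (∑ i ∈ s, dWedge (χ i) η x) v = ∑ i ∈ s, dWedge (χ i) η x v := by simp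
  rw [h6, Finset.sum_congr rfl fun i _ => dWedge_apply (χ i) η x v, Finset.sum_comm]
  refine Finset.sum_eq_zero fun j _ => ?_
  rw [← Finset.smul_sum, ← Finset.sum_mul, h4 (v j), zero_mul, smul_zero]

lemma sum_mulForm {κ : Type*} (s : Finset κ) {χ : κ → S → ℝ} (hsum : ∀ x, ∑ i ∈ s, χ i x = 1)
    (η : DiffForm p k S) : ∑ i ∈ s, mulForm (χ i) η = η := by
  funext x
  rw [Finset.sum_apply]
  simp only [mulForm]
  rw [← Finset.sum_smul, hsum, one_smul]

end Closed

section Exact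

variable {k : ℕ} {S : Type*} [TopologicalSpace S] [ChartedSpace (EuclideanSpace ℝ (Fin (k + 1))) S]
  [IsManifold (𝓡 (k + 1)) ∞ S] [T2Space S] [CompactSpace S]

/-- An exact form whose primitive is supported in a box has integral zero: in Stokes' theorem on the
box, the primitive vanishes on all faces. -/
lemma formIntegral_eq_zero_of_box (o : ManifoldOrientation (k + 1) S) (B : OrientedBox o)
    {η : DiffForm k (k + 1) S} {θ : DiffForm (k + 1) (k + 1) S} (hη : PullDifferentiable η)
    (hθ : PullDifferentiable θ) (hd : PullHasExtDeriv η θ) (hηB : ∀ x, η x ≠ 0 → x ∈ B.inner)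
    (hθB : ∀ x, θ x ≠ 0 → x ∈ B.inner) : formIntegral o (fun x v => θ x v) = 0 := by
  rw [formIntegral_eq_of_param o hθ B.isOpen isCompact_Icc B.subset B.contMDiffOn B.injOn B.sign_eq
    fun x hx => B.inner_subset (hθB x hx)]
  have h1 : ∀ u ∈ Icc B.a B.b, extDeriv (pull B.F η) u = pull B.F θ u := fun u hu =>
    hd ((B.isOpen.eventually_mem (B.subset hu)).mono fun z hz => B.contMDiffAt hz)
  have h2 : ∀ u ∈ Icc B.a B.b, extDeriv (pull B.F η) u (stdFrame (k + 1)) =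
      pull B.F θ u (stdFrame (k + 1)) := fun u hu => by rw [h1 u hu]
  rw [← setIntegral_congr_fun measurableSet_Icc h2, integral_extDeriv_Icc B.le
    (fun u hu => hη (B.contMDiffAt (B.subset hu)))]
  · have h3 : ∀ u ∈ Icc B.a B.b, ∀ i, (u i = B.a i ∨ u i = B.b i) → pull B.F η u = 0 := by
      intro u hu i hi
      have : η (B.F u) = 0 := by
        by_contra hne
        exact B.notMem_inner hu hi (hηB _ hne)
      ext v
      rw [pull_apply, this]
      rfl
    have hmem : ∀ (i : Fin (k + 1)) (c : ℝ), c ∈ Icc (B.a i) (B.b i) →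
        ∀ x ∈ Icc (B.a ∘ i.succAbove) (B.b ∘ i.succAbove),
        Fin.insertNth (α := fun _ => ℝ) i c x ∈ Icc B.a B.b := by
      intro i c hc x hx
      exact Fin.insertNth_mem_Icc.2 ⟨hc, hx⟩
    rw [Finset.sum_eq_zero, mul_zero]
    intro i _
    have hf : ∀ c, (c = B.a i ∨ c = B.b i) →
        ∫ x in Icc (B.a ∘ i.succAbove) (B.b ∘ i.succAbove), (-1 : ℝ) ^ (i : ℕ) *
          pull B.F η (i.insertNth c x) (stdFrame (k + 1) ∘ i.succAbove) = 0 := by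
      intro c hc
      have hcI : c ∈ Icc (B.a i) (B.b i) := by
        rcases hc with rfl | rfl
        · exact ⟨le_rfl, B.le i⟩
        · exact ⟨B.le i, le_rfl⟩
      refine setIntegral_eq_zero_of_forall_eq_zero fun x hx => ?_
      rw [h3 _ (hmem i c hcI x hx) i (by simpa using hc)]
      exact mul_zero _
    rw [hf _ (Or.inr rfl), hf _ (Or.inl rfl), sub_zero]
  · refine IntegrableOn.congr_fun ?_ (fun u hu => (h2 u hu).symm) measurableSet_Icc
    refine ContinuousOn.integrableOn_compact isCompact_Icc fun u hu => ?_
    have := (hθ (B.contMDiffAt (B.subset hu))).continuousAlternatingMap_apply_const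
      (stdFrame (k + 1))
    exact this.continuousAt.continuousWithinAt

/-- Stokes' theorem on a closed oriented manifold. A partition of unity `χᵢ` localizes the primitive
in boxes, and `θ = ∑ d(χᵢ η)`. -/
lemma formIntegral_eq_zero_of_hasExtDeriv (o : ManifoldOrientation (k + 1) S)
    {η : DiffForm k (k + 1) S} {θ : DiffForm (k + 1) (k + 1) S} (hη : PullDifferentiable η)
    (hθ : PullDifferentiable θ) (hd : PullHasExtDeriv η θ) :
    formIntegral o (fun x v => θ x v) = 0 := by
  choose B hB using fun x : S => exists_orientedBox o x univ_mem
  obtain ⟨s, χ, hχ, hχB, hsum⟩ := exists_finite_partition (k + 1) (fun x => (B x).inner)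
    fun x => (hB x).2
  have hdec : θ = ∑ i ∈ s, (mulForm (χ i) θ + dWedge (χ i) η) := by
    rw [Finset.sum_add_distrib, sum_mulForm s hsum, sum_dWedge_eq_zero s hχ hsum, add_zero]
  have hdiff : ∀ i, PullDifferentiable (mulForm (χ i) θ + dWedge (χ i) η) := fun i =>
    (hθ.mulForm (hχ i)).add (pullDifferentiable_dWedge (hχ i) hη)
  rw [hdec, formIntegral_sum o s fun i _ => hdiff i]
  refine Finset.sum_eq_zero fun i _ => ?_
  refine formIntegral_eq_zero_of_box o (B i) (hη.mulForm (hχ i)) (hdiff i)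
    (pullHasExtDeriv_mulForm (hχ i) hη hd) (fun x hx => ?_) (fun x hx => ?_)
  · refine hχB i (subset_closure fun h0 => hx ?_)
    simp [mulForm, h0]
  · by_contra hne
    have h0 : x ∉ tsupport (χ i) := fun h => hne (hχB i h)
    apply hx
    have h1 : χ i x = 0 := image_eq_zero_of_notMem_tsupport h0
    rw [Pi.add_apply, dWedge_eq_zero h0]
    simp [mulForm, h1]

end Exact

/-! ### Integration over a fundamental cycle -/

section Fundamental

variable {k : ℕ} {S : Type*} [TopologicalSpace S] [ChartedSpace (EuclideanSpace ℝ (Fin k)) S]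
  [IsManifold (𝓡 k) ∞ S]

/-- A form of top degree is closed: its pullbacks locally factor through `ℝᵏ`. -/
lemma PullDifferentiable.pullClosed_of_top {θ : DiffForm k k S} (hθ : PullDifferentiable θ) :
    PullClosed θ := by
  intro F y hF
  set φ := chartAt (EuclideanSpace ℝ (Fin k)) (F y)
  have hφ : φ ∈ IsManifold.maximalAtlas (𝓡 k) ∞ S := IsManifold.chart_mem_maximalAtlas _
  have hy : F y ∈ φ.source := mem_chart_source _ _
  set g : (Fin (k + 1) → ℝ) → (Fin k → ℝ) := fun z => (euc k).symm (φ (F z)) with hg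
  have hgs : ContDiffAt ℝ ∞ g y := by
    have : ContDiffAt ℝ ∞ (fun z => φ (F z)) y :=
      ((contMDiffAt_of_mem_maximalAtlas hφ hy).comp y hF).contDiffAt
    exact (euc k).symm.contDiff.contDiffAt.comp y this
  have hge : ∀ z, F z ∈ φ.source → euc k (g z) ∈ φ.target := fun z hz => by
    simpa [hg] using φ.map_source hz
  have hev : ∀ᶠ z in 𝓝 y, F z ∈ φ.source :=
    hF.continuousAt.eventually (φ.open_source.mem_nhds hy)
  have hgd : ∀ᶠ z in 𝓝 y, DifferentiableAt ℝ g z := by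
    filter_upwards [(hgs.of_le (m := 1) (by norm_cast)).eventually (by simp)] with z hz
    exact hz.differentiableAt (by simp)
  have h1 : pull F θ =ᶠ[𝓝 y] fun z =>
      (pull (φ.symm ∘ euc k) θ (g z)).compContinuousLinearMap (fderiv ℝ g z) := by
    filter_upwards [hgd, hev.eventually_nhds] with z hz hz'
    rw [← pull_comp ((contMDiffAt_symm_euc hφ (hge z hz'.self_of_nhds)).mdifferentiableAt
      (by simp)) hz]
    apply pull_congr
    filter_upwards [hz'] with w hw
    simp [hg, φ.left_inv hw]
  rw [h1.extDeriv_eq, extDeriv_pullback (hθ (contMDiffAt_symm_euc hφ (hge y hy))) hgs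
    (by simpa using WithTop.coe_le_coe.2 (le_top : (2 : ℕ∞) ≤ ⊤))]
  ext v
  refine AlternatingMap.map_linearDependent
    (extDeriv (pull (φ.symm ∘ euc k) θ) (g y)).toAlternatingMap _ fun hli => ?_
  have := hli.fintype_card_le_finrank
  simp at this

/-- The inverse function theorem for a parametrization whose frame is nondegenerate. -/
lemma image_mem_nhds_of_signAt_ne_zero (o : ManifoldOrientation k S) {F : (Fin k → ℝ) → S}
    {u : Fin k → ℝ} (hF : ∀ᶠ z in 𝓝 u, ContMDiffAt 𝓘(ℝ, Fin k → ℝ) (𝓡 k) ∞ F z)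
    (hne : signAt o (F u) (paramFrame F u) ≠ 0) {K : Set (Fin k → ℝ)} (hK : K ∈ 𝓝 u) :
    F '' K ∈ 𝓝 (F u) := by
  set φ := chartAt (EuclideanSpace ℝ (Fin k)) (F u)
  have hφ : φ ∈ IsManifold.maximalAtlas (𝓡 k) ∞ S := IsManifold.chart_mem_maximalAtlas _
  have hu : F u ∈ φ.source := mem_chart_source _ _
  have hdet := (eventually_signAt_paramFrame o hφ hF hu hne).1
  have hg := (mfderiv_factor hφ hF.self_of_nhds hu).1
  set g : (Fin k → ℝ) → (Fin k → ℝ) := fun z => (euc k).symm (φ (F z)) with hgdef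
  have hstrict : HasStrictFDerivAt g
      (((fderiv ℝ g u).toContinuousLinearEquivOfDetNeZero hdet : (Fin k → ℝ) ≃L[ℝ] (Fin k → ℝ)) :
        (Fin k → ℝ) →L[ℝ] (Fin k → ℝ)) u := by
    rw [ContinuousLinearMap.coe_toContinuousLinearEquivOfDetNeZero]
    exact hg.hasStrictFDerivAt (by simp)
  have hmap := hstrict.map_nhds_eq_of_equiv
  have hK' : K ∩ F ⁻¹' φ.source ∈ 𝓝 u := inter_mem hK
    (hF.self_of_nhds.continuousAt.preimage_mem_nhds (φ.open_source.mem_nhds hu))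
  have h1 : g '' (K ∩ F ⁻¹' φ.source) ∈ 𝓝 (g u) := hmap ▸ image_mem_map hK'
  have hcont : ContinuousAt (fun s => (euc k).symm (φ s)) (F u) :=
    (euc k).symm.continuous.continuousAt.comp (φ.continuousAt hu)
  filter_upwards [hcont.preimage_mem_nhds h1, φ.open_source.mem_nhds hu] with s hs hs'
  obtain ⟨w, ⟨hwK, hwF⟩, hw⟩ := hs
  exact ⟨w, hwK, φ.injOn hwF hs' ((euc k).symm.injective hw)⟩

variable [T2Space S] [CompactSpace S] {R : Type*} [CommRing R] [Algebra R ℝ]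

/-- Near a given point, a fundamental cycle integrates forms as the oriented manifold does. There
the cycle is an embedded simplex plus a boundary, which does not contribute because forms of top
degree are closed, plus simplices away from the point. -/
lemma exists_nhds_chainIntegral_eq (o : ManifoldOrientation k S) {c : Chain k S R k}
    (hc : IsFundamentalCycle o c) (x : S) : ∃ W ∈ 𝓝 x, ∀ θ : DiffForm k k S,
      PullDifferentiable θ → (∀ z, θ z ≠ 0 → z ∈ W) →
      chainIntegral c θ = formIntegral o (fun x v => θ x v) := by
  obtain ⟨σ, y, ε, hinj, hy, hyx, hsign, b, c', hc', hceq⟩ := hc.2 x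
  set F := σ.extend with hFdef
  have hyΔ : y ∈ solidSimplex k := interior_subset hy
  have hFy : ∀ u ∈ solidSimplex k, ContMDiffAt 𝓘(ℝ, Fin k → ℝ) (𝓡 k) ∞ F u := fun u hu =>
    σ.contMDiffAt_extend hu
  have hev : ∀ᶠ z in 𝓝 y, ContMDiffAt 𝓘(ℝ, Fin k → ℝ) (𝓡 k) ∞ F z := by
    filter_upwards [mem_interior_iff_mem_nhds.1 hy] with z hz using hFy z hz
  have hsign' : signAt o (F y) (paramFrame F y) = ((ε : ℤ) : ℝ) := hsign
  have hne : signAt o (F y) (paramFrame F y) ≠ 0 := by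
    rw [hsign']
    exact_mod_cast ε.ne_zero
  have hFinj : InjOn F (solidSimplex k) := by
    intro u hu v hv huv
    have := hinj ((σ.extend_apply ⟨u, hu⟩).symm.trans (huv.trans (σ.extend_apply ⟨v, hv⟩)))
    exact congrArg Subtype.val this
  have hφ : chartAt (EuclideanSpace ℝ (Fin k)) (F y) ∈ IsManifold.maximalAtlas (𝓡 k) ∞ S :=
    IsManifold.chart_mem_maximalAtlas _
  have hsev := (eventually_signAt_paramFrame o hφ hev (mem_chart_source _ _) hne).2
  obtain ⟨r, hr, hball⟩ := Metric.eventually_nhds_iff_ball.1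
    (hsev.and (eventually_mem_nhds_iff.2 (mem_interior_iff_mem_nhds.1 hy)))
  have hNΔ : Metric.ball y r ⊆ solidSimplex k := fun z hz => mem_of_mem_nhds (hball z hz).2
  set K := Metric.closedBall y (r / 2) with hKdef
  have hKN : K ⊆ Metric.ball y r := Metric.closedBall_subset_ball (by linarith)
  have hK : IsCompact K := isCompact_closedBall _ _
  -- the part of `σ` outside a small ball, and the simplices of `c'`, stay away from `x`
  have hcpt : IsCompact (F '' (solidSimplex k \ Metric.ball y (r / 2))) := by
    refine ((isCompact_solidSimplex k).diff Metric.isOpen_ball).image_of_continuousOn ?_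
    exact fun u hu => (hFy u hu.1).continuousAt.continuousWithinAt
  have hx1 : x ∉ F '' (solidSimplex k \ Metric.ball y (r / 2)) := by
    rintro ⟨u, hu, hux⟩
    have := hFinj hu.1 hyΔ (hux.trans hyx.symm)
    exact hu.2 (this ▸ Metric.mem_ball_self (by linarith))
  have hτ : ∀ τ : SmoothSimplex k S k, IsCompact (τ.extend '' solidSimplex k) := fun τ =>
    (isCompact_solidSimplex k).image_of_continuousOn
      fun u hu => (τ.contMDiffAt_extend hu).continuousAt.continuousWithinAt
  have hx2 : ∀ τ ∈ c'.support, (τ.extend '' solidSimplex k)ᶜ ∈ 𝓝 x := by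
    intro τ hτc
    refine (hτ τ).isClosed.isOpen_compl.mem_nhds ?_
    rintro ⟨u, hu, hux⟩
    exact hc' τ hτc ⟨u, hu⟩ ((τ.extend_apply ⟨u, hu⟩).symm.trans hux)
  have hx3 : F '' K ∈ 𝓝 x := by
    have := image_mem_nhds_of_signAt_ne_zero o hev hne
      (Metric.closedBall_mem_nhds y (by linarith : 0 < r / 2))
    rwa [hyx] at this
  refine ⟨F '' K ∩ ((F '' (solidSimplex k \ Metric.ball y (r / 2)))ᶜ ∩
    ⋂ τ ∈ c'.support, (τ.extend '' solidSimplex k)ᶜ), inter_mem hx3 (inter_mem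
      (hcpt.isClosed.isOpen_compl.mem_nhds hx1) ((Filter.biInter_finset_mem _).2 hx2)), ?_⟩
  intro θ hθ hsupp
  have hσ : σ.integral θ = ∫ u in K, pull F θ u (stdFrame k) := by
    rw [σ.integral_eq θ (G := F) σ.extend_apply]
    refine setIntegral_eq_of_subset_of_forall_sdiff_eq_zero
      (isCompact_solidSimplex k).measurableSet (hKN.trans hNΔ) fun u hu => ?_
    have h0 : θ (F u) = 0 := by
      by_contra hne
      exact (hsupp _ hne).2.1 ⟨u, ⟨hu.1, fun h => hu.2 (Metric.ball_subset_closedBall h)⟩, rfl⟩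
    rw [pull_apply, h0]
    rfl
  have hc'0 : chainIntegral c' θ = 0 := by
    refine Finset.sum_eq_zero fun τ hτc => ?_
    have : τ.integral θ = 0 := by
      rw [τ.integral_eq θ (G := τ.extend) τ.extend_apply]
      refine setIntegral_eq_zero_of_forall_eq_zero fun u hu => ?_
      have h0 : θ (τ.extend u) = 0 := by
        by_contra hne
        exact (mem_iInter₂.1 (hsupp _ hne).2.2 τ hτc) ⟨u, hu, rfl⟩
      rw [pull_apply, h0]
      rfl
    simp only [this, mul_zero]
  have hchain : chainIntegral c θ = ((ε : ℤ) : ℝ) * σ.integral θ := by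
    rw [← chainIntegralHom_apply, hceq, map_add, map_add, chainIntegralHom_single,
      chainIntegralHom_apply, chainIntegralHom_apply, hc'0,
      chainIntegral_boundary hθ hθ.pullClosed_of_top]
    simp
  rw [hchain, hσ, formIntegral_eq_of_param o hθ (N := Metric.ball y r) Metric.isOpen_ball hK hKN
    (fun u hu => (hFy u (hNΔ hu)).contMDiffWithinAt) (hFinj.mono hNΔ)
    (fun u hu => (hball u hu).1.trans hsign') (fun z hz => (hsupp z hz).1)]

/-- Integration over a fundamental cycle is integration over the oriented manifold. -/
lemma chainIntegral_eq_formIntegral (o : ManifoldOrientation k S) {c : Chain k S R k}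
    (hc : IsFundamentalCycle o c) {θ : DiffForm k k S} (hθ : PullDifferentiable θ) :
    chainIntegral c θ = formIntegral o (fun x v => θ x v) := by
  choose W hW hWθ using exists_nhds_chainIntegral_eq o hc
  obtain ⟨s, χ, hχ, hχW, hsum⟩ := exists_finite_partition k W hW
  rw [← sum_mulForm s hsum θ, chainIntegral_sum s fun i _ => hθ.mulForm (hχ i),
    formIntegral_sum o s fun i _ => hθ.mulForm (hχ i)]
  refine Finset.sum_congr rfl fun i _ => hWθ i _ (hθ.mulForm (hχ i)) fun z hz => ?_
  refine hχW i (subset_closure fun h0 => hz ?_)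
  simp [mulForm, h0]

end Fundamental

/-! ### Moving a map inside a box -/

section Blend

variable {k n : ℕ} {S : Type*} [TopologicalSpace S] [ChartedSpace (EuclideanSpace ℝ (Fin k)) S]
  {M : Type*} [TopologicalSpace M]

/-- The point at time `t` of the segment joining `p` to `p'` in the chart `ψ`. -/
def chartSegment (ψ : OpenPartialHomeomorph M (EuclideanSpace ℝ (Fin n))) (t : ℝ) (p p' : M) : M :=
  ψ.symm (ψ p + t • (ψ p' - ψ p))

open Classical in
/-- The map which follows, at the point `s`, the segment from `a s` to `a' s` in the chart `ψ` up
to the time `χ s`. -/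
def blend (ψ : OpenPartialHomeomorph M (EuclideanSpace ℝ (Fin n))) (χ : S → ℝ) (a a' : S → M)
    (s : S) : M :=
  if s ∈ tsupport χ then chartSegment ψ (χ s) (a s) (a' s) else a s

variable {ψ : OpenPartialHomeomorph M (EuclideanSpace ℝ (Fin n))}
  {C : Set (EuclideanSpace ℝ (Fin n))} {χ : S → ℝ} {a a' : S → M}

lemma chartSegment_zero {p p' : M} (hp : p ∈ ψ.source) : chartSegment ψ 0 p p' = p := by
  simp [chartSegment, ψ.left_inv hp]

lemma chartSegment_one {p p' : M} (hp : p' ∈ ψ.source) : chartSegment ψ 1 p p' = p' := by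
  simp [chartSegment, ψ.left_inv hp]

lemma chartSegment_self {p : M} {t : ℝ} (hp : p ∈ ψ.source) : chartSegment ψ t p p = p := by
  simp [chartSegment, ψ.left_inv hp]

lemma blend_of_notMem {s : S} (hs : s ∉ tsupport χ) : blend ψ χ a a' s = a s := by
  simp [blend, hs]

lemma blend_eq_chartSegment {s : S} (hs : a s ∈ ψ.source) :
    blend ψ χ a a' s = chartSegment ψ (χ s) (a s) (a' s) := by
  by_cases h : s ∈ tsupport χ
  · simp [blend, h]
  · rw [blend_of_notMem h, image_eq_zero_of_notMem_tsupport h, chartSegment_zero hs]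

lemma segment_mem (hC : Convex ℝ C) {p p' : EuclideanSpace ℝ (Fin n)} (hp : p ∈ C) (hp' : p' ∈ C)
    {t : ℝ} (ht : t ∈ Icc (0 : ℝ) 1) : p + t • (p' - p) ∈ C :=
  hC.add_smul_sub_mem hp hp' ht

variable [ChartedSpace (EuclideanSpace ℝ (Fin n)) M]

/-- Smoothness of a family of chart segments. -/
lemma contMDiffAt_chartSegment (hψ : ψ ∈ IsManifold.maximalAtlas (𝓡 n) ∞ M)
    (hC : Convex ℝ C) (hCψ : C ⊆ ψ.target) {E X : Type*} [NormedAddCommGroup E] [NormedSpace ℝ E]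
    [TopologicalSpace X] [ChartedSpace E X] {τ : X → ℝ} {f f' : X → M} {x : X}
    (hτ : ContMDiffAt 𝓘(ℝ, E) 𝓘(ℝ, ℝ) ∞ τ x) (hf : ContMDiffAt 𝓘(ℝ, E) (𝓡 n) ∞ f x)
    (hf' : ContMDiffAt 𝓘(ℝ, E) (𝓡 n) ∞ f' x) (hτx : τ x ∈ Icc (0 : ℝ) 1)
    (hx : f x ∈ ψ.source ∩ ψ ⁻¹' C) (hx' : f' x ∈ ψ.source ∩ ψ ⁻¹' C) :
    ContMDiffAt 𝓘(ℝ, E) (𝓡 n) ∞ (fun y => chartSegment ψ (τ y) (f y) (f' y)) x := by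
  have h1 : ContMDiffAt 𝓘(ℝ, E) (𝓡 n) ∞ (fun y => ψ (f y)) x :=
    (contMDiffAt_of_mem_maximalAtlas hψ hx.1).comp x hf
  have h2 : ContMDiffAt 𝓘(ℝ, E) (𝓡 n) ∞ (fun y => ψ (f' y)) x :=
    (contMDiffAt_of_mem_maximalAtlas hψ hx'.1).comp x hf'
  have h3 : ContMDiffAt 𝓘(ℝ, E) (𝓡 n) ∞ (fun y => ψ (f y) + τ y • (ψ (f' y) - ψ (f y))) x :=
    h1.add (hτ.smul (h2.sub h1))
  exact (contMDiffAt_symm_of_mem_maximalAtlas hψ (hCψ (segment_mem hC hx.2 hx'.2 hτx))).comp x h3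

lemma contMDiff_blend (hψ : ψ ∈ IsManifold.maximalAtlas (𝓡 n) ∞ M)
    (hC : Convex ℝ C) (hCψ : C ⊆ ψ.target)
    (hχ : ContMDiff (𝓡 k) 𝓘(ℝ, ℝ) ∞ χ) (hχ01 : ∀ s, χ s ∈ Icc (0 : ℝ) 1)
    (ha : ContMDiff (𝓡 k) (𝓡 n) ∞ a) (ha' : ContMDiff (𝓡 k) (𝓡 n) ∞ a')
    (hO : ∀ s ∈ tsupport χ, a s ∈ ψ.source ∩ ψ ⁻¹' C ∧ a' s ∈ ψ.source ∩ ψ ⁻¹' C) :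
    ContMDiff (𝓡 k) (𝓡 n) ∞ (blend ψ χ a a') := by
  intro s
  by_cases hs : s ∈ tsupport χ
  · refine (contMDiffAt_chartSegment hψ hC hCψ (hχ s) (ha s) (ha' s) (hχ01 s) (hO s hs).1
      (hO s hs).2).congr_of_eventuallyEq ?_
    filter_upwards [ha.continuous.continuousAt.eventually (ψ.open_source.mem_nhds (hO s hs).1.1)]
      with z hz using blend_eq_chartSegment hz
  · refine (ha s).congr_of_eventuallyEq ?_
    filter_upwards [(isClosed_tsupport χ).isOpen_compl.mem_nhds hs] with z hz
      using blend_of_notMem hz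

/-- Blending inside a box does not change the integral over the box of a closed form: the
straight-line homotopy sweeps out a prism, and the sides of this prism are collapsed. -/
lemma setIntegral_pull_blend {o : ManifoldOrientation k S} (B : OrientedBox o)
    (hψ : ψ ∈ IsManifold.maximalAtlas (𝓡 n) ∞ M)
    (hC : Convex ℝ C) (hCψ : C ⊆ ψ.target)
    (hχ : ContMDiff (𝓡 k) 𝓘(ℝ, ℝ) ∞ χ) (hχ01 : ∀ s, χ s ∈ Icc (0 : ℝ) 1)
    (hχB : tsupport χ ⊆ B.inner)
    (ha : ContMDiff (𝓡 k) (𝓡 n) ∞ a) (ha' : ContMDiff (𝓡 k) (𝓡 n) ∞ a')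
    (hO : ∀ u ∈ Icc B.a B.b,
      a (B.F u) ∈ ψ.source ∩ ψ ⁻¹' C ∧ a' (B.F u) ∈ ψ.source ∩ ψ ⁻¹' C)
    {α : DiffForm k n M} (hα : PullDifferentiable α) (hαc : PullClosed α) :
    ∫ u in Icc B.a B.b, pull (blend ψ χ a a' ∘ B.F) α u (stdFrame k) =
      ∫ u in Icc B.a B.b, pull (a ∘ B.F) α u (stdFrame k) := by
  set H : (Fin (k + 1) → ℝ) → M := fun v => chartSegment ψ (v 0 * χ (B.F (Fin.tail v)))
    (a (B.F (Fin.tail v))) (a' (B.F (Fin.tail v))) with hH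
  set lo : Fin (k + 1) → ℝ := Fin.cons 0 B.a with hlo
  set hi : Fin (k + 1) → ℝ := Fin.cons 1 B.b with hhi
  have hmem : ∀ v ∈ Icc lo hi, v 0 ∈ Icc (0 : ℝ) 1 ∧ Fin.tail v ∈ Icc B.a B.b := by
    intro v hv
    refine ⟨⟨hv.1 0, hv.2 0⟩, fun i => ?_, fun i => ?_⟩
    · have h := hv.1 i.succ
      rw [hlo, Fin.cons_succ] at h
      exact h
    · have h := hv.2 i.succ
      rw [hhi, Fin.cons_succ] at h
      exact h
  have hFt : ∀ v ∈ Icc lo hi, ContMDiffAt 𝓘(ℝ, Fin (k + 1) → ℝ) (𝓡 k) ∞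
      (fun v => B.F (Fin.tail v)) v := fun v hv =>
    (B.contMDiffAt (B.subset (hmem v hv).2)).comp v (contDiff_tail.contMDiff v)
  have hHs : ∀ v ∈ Icc lo hi, ContMDiffAt 𝓘(ℝ, Fin (k + 1) → ℝ) (𝓡 n) ∞ H v := by
    intro v hv
    have hv0 := (hmem v hv).1
    have hχ' := hχ01 (B.F (Fin.tail v))
    refine contMDiffAt_chartSegment hψ hC hCψ ?_ ((ha _).comp v (hFt v hv))
      ((ha' _).comp v (hFt v hv))
      ⟨mul_nonneg hv0.1 hχ'.1, mul_le_one₀ hv0.2 hχ'.1 hχ'.2⟩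
      (hO _ (hmem v hv).2).1 (hO _ (hmem v hv).2).2
    have h1 : ContMDiffAt 𝓘(ℝ, Fin (k + 1) → ℝ) 𝓘(ℝ, ℝ) ∞
        (fun v : Fin (k + 1) → ℝ => v 0) v := (contDiff_apply ℝ ℝ 0).contMDiff v
    exact h1.mul ((hχ _).comp v (hFt v hv))
  have hle : lo ≤ hi := by
    intro i
    refine Fin.cases ?_ (fun i => ?_) i
    · simp [hlo, hhi]
    · simpa [hlo, hhi] using B.le i
  have h0 := sum_face_integrals_eq_zero hle (ζ := pull H α) (fun v hv => hα (hHs v hv))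
    (fun v hv => hαc (hHs v hv))
  have hsub : ∀ i : Fin (k + 1), ∀ c ∈ Icc (lo i) (hi i), ∀ x ∈ Icc (lo ∘ i.succAbove)
      (hi ∘ i.succAbove), Fin.insertNth (α := fun _ => ℝ) i c x ∈ Icc lo hi := by
    intro i c hc x hx
    exact Fin.insertNth_mem_Icc.2 ⟨hc, hx⟩
  -- the sides of the prism
  have hside : ∀ i : Fin k, ∀ c, (c = lo i.succ ∨ c = hi i.succ) →
      ∫ x in Icc (lo ∘ i.succ.succAbove) (hi ∘ i.succ.succAbove), (-1 : ℝ) ^ (i.succ : ℕ) *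
        pull H α (i.succ.insertNth c x) (stdFrame (k + 1) ∘ i.succ.succAbove) = 0 := by
    intro i c hc
    refine setIntegral_eq_zero_of_forall_eq_zero fun x hx => ?_
    have hcI : c ∈ Icc (lo i.succ) (hi i.succ) := by
      rcases hc with rfl | rfl
      · exact ⟨le_rfl, hle _⟩
      · exact ⟨hle _, le_rfl⟩
    have hvI := hsub i.succ c hcI x hx
    set v : Fin (k + 1) → ℝ := Fin.insertNth (α := fun _ => ℝ) i.succ c x with hv
    have hvi : Fin.tail v i = B.a i ∨ Fin.tail v i = B.b i := by
      simpa [Fin.tail, hv, hlo, hhi] using hc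
    have hnot : B.F (Fin.tail v) ∉ tsupport χ := fun h =>
      B.notMem_inner (hmem v hvI).2 hvi (hχB h)
    have hloc : H =ᶠ[𝓝 v] (a ∘ B.F) ∘ fun v => Fin.tail v := by
      have e1 := (hFt v hvI).continuousAt.eventually
        ((isClosed_tsupport χ).isOpen_compl.mem_nhds hnot)
      have e2 := ((ha _).comp v (hFt v hvI)).continuousAt.eventually
        (ψ.open_source.mem_nhds (hO _ (hmem v hvI).2).1.1)
      filter_upwards [e1, e2] with w hw1 hw2
      rw [hH]
      simp only
      rw [image_eq_zero_of_notMem_tsupport hw1, mul_zero,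
        chartSegment_zero (show a (B.F (Fin.tail w)) ∈ ψ.source from hw2)]
      rfl
    have hpos : 0 < k := i.pos
    obtain ⟨q, rfl⟩ := Nat.exists_eq_succ_of_ne_zero hpos.ne'
    rw [pull_congr hloc, pull_comp (((ha _).comp _
      (B.contMDiffAt (B.subset (hmem v hvI).2))).mdifferentiableAt (by simp))
      (contDiff_tail.differentiable (by simp) _),
      ContinuousAlternatingMap.compContinuousLinearMap_apply,
      ContinuousAlternatingMap.map_coord_zero _ (0 : Fin (q + 1)), mul_zero]
    have hd : DifferentiableAt ℝ (fun v : Fin (q + 1 + 1) → ℝ => Fin.tail v) v :=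
      contDiff_tail.differentiable (by simp) _
    simp only [Function.comp_apply, Fin.succ_succAbove_zero]
    rw [← hd.lineDeriv_eq_fderiv, lineDeriv]
    have : ∀ s : ℝ, Fin.tail (v + s • stdFrame (q + 1 + 1) 0) = Fin.tail v := by
      intro s; ext j; simp [Fin.tail, stdFrame]
    simp [this]
  -- the bottom and the top of the prism
  have hends : ∀ c ∈ Icc (0 : ℝ) 1, ∀ G : (Fin k → ℝ) → M,
      (∀ x ∈ Icc B.a B.b, G =ᶠ[𝓝 x] fun x => H (Fin.insertNth (α := fun _ => ℝ) 0 c x)) →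
      ∫ x in Icc (lo ∘ (0 : Fin (k + 1)).succAbove) (hi ∘ (0 : Fin (k + 1)).succAbove),
        (-1 : ℝ) ^ ((0 : Fin (k + 1)) : ℕ) *
        pull H α (Fin.insertNth (α := fun _ => ℝ) 0 c x)
          (stdFrame (k + 1) ∘ (0 : Fin (k + 1)).succAbove) =
      ∫ x in Icc B.a B.b, pull G α x (stdFrame k) := by
    intro c hc G hG
    have hIcc : Icc (lo ∘ (0 : Fin (k + 1)).succAbove) (hi ∘ (0 : Fin (k + 1)).succAbove) =
        Icc B.a B.b := by
      congr 1
    rw [hIcc]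
    refine setIntegral_congr_fun measurableSet_Icc fun x hx => ?_
    have hx' := hsub 0 c hc x (hIcc.symm ▸ hx)
    have := pull_insertNth 0 c x ((hHs _ hx').mdifferentiableAt (by simp)) α
    have e : pull (H ∘ fun x => Fin.insertNth (α := fun _ => ℝ) 0 c x) α x = pull G α x :=
      (pull_congr (hG x hx) α).symm
    rw [← this, e]
    simp
  have hcF : ∀ x ∈ Icc B.a B.b, ∀ᶠ z in 𝓝 x, a (B.F z) ∈ ψ.source := fun x hx =>
    ((ha _).comp x (B.contMDiffAt (B.subset hx))).continuousAt.eventually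
        (ψ.open_source.mem_nhds (hO _ hx).1.1)
  have htop := hends 1 ⟨zero_le_one, le_rfl⟩ (blend ψ χ a a' ∘ B.F) (fun x hx => by
    filter_upwards [hcF x hx] with z hz
    simp [hH, blend_eq_chartSegment hz])
  have hbot := hends 0 ⟨le_rfl, zero_le_one⟩ (a ∘ B.F) (fun x hx => by
    filter_upwards [hcF x hx] with z hz
    simp [hH, chartSegment_zero hz])
  rw [Fin.sum_univ_succ, Finset.sum_eq_zero (s := Finset.univ) (fun i _ => by
    rw [hside i _ (Or.inr rfl), hside i _ (Or.inl rfl), sub_zero]), add_zero, sub_eq_zero] at h0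
  rw [← htop, ← hbot]
  exact h0

end Blend

/-! ### Uniformly close maps have the same periods -/

section LocallyConstant

variable {k n : ℕ} {S : Type*} [TopologicalSpace S] [ChartedSpace (EuclideanSpace ℝ (Fin k)) S]
  [IsManifold (𝓡 k) ∞ S] [T2Space S] [CompactSpace S]

lemma formIntegral_sub (o : ManifoldOrientation k S) {θ θ' : DiffForm k k S}
    (hθ : PullDifferentiable θ) (hθ' : PullDifferentiable θ') :
    formIntegral o (fun x v => (θ - θ') x v) =
      formIntegral o (fun x v => θ x v) - formIntegral o (fun x v => θ' x v) := by
  simp only [formIntegral_eq_sum]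
  rw [← Finset.sum_sub_distrib]
  refine Finset.sum_congr rfl fun i _ => ?_
  rw [← integral_sub (hθ.formIntegrable o i) (hθ'.formIntegrable o i)]
  refine integral_congr_ae (Eventually.of_forall fun y => ?_)
  simp [localIntegrand, mul_sub]

variable {M : Type*} [MetricSpace M] [ChartedSpace (EuclideanSpace ℝ (Fin n)) M]
  [IsManifold (𝓡 n) ∞ M]

/-- The pullbacks of `α` under `a` and under the blended map differ only inside the box, so that the
equality of their integrals over the box is enough. -/
lemma formIntegral_blend (o : ManifoldOrientation k S) (B : OrientedBox o)
    {ψ : OpenPartialHomeomorph M (EuclideanSpace ℝ (Fin n))}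
    {C : Set (EuclideanSpace ℝ (Fin n))} {χ : S → ℝ} {a a' : S → M}
    (hψ : ψ ∈ IsManifold.maximalAtlas (𝓡 n) ∞ M)
    (hC : Convex ℝ C) (hCψ : C ⊆ ψ.target)
    (hχ : ContMDiff (𝓡 k) 𝓘(ℝ, ℝ) ∞ χ) (hχ01 : ∀ s, χ s ∈ Icc (0 : ℝ) 1)
    (hχB : tsupport χ ⊆ B.inner)
    (ha : ContMDiff (𝓡 k) (𝓡 n) ∞ a) (ha' : ContMDiff (𝓡 k) (𝓡 n) ∞ a')
    (hO : ∀ u ∈ Icc B.a B.b,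
      a (B.F u) ∈ ψ.source ∩ ψ ⁻¹' C ∧ a' (B.F u) ∈ ψ.source ∩ ψ ⁻¹' C)
    {α : DiffForm k n M} (hα : α.IsSmooth) (hαc : α.IsClosed) :
    ContMDiff (𝓡 k) (𝓡 n) ∞ (blend ψ χ a a') ∧
    formIntegral o (α.pullback (blend ψ χ a a')) = formIntegral o (α.pullback a) := by
  have hb : ContMDiff (𝓡 k) (𝓡 n) ∞ (blend ψ χ a a') := by
    refine contMDiff_blend hψ hC hCψ hχ hχ01 ha ha' fun s hs => ?_
    obtain ⟨u, hu, rfl⟩ := B.inner_subset (hχB hs)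
    exact hO u hu
  refine ⟨hb, ?_⟩
  have hθb := pullDifferentiable_pullForm hb hα
  have hθa := pullDifferentiable_pullForm ha hα
  have hsupp : ∀ x, (pullForm (blend ψ χ a a') α - pullForm a α : DiffForm k k S) x ≠ 0 →
      x ∈ B.F '' Icc B.a B.b := by
    intro x hx
    by_contra hne
    have hx' : x ∉ tsupport χ := fun h => hne (B.inner_subset (hχB h))
    have hloc : blend ψ χ a a' =ᶠ[𝓝 x] a := by
      filter_upwards [(isClosed_tsupport χ).isOpen_compl.mem_nhds hx'] with z hz
        using blend_of_notMem hz
    apply hx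
    have h1 : (mfderiv (𝓡 k) (𝓡 n) (blend ψ χ a a') x :
        EuclideanSpace ℝ (Fin k) →L[ℝ] EuclideanSpace ℝ (Fin n)) = mfderiv (𝓡 k) (𝓡 n) a x :=
      hloc.mfderiv_eq
    have key : ∀ (q q' : M) (_ : q = q')
        (A A' : EuclideanSpace ℝ (Fin k) →L[ℝ] EuclideanSpace ℝ (Fin n)), A = A' →
        ∀ v : Fin k → EuclideanSpace ℝ (Fin k),
        (α q) (fun i => A (v i)) = (α q') (fun i => A' (v i)) := by
      rintro q _ rfl A _ rfl v; rfl
    ext v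
    exact sub_eq_zero.2 (key _ _ hloc.eq_of_nhds _ _ h1 v)
  have hzero := formIntegral_eq_of_param o (hθb.sub hθa) B.isOpen isCompact_Icc B.subset
    B.contMDiffOn B.injOn B.sign_eq hsupp
  have hint : ∀ {c : S → M}, ContMDiff (𝓡 k) (𝓡 n) ∞ c →
      IntegrableOn (fun u => pull (c ∘ B.F) α u (stdFrame k)) (Icc B.a B.b) := by
    intro c hc
    refine ContinuousOn.integrableOn_compact isCompact_Icc fun u hu => ?_
    have := (IsSmooth.differentiableAt_pull hα ((hc _).comp u
      (B.contMDiffAt (B.subset hu)))).continuousAlternatingMap_apply_const (stdFrame k)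
    exact this.continuousAt.continuousWithinAt
  have hI : ∫ u in Icc B.a B.b,
      pull B.F (pullForm (blend ψ χ a a') α - pullForm a α : DiffForm k k S) u (stdFrame k) = 0 := by
    have : ∀ u ∈ Icc B.a B.b,
        pull B.F (pullForm (blend ψ χ a a') α - pullForm a α : DiffForm k k S) u (stdFrame k) =
        pull (blend ψ χ a a' ∘ B.F) α u (stdFrame k) - pull (a ∘ B.F) α u (stdFrame k) := by
      intro u hu
      have hFu := (B.contMDiffAt (B.subset hu)).mdifferentiableAt (n := ∞) (by simp)
      rw [← pull_pullForm ((hb _).mdifferentiableAt (by simp)) hFu,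
        ← pull_pullForm ((ha _).mdifferentiableAt (by simp)) hFu]
      rfl
    rw [setIntegral_congr_fun measurableSet_Icc this, integral_sub (hint hb) (hint ha),
      setIntegral_pull_blend B hψ hC hCψ hχ hχ01 hχB ha ha' hO (IsSmooth.pullDifferentiable hα)
        (IsClosed.pullClosed hα hαc), sub_self]
  rw [hI, mul_zero, formIntegral_sub o hθb hθa, sub_eq_zero] at hzero
  exact hzero

/-- One step of the deformation: near `x`, the map `a` can be replaced by `a'` without changing
the integral of a closed form, and with uniform control. -/
lemma exists_blend_step (o : ManifoldOrientation k S) {ι : S → M}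
    (hι : ContMDiff (𝓡 k) (𝓡 n) ∞ ι) {α : DiffForm k n M} (hα : α.IsSmooth) (hαc : α.IsClosed)
    (x : S) : ∃ χ : S → ℝ, (∀ᶠ s in 𝓝 x, χ s = 1) ∧ ∀ ε > 0, ∃ δ > 0, ∀ a a' : S → M,
      ContMDiff (𝓡 k) (𝓡 n) ∞ a → ContMDiff (𝓡 k) (𝓡 n) ∞ a' →
      (∀ s, dist (a s) (ι s) < δ) → (∀ s, dist (a' s) (ι s) < δ) →
      ∃ b : S → M, ContMDiff (𝓡 k) (𝓡 n) ∞ b ∧ (∀ s, dist (b s) (ι s) < ε) ∧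
        (∀ s, χ s = 1 → b s = a' s) ∧ (∀ s, a s = a' s → b s = a' s) ∧
        formIntegral o (α.pullback b) = formIntegral o (α.pullback a) := by
  set ψ := chartAt (EuclideanSpace ℝ (Fin n)) (ι x) with hψdef
  have hψ : ψ ∈ IsManifold.maximalAtlas (𝓡 n) ∞ M := IsManifold.chart_mem_maximalAtlas _
  have hx : ι x ∈ ψ.source := mem_chart_source _ _
  obtain ⟨r, hr, hball⟩ := Metric.isOpen_iff.1 ψ.open_target (ψ (ι x)) (ψ.map_source hx)
  set C := Metric.ball (ψ (ι x)) r with hCdef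
  have hC : Convex ℝ C := convex_ball _ _
  set O : Set M := ψ.source ∩ ψ ⁻¹' C with hOdef
  have hO : IsOpen O := ψ.continuousOn.isOpen_inter_preimage ψ.open_source Metric.isOpen_ball
  have hxO : ι x ∈ O := ⟨hx, Metric.mem_ball_self hr⟩
  obtain ⟨B, hBO, hBx⟩ := exists_orientedBox o x
    (hι.continuous.continuousAt.preimage_mem_nhds (hO.mem_nhds hxO))
  obtain ⟨f, -, hf⟩ := (SmoothBumpFunction.nhds_basis_tsupport (I := 𝓡 k) x).mem_iff.1 hBx
  have hf01 : ∀ s, f s ∈ Icc (0 : ℝ) 1 := fun s => ⟨f.nonneg, f.le_one⟩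
  refine ⟨f, f.eventuallyEq_one, fun ε hε => ?_⟩
  set K : Set S := B.F '' Icc B.a B.b with hKdef
  have hK : IsCompact K := isCompact_Icc.image_of_continuousOn
    fun u hu => (B.contMDiffAt (B.subset hu)).continuousAt.continuousWithinAt
  have hKO : ∀ s ∈ K, ι s ∈ O := by
    rintro _ ⟨u, hu, rfl⟩
    exact hBO ⟨u, B.subset hu, rfl⟩
  -- uniform control of the chart segments over the compact set `K`
  have hP : ∀ᶠ δ in 𝓝 (0 : ℝ), ∀ s ∈ K, ∀ p p' : M, dist p (ι s) < δ → dist p' (ι s) < δ →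
      p ∈ O ∧ p' ∈ O ∧ dist (chartSegment ψ (f s) p p') (ι s) < ε := by
    refine hK.eventually_forall_of_forall_eventually fun s hs => ?_
    have hsO := hKO s hs
    have hcont : ContinuousAt (fun z : S × M × M => chartSegment ψ (f z.1) z.2.1 z.2.2)
        (s, ι s, ι s) := by
      have c1 : ContinuousAt (fun z : S × M × M => ψ z.2.1) (s, ι s, ι s) :=
        ContinuousAt.comp (f := fun z : S × M × M => z.2.1) (ψ.continuousAt hsO.1)
          (by fun_prop)
      have c2 : ContinuousAt (fun z : S × M × M => ψ z.2.2) (s, ι s, ι s) :=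
        ContinuousAt.comp (f := fun z : S × M × M => z.2.2) (ψ.continuousAt hsO.1)
          (by fun_prop)
      have c3 : ContinuousAt (fun z : S × M × M => f z.1) (s, ι s, ι s) :=
        (f.continuous.comp continuous_fst).continuousAt
      have c4 : ContinuousAt (fun z : S × M × M => ψ z.2.1 + f z.1 • (ψ z.2.2 - ψ z.2.1))
        (s, ι s, ι s) := c1.add (c3.smul (c2.sub c1))
      refine ContinuousAt.comp (g := ψ.symm) ?_ c4
      exact ψ.continuousAt_symm (hball (segment_mem hC hsO.2 hsO.2 (hf01 s)))
    have hval : chartSegment ψ (f s) (ι s) (ι s) = ι s := chartSegment_self hsO.1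
    have hev : ∀ᶠ z : S × M × M in 𝓝 (s, ι s, ι s), z.2.1 ∈ O ∧ z.2.2 ∈ O ∧
        dist (chartSegment ψ (f z.1) z.2.1 z.2.2) (ι z.1) < ε := by
      have e1 : ∀ᶠ z : S × M × M in 𝓝 (s, ι s, ι s), z.2.1 ∈ O :=
        (continuous_fst.comp continuous_snd).continuousAt.eventually (hO.mem_nhds hsO)
      have e2 : ∀ᶠ z : S × M × M in 𝓝 (s, ι s, ι s), z.2.2 ∈ O :=
        (continuous_snd.comp continuous_snd).continuousAt.eventually (hO.mem_nhds hsO)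
      have e3 : ContinuousAt (fun z : S × M × M =>
          dist (chartSegment ψ (f z.1) z.2.1 z.2.2) (ι z.1)) (s, ι s, ι s) :=
        hcont.dist (hι.continuous.comp continuous_fst).continuousAt
      have e4 := e3.eventually_lt_const (u := ε) (by simpa [hval] using hε)
      filter_upwards [e1, e2, e4] with z h1 h2 h3 using ⟨h1, h2, h3⟩
    rw [nhds_prod_eq, nhds_prod_eq] at hev
    obtain ⟨A, hA, A', hA', hAA⟩ := Filter.mem_prod_iff.1 hev
    obtain ⟨A₁, hA₁, A₂, hA₂, hAA'⟩ := Filter.mem_prod_iff.1 hA'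
    obtain ⟨ρ, hρ, hρA⟩ := Metric.mem_nhds_iff.1 (inter_mem hA₁ hA₂)
    have e5 : ∀ᶠ z : ℝ × S in 𝓝 (0, s), z.1 < ρ / 2 :=
      continuous_fst.continuousAt.eventually_lt_const (by simpa using half_pos hρ)
    have e6 : ∀ᶠ z : ℝ × S in 𝓝 (0, s), z.2 ∈ A ∧ dist (ι z.2) (ι s) < ρ / 2 := by
      refine continuous_snd.continuousAt.eventually (p := fun s' => s' ∈ A ∧
        dist (ι s') (ι s) < ρ / 2) (Filter.Eventually.and hA ?_)
      exact hι.continuous.continuousAt.eventually (Metric.ball_mem_nhds _ (half_pos hρ))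
    filter_upwards [e5, e6] with z hz1 hz2 p p' hp hp'
    have hpA : p ∈ A₁ ∩ A₂ := hρA (by
      rw [Metric.mem_ball]; linarith [dist_triangle p (ι z.2) (ι s)])
    have hpA' : p' ∈ A₁ ∩ A₂ := hρA (by
      rw [Metric.mem_ball]; linarith [dist_triangle p' (ι z.2) (ι s)])
    exact hAA (show (z.2, p, p') ∈ A ×ˢ A' from ⟨hz2.1, hAA' ⟨hpA.1, hpA'.2⟩⟩)
  obtain ⟨δ₀, hδ₀, hδ⟩ := Metric.eventually_nhds_iff.1 hP
  have hδ' := hδ (y := δ₀ / 2) (by rw [Real.dist_eq, sub_zero, abs_of_pos] <;> linarith)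
  refine ⟨min ε (δ₀ / 2), lt_min hε (half_pos hδ₀), fun a a' ha ha' hda hda' => ?_⟩
  have hall : ∀ s ∈ K, a s ∈ O ∧ a' s ∈ O ∧ dist (chartSegment ψ (f s) (a s) (a' s)) (ι s) < ε :=
    fun s hs => hδ' s hs _ _ ((hda s).trans_le (min_le_right _ _))
      ((hda' s).trans_le (min_le_right _ _))
  have hfK : tsupport f ⊆ K := hf.trans B.inner_subset
  obtain ⟨hb, hbI⟩ := formIntegral_blend o B hψ hC hball f.contMDiff hf01 hf ha ha'
    (fun u hu => ⟨(hall _ ⟨u, hu, rfl⟩).1, (hall _ ⟨u, hu, rfl⟩).2.1⟩) hα hαc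
  refine ⟨blend ψ f a a', hb, fun s => ?_, fun s hs => ?_, fun s hs => ?_, hbI⟩
  · by_cases h : s ∈ tsupport f
    · have h1 := hall s (hfK h)
      rw [blend_eq_chartSegment h1.1.1]
      exact h1.2.2
    · rw [blend_of_notMem h]
      exact (hda s).trans_le (min_le_left _ _)
  · have h : s ∈ tsupport f := subset_closure (by simp [hs])
    have h1 := hall s (hfK h)
    rw [blend_eq_chartSegment h1.1.1, hs, chartSegment_one h1.2.1.1]
  · by_cases h : s ∈ tsupport f
    · have h1 := hall s (hfK h)
      rw [blend_eq_chartSegment h1.1.1, hs, chartSegment_self h1.2.1.1]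
    · rw [blend_of_notMem h, hs]

/-- The integral of the pullback of a closed form is the same for all uniformly close maps. One map
is deformed into the other in finitely many steps, each inside one box of `S` and one chart
of `M`. -/
lemma exists_dist_formIntegral_eq (o : ManifoldOrientation k S) {ι : S → M}
    (hι : ContMDiff (𝓡 k) (𝓡 n) ∞ ι) {α : DiffForm k n M} (hα : α.IsSmooth)
    (hαc : α.IsClosed) : ∃ δ > 0, ∀ a' : S → M, ContMDiff (𝓡 k) (𝓡 n) ∞ a' →
      (∀ s, dist (a' s) (ι s) < δ) →
      formIntegral o (α.pullback a') = formIntegral o (α.pullback ι) := by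
  classical
  choose χ hχ1 hχ using exists_blend_step o hι hα hαc
  obtain ⟨T, -, hT⟩ := isCompact_univ.elim_nhds_subcover (fun x => {s | χ x s = 1})
    fun x _ => hχ1 x
  -- the points where one of the cut-off functions `χ x`, `x ∈ T`, equals `1` are those where the
  -- map has already been replaced by `a'`
  have key : ∀ T : Finset S, ∀ ε > 0, ∃ δ > 0, ∀ a' : S → M, ContMDiff (𝓡 k) (𝓡 n) ∞ a' →
      (∀ s, dist (a' s) (ι s) < δ) → ∃ a : S → M, ContMDiff (𝓡 k) (𝓡 n) ∞ a ∧
        (∀ s, dist (a s) (ι s) < ε) ∧ (∀ s, (∃ x ∈ T, χ x s = 1) → a s = a' s) ∧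
        formIntegral o (α.pullback a) = formIntegral o (α.pullback ι) := by
    intro T
    induction T using Finset.induction_on with
    | empty =>
      exact fun ε hε => ⟨1, one_pos, fun a' _ _ => ⟨ι, hι, fun s => by simpa using hε,
        fun s ⟨x, hx, _⟩ => absurd hx (Finset.notMem_empty x), rfl⟩⟩
    | insert x T _ ih =>
      intro ε hε
      obtain ⟨δ₁, hδ₁, h₁⟩ := hχ x ε hε
      obtain ⟨δ₂, hδ₂, h₂⟩ := ih δ₁ hδ₁
      refine ⟨min δ₁ δ₂, lt_min hδ₁ hδ₂, fun a' ha' hda' => ?_⟩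
      obtain ⟨a, ha, hda, haT, haI⟩ := h₂ a' ha' fun s => (hda' s).trans_le (min_le_right _ _)
      obtain ⟨b, hb, hdb, hbχ, hba, hbI⟩ := h₁ a a' ha ha' hda
        fun s => (hda' s).trans_le (min_le_left _ _)
      refine ⟨b, hb, hdb, fun s ⟨y, hy, hys⟩ => ?_, hbI.trans haI⟩
      rcases Finset.mem_insert.1 hy with rfl | hy
      · exact hbχ s hys
      · exact hba s (haT s ⟨y, hy, hys⟩)
  obtain ⟨δ, hδ, h⟩ := key T 1 one_pos
  refine ⟨δ, hδ, fun a' ha' hda' => ?_⟩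
  obtain ⟨a, -, -, haT, haI⟩ := h a' ha' hda'
  have : a = a' := by
    funext s
    have hs := hT (mem_univ s)
    simp only [mem_iUnion] at hs
    obtain ⟨x, hx, hxs⟩ := hs
    exact haT s ⟨x, hx, hxs⟩
  rw [← this, haI]

end LocallyConstant

/-! ### The calibration inequality -/

section Sign

variable {k : ℕ} {V W : Type*} [AddCommGroup V] [Module ℝ V] [AddCommGroup W] [Module ℝ W]

/-- An isomorphism carrying the orientation along preserves the signs of frames; these do not depend
on the form chosen to represent an orientation. -/
lemma frameSign_map (e : V ≃ₗ[ℝ] W) (o : Orientation ℝ V (Fin k)) (v : Fin k → V) :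
    frameSign (Orientation.map (Fin k) e o) (fun i => e (v i)) = frameSign o v := by
  have h0 : o.someVector.compLinearMap (e.symm : W →ₗ[ℝ] V) ≠ 0 := by
    intro h
    apply o.someVector_ne_zero
    ext u
    simpa using congrArg (fun μ => μ (fun i => e (u i))) h
  have h : SameRay ℝ (Orientation.map (Fin k) e o).someVector
      (o.someVector.compLinearMap (e.symm : W →ₗ[ℝ] V)) := by
    refine (ray_eq_iff (Module.Ray.someVector_ne_zero _) h0).1 ?_
    rw [Module.Ray.someVector_ray]
    conv_lhs => rw [← o.someVector_ray]
    exact Orientation.map_apply (Fin k) e _ o.someVector_ne_zero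
  obtain ⟨r, hr, h⟩ := h.exists_pos_left (Module.Ray.someVector_ne_zero _) h0
  have h1 : r * (Orientation.map (Fin k) e o).someVector (fun i => e (v i)) = o.someVector v := by
    simpa using congrArg (fun μ => μ (fun i => e (v i))) h
  rw [frameSign, frameSign, ← h1, sign_mul, sign_pos hr, one_mul]

end Sign

section Calibrated

variable {k n : ℕ} {S M : Type*}
  [TopologicalSpace S] [ChartedSpace (EuclideanSpace ℝ (Fin k)) S]
  [TopologicalSpace M] [ChartedSpace (EuclideanSpace ℝ (Fin n)) M] [IsManifold (𝓡 n) ∞ M]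
  {o : ManifoldOrientation k S} {U : Set (OrientedPlane k n M)} {g : Metric n M} {f : U → ℝ}
  {α : DiffForm k n M}

/-- A form which is `c` times the volume form of the tangent plane pulls back to `c` times the
induced volume form. -/
lemma pullback_eq_of_tangentPlane {ι : S → M} {x : S}
    (h : Function.Injective (mfderiv (𝓡 k) (𝓡 n) ι x)) {c : ℝ}
    (hc : ∀ v : Fin k → (tangentPlane o ι x h).plane, α (tangentPlane o ι x h).base (fun i => v i) =
      c * planeVolume g (tangentPlane o ι x h) v) (v : Fin k → TangentSpace (𝓡 k) x) :
    α.pullback ι x v = c * inducedVolume g o ι x v := by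
  refine (hc fun i => LinearEquiv.ofInjective
    (mfderiv (𝓡 k) (𝓡 n) ι x : TangentSpace (𝓡 k) x →ₗ[ℝ] TangentSpace (𝓡 n) (ι x)) h
      (v i)).trans ?_
  congr 1
  have := frameSign_map (LinearEquiv.ofInjective
    (mfderiv (𝓡 k) (𝓡 n) ι x : TangentSpace (𝓡 k) x →ₗ[ℝ] TangentSpace (𝓡 n) (ι x)) h)
    (o.at_ x) v
  exact congrArg₂ (· * ·) this rfl

/-- For a calibrated immersion, the calibration inequality is an equality at every point. -/
lemma Imm.anisotropicVolume_eq_pullback (ι : Imm o U)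
    (hι : ∀ x : S, (ι.plane x : OrientedPlane k n M) ∈ calibratedPlanes g U f α) :
    ι.anisotropicVolume g f = α.pullback ι.map := by
  funext x v
  obtain ⟨h, hc⟩ := hι x
  exact (pullback_eq_of_tangentPlane (ι.injective_mfderiv x) hc v).symm

/-- The pointwise calibration inequality. The sign of the frame turns the inequality of `k`-forms
into one of densities. -/
lemma Imm.frameSign_mul_pullback_le (hα : IsAnisotropicCalibration g U f α) (ι : Imm o U) (x : S)
    (v : Fin k → TangentSpace (𝓡 k) x) :
    frameSign (o.at_ x) v * α.pullback ι.map x v ≤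
      frameSign (o.at_ x) v * ι.anisotropicVolume g f x v := by
  obtain ⟨c, hcf, hc⟩ := hα.le_vol (ι.plane x)
  rw [pullback_eq_of_tangentPlane (ι.injective_mfderiv x) hc v, Imm.anisotropicVolume,
    inducedVolume, mul_left_comm, mul_left_comm _ (f _)]
  refine mul_le_mul_of_nonneg_right hcf ?_
  rw [← mul_assoc]
  exact mul_nonneg (mul_self_nonneg _) (Real.sqrt_nonneg _)

variable [IsManifold (𝓡 k) ∞ S] [T2Space S] [CompactSpace S]

/-- The integrated calibration inequality. -/
lemma formIntegral_pullback_le_volF (hα : IsAnisotropicCalibration g U f α) {ι : Imm o U}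
    (hdef : VolDefined g f ι) : formIntegral o (α.pullback ι.map) ≤ volF g f ι := by
  rw [volF, formIntegral_eq_sum, formIntegral_eq_sum]
  refine Finset.sum_le_sum fun i _ => ?_
  refine integral_mono
    ((pullDifferentiable_pullForm ι.map.contMDiff hα.isSmooth).formIntegrable o i) (hdef i)
    fun y => ?_
  exact mul_le_mul_of_nonneg_left (ι.frameSign_mul_pullback_le hα _ _)
    ((chartPartition k S).nonneg i _)

end Calibrated

/-! ### Periods of closed forms -/

section Periods

variable {k n : ℕ} {S M : Type*}
  [TopologicalSpace S] [ChartedSpace (EuclideanSpace ℝ (Fin k)) S]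
  [IsManifold (𝓡 k) ∞ S] [T2Space S] [CompactSpace S]
  [TopologicalSpace M] [ChartedSpace (EuclideanSpace ℝ (Fin n)) M] [IsManifold (𝓡 n) ∞ M]
  {R : Type*} [CommRing R] [Algebra R ℝ]

lemma chainIntegral_pushChain_eq_formIntegral {o : ManifoldOrientation k S} {c : Chain k S R k}
    (hc : IsFundamentalCycle o c) (ι : C^∞⟮𝓡 k, S; 𝓡 n, M⟯) {β : DiffForm k n M}
    (hβ : β.IsSmooth) : chainIntegral (pushChain ι c) β = formIntegral o (β.pullback ι) := by
  rw [chainIntegral_pushChain,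
    chainIntegral_eq_formIntegral o hc (pullDifferentiable_pullForm ι.contMDiff hβ)]
  rfl

lemma HomologousMaps.formIntegral_eq {o : ManifoldOrientation k S}
    {ι ι' : C^∞⟮𝓡 k, S; 𝓡 n, M⟯} (h : HomologousMaps R o ι ι') {β : DiffForm k n M}
    (hβ : β.IsSmooth) (hβc : β.IsClosed) :
    formIntegral o (β.pullback ι) = formIntegral o (β.pullback ι') := by
  obtain ⟨c, hc, hb⟩ := h
  rw [← chainIntegral_pushChain_eq_formIntegral hc ι hβ,
    ← chainIntegral_pushChain_eq_formIntegral hc ι' hβ]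
  exact chainIntegral_eq_of_isBoundary_sub (IsSmooth.pullDifferentiable hβ)
    (IsClosed.pullClosed hβ hβc) hb

lemma RepresentsClass.formIntegral_eq {o : ManifoldOrientation k S}
    {ι : C^∞⟮𝓡 k, S; 𝓡 n, M⟯} {z : Chain n M R k} (h : RepresentsClass o ι z)
    {β : DiffForm k n M} (hβ : β.IsSmooth) (hβc : β.IsClosed) :
    formIntegral o (β.pullback ι) = chainIntegral z β := by
  obtain ⟨c, hc, hb⟩ := h
  rw [← chainIntegral_pushChain_eq_formIntegral hc ι hβ]
  exact (chainIntegral_eq_of_isBoundary_sub (IsSmooth.pullDifferentiable hβ)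
    (IsClosed.pullClosed hβ hβc) hb).symm

/-- Cohomologous forms have the same integral over a closed oriented manifold. -/
lemma formIntegral_eq_of_isExact_sub (o : ManifoldOrientation k S) (ι : C^∞⟮𝓡 k, S; 𝓡 n, M⟯)
    {α β : DiffForm k n M} (hα : α.IsSmooth) (hβ : β.IsSmooth)
    (h : DiffForm.IsExact (β - α)) :
    formIntegral o (α.pullback ι) = formIntegral o (β.pullback ι) := by
  cases k with
  | zero => rw [sub_eq_zero.1 (show β - α = 0 from h)]
  | succ k =>
    obtain ⟨η, hη, hd⟩ := h
    have hA := pullDifferentiable_pullForm ι.contMDiff hα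
    have hB := pullDifferentiable_pullForm ι.contMDiff hβ
    have hsub : (pullForm ι (β - α) : DiffForm (k + 1) (k + 1) S) =
        pullForm ι β - pullForm ι α := by
      funext x; ext v; rfl
    have h0 := formIntegral_eq_zero_of_hasExtDeriv o
      (pullDifferentiable_pullForm ι.contMDiff hη) (hsub ▸ hB.sub hA)
      (pullHasExtDeriv_pullForm ι.contMDiff hη hd)
    rw [hsub, formIntegral_sub o hB hA] at h0
    exact (sub_eq_zero.1 h0).symm

end Periods

/-! ### Immersions close in the `C¹` topology -/

section NearbyImmersions

variable {k n : ℕ} {S M : Type*}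
  [TopologicalSpace S] [ChartedSpace (EuclideanSpace ℝ (Fin k)) S]
  [TopologicalSpace M] [ChartedSpace (EuclideanSpace ℝ (Fin n)) M]
  [IsManifold (𝓡 k) ∞ S] [IsManifold (𝓡 n) ∞ M]
  {o : ManifoldOrientation k S} {U : Set (OrientedPlane k n M)}

/-- The `C¹` topology is finer than the compact-open topology: a map is recovered from its
differential by restricting to the zero section and projecting. -/
lemma Imm.continuous_map : Continuous (fun ι : Imm o U =>
    (⟨ι.map, ι.map.contMDiff.continuous⟩ : C(S, M))) := by
  have hz : Continuous (fun x : S => (⟨x, 0⟩ : TangentBundle (𝓡 k) S)) :=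
    (Bundle.contMDiff_zeroSection (IB := 𝓡 k) (n := 0) ℝ
      (TangentSpace (𝓡 k) : S → Type _)).continuous
  have hp : Continuous (fun v : TangentBundle (𝓡 n) M => v.proj) :=
    FiberBundle.continuous_proj (EuclideanSpace ℝ (Fin n)) (TangentSpace (𝓡 n) : M → Type _)
  let z : C(S, TangentBundle (𝓡 k) S) := ⟨_, hz⟩
  let π : C(TangentBundle (𝓡 n) M, M) := ⟨_, hp⟩
  have h : Continuous fun T : C(TangentBundle (𝓡 k) S, TangentBundle (𝓡 n) M) =>
      π.comp (T.comp z) := by fun_prop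
  have hT : Continuous fun ι : Imm o U => (⟨tangentMap (𝓡 k) (𝓡 n) ι.map,
      ι.map.contMDiff.continuous_tangentMap (by simp)⟩ :
        C(TangentBundle (𝓡 k) S, TangentBundle (𝓡 n) M)) := continuous_induced_dom
  exact h.comp hT

variable [T2Space S] [CompactSpace S] [T2Space M] [SecondCountableTopology M]

/-- The integral of a closed form over an immersion is locally constant in the `C¹` topology. -/
lemma Imm.eventually_formIntegral_eq (ι : Imm o U) {α : DiffForm k n M} (hα : α.IsSmooth)
    (hαc : α.IsClosed) :
    ∀ᶠ ι' : Imm o U in 𝓝 ι,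
      formIntegral o (α.pullback ι'.map) = formIntegral o (α.pullback ι.map) := by
  have : LocallyCompactSpace M := Manifold.locallyCompact_of_finiteDimensional (𝓡 n)
  have : SigmaCompactSpace M := inferInstance
  have : TopologicalSpace.MetrizableSpace M := Manifold.metrizableSpace (𝓡 n) M
  let _ : MetricSpace M := TopologicalSpace.metrizableSpaceMetric M
  obtain ⟨δ, hδ, h⟩ := exists_dist_formIntegral_eq o ι.map.contMDiff hα hαc
  filter_upwards [Imm.continuous_map.continuousAt.eventually (Metric.ball_mem_nhds _ hδ)]
    with ι' hι'
  exact h _ ι'.map.contMDiff fun s => (ContinuousMap.dist_apply_le_dist s).trans_lt hι'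

end NearbyImmersions

end

end AnisotropicCalibration

theorem mainTheorem2 {k n : ℕ}
    {S : Type*} [TopologicalSpace S] [ChartedSpace (EuclideanSpace ℝ (Fin k)) S]
    [IsManifold (𝓡 k) ∞ S] [T2Space S] [CompactSpace S] (o : ManifoldOrientation k S)
    {M : Type*} [TopologicalSpace M] [ChartedSpace (EuclideanSpace ℝ (Fin n)) M]
    [IsManifold (𝓡 n) ∞ M] [T2Space M] [SecondCountableTopology M] (g : Metric n M)
    (U : Set (OrientedPlane k n M)) (f : U → ℝ)
    (α : DiffForm k n M) (hα : IsAnisotropicCalibration g U f α)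
    (ι : Imm o U)
    (hι : ∀ x : S, (ι.plane x : OrientedPlane k n M) ∈ calibratedPlanes g U f α)
    (R : Type*) [CommRing R] [Algebra R ℝ] :
    VolDefined g f ι ∧
    -- minimality in the restricted homology class
    (∀ ι' : Imm o U, VolDefined g f ι' → HomologousMaps R o ι.map ι'.map →
      volF g f ι ≤ volF g f ι') ∧
    -- local minimality in the `C¹` topology
    IsLocalMinOn (volF g f) {ι' : Imm o U | VolDefined g f ι'} ι ∧
    -- the minimum is the pairing of the classes of `α` and of `ι`
    (∀ β : DiffForm k n M, β.IsSmooth → β.IsClosed → DiffForm.IsExact (β - α) →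
      volF g f ι = formIntegral o (β.pullback ι.map) ∧
      ∀ z : Chain n M R k, RepresentsClass o ι.map z → volF g f ι = chainIntegral z β) := by
  have hvol := ι.anisotropicVolume_eq_pullback hι
  have hval : volF g f ι = formIntegral o (α.pullback ι.map) := by rw [volF, hvol]
  refine ⟨?_, fun ι' hι' h => ?_, ?_, fun β hβ hβc hex => ?_⟩
  · rw [VolDefined, hvol]
    exact (pullDifferentiable_pullForm ι.map.contMDiff hα.isSmooth).formIntegrable o
  · rw [hval, h.formIntegral_eq hα.isSmooth hα.isClosed]
    exact formIntegral_pullback_le_volF hα hι'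
  · filter_upwards [self_mem_nhdsWithin,
      mem_nhdsWithin_of_mem_nhds (ι.eventually_formIntegral_eq hα.isSmooth hα.isClosed)]
      with ι' hι' heq
    rw [hval, ← heq]
    exact formIntegral_pullback_le_volF hα hι'
  · rw [hval, formIntegral_eq_of_isExact_sub o ι.map hα.isSmooth hβ hex]
    exact ⟨rfl, fun z hz => hz.formIntegral_eq hβ hβc⟩
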